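/- **Setting.** Let $U=\{0,\dots,u-1\}$ and $R=\{0,\dots,r-1\}$ with $1<r\le u$, $\log=\log_2$. Functions are evaluated with words of $\kappa\lceil\log u\rceil$ bits, $\kappa\ge 1$ an absolute constant; a key is one word, and the evaluation time is the number of elementary word operations (constants, $+,-,\cdot$, integer division and remainder, bitwise operations, shifts, comparison, reading one memory word). A data structure draws its random choices uniformly from a finite set, and from them fills a memory; it represents the function $h\colon U\to R$ that a fixed program, not depending on the random choices, computes from the memory. Its size is the number of memory bits plus the number of bits of all constants in the program. A hash class is a finite family of functions from which one is drawn uniformly by its index. A class of functions $N\text{-set}\to\{0,\dots,m-1\}$ is *2-universal* if any two distinct keys collide with probability at most $2/m$, and *2-wise independent* if the values of any two distinct keys are uniform on pairs. Given a 2-wise independent class $\mathcal H$ with range $\{0,\dots,m-1\}$ and a 2-universal class $\mathcal F$ with range $\{0,\dots,\ell-1\}$, a random pair $(h_1,h_2)$ from $\mathcal Z^{c,2}_{\ell,m}$ is $h_i(x)=\bigl(f_i(x)+\sum_{j=1}^{c} z^{(i)}[j,g_j(x)]\bigr)\bmod m$, where $f_1,f_2\in\mathcal H$, $g_1,\dots,g_c\in\mathcal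 F$ and all table entries $z^{(i)}[j,k]\in\{0,\dots,m-1\}$ are chosen independently and uniformly at random. **Theorem.** There are absolute constants $\kappa\ge1$ and $C$ such that for all real $0<\delta<1$, $\varepsilon>0$, $s\ge0$ there are a constant $D$, a function $g(n)=o(n)$ and a number $n_0$ (depending only on $\delta,\varepsilon,s$) such that for all integers $n\ge1$ and $1<r\le u$ there is a data structure $\mathrm{DS}_n$ representing a random function $h\colon U\to R$ with: 1. For each $S\subseteq U$ of size $n$ there is an event $B_S$ of probability at most $D/n^{s+1}$ such that, conditioned on $\overline{B_S}$, the restriction of $h$ to $S$ is uniform among all functions $S\to R$. 2. For every $x\in U$, $h(x)$ is evaluated in time at most $C\max\{s,1\}/\delta$. 3. $\mathrm{DS}_n$ comprises at most $2(1+\varepsilon)n\log|R|+g(n)+D\log\log|U|$ bits. 4. If $n_0\le n\le u$, then $\mathrm{DS}_n$ is built from $\mathcal Z$ and random tables: there are integers $c\ge(s+2)/\delta$, $\ell=\lceil n^\delta\rceil$, $m\le(1+\varepsilon)n$, $N\le D n^{s+3}$, classes $\mathcal H$ (2-wise independent) and $\mathcal F$ (2-universal) as above on $\{0,\dots,N-1\}$,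 a 2-wise independent class $\mathcal K$ from $\{0,\dots,N-1\}$ to $R$, and a class $\mathcal C$ of functions $U\to\{0,\dots,N-1\}$ under which any two distinct keys collide with probability at most $D/n^{s+3}$, such that $$h(x)=\Bigl(t_1[h_1(x')]+t_2[h_2(x')]+f(x')+\sum_{j=1}^{c}y_j[g_j(x')]\Bigr)\bmod r,\qquad x'=q(x),$$ with $q\in\mathcal C$, $(h_1,h_2)\in\mathcal Z^{c,2}_{\ell,m}$ (with components $g_1,\dots,g_c$), $t_1,t_2\in R^m$, $y_1,\dots,y_c\in R^\ell$ and $f\in\mathcal K$ chosen independently and uniformly at random. -/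

import Mathlib

open scoped Asymptotics

namespace UniformHashing

/-! ### Word programs

A key is a number below `|U|`, and a word consists of `w` bits. A program is a sequence of
elementary word operations. Each operation is executed exactly once, takes one time step, and
writes its result to a fresh register, so the running time is the number of instructions.
Register `0` holds the key at the start. -/

/-- Binary word operations. -/
inductive WordOp
  | add | sub | mul | div | mod | and | or | xor | shl | shr | lt

/-- The value of an operation on words, before truncation to `w` bits. -/
def WordOp.eval (w : ℕ) : WordOp → ℕ → ℕ → ℕ
  | .add, a, b => a + b
  | .sub, a, b => a + 2 ^ w - b
  | .mul, a, b => a * b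
  | .div, a, b => a / b
  | .mod, a, b => a % b
  | .and, a, b => a &&& b
  | .or, a, b => a ||| b
  | .xor, a, b => a ^^^ b
  | .shl, a, b => a * 2 ^ b
  | .shr, a, b => a / 2 ^ b
  | .lt, a, b => if a < b then 1 else 0

/-- Instructions: a constant, a read from the memory word whose address is in register `i`,
or a binary operation on the registers `i` and `j`. -/
inductive Instr
  | const (a : ℕ)
  | load (i : ℕ)
  | op (o : WordOp) (i j : ℕ)

/-- The `k`-th bit of a memory of `b` bits; positions outside the memory read as `0`. -/
def memBit {b : ℕ} (mem : Fin b → Bool) (k : ℕ) : ℕ :=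
  if h : k < b then (mem ⟨k, h⟩).toNat else 0

/-- The `a`-th `w`-bit word of the memory. -/
def memWord (w : ℕ) {b : ℕ} (mem : Fin b → Bool) (a : ℕ) : ℕ :=
  ∑ t ∈ Finset.range w, memBit mem (a * w + t) * 2 ^ t

/-- The word computed by one instruction from the current registers. -/
def Instr.eval (w : ℕ) {b : ℕ} (mem : Fin b → Bool) (regs : List ℕ) : Instr → ℕ
  | .const a => a % 2 ^ w
  | .load i => memWord w mem (regs.getD i 0)
  | .op o i j => o.eval w (regs.getD i 0) (regs.getD j 0) % 2 ^ w

/-- The registers after executing a program, oldest first. -/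
def runRegs (w : ℕ) {b : ℕ} (mem : Fin b → Bool) (prog : List Instr) (x : ℕ) : List ℕ :=
  prog.foldl (fun regs ins => regs ++ [ins.eval w mem regs]) [x]

/-- The output is the content of the last register. -/
def run (w : ℕ) {b : ℕ} (mem : Fin b → Bool) (prog : List Instr) (x : ℕ) : ℕ :=
  (runRegs w mem prog x).getLastD 0

/-- The number of bits of the constant occurring in an instruction. -/
def Instr.constBits : Instr → ℕ
  | .const a => a.size
  | _ => 0

/-! ### Data structures representing a random hash function -/

/-- A data structure for a function from `{0, …, u-1}` to `{0, …, r-1}` over words of `w` bits.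
The set-up draws `ω` uniformly from the finite set `Ω` and fills a memory of `memBits` bits;
`prog`, which does not depend on `ω`, then computes the represented function `h ω`. -/
structure HashDS (u r w : ℕ) where
  Ω : Type
  [fintypeΩ : Fintype Ω]
  [decEqΩ : DecidableEq Ω]
  [nonemptyΩ : Nonempty Ω]
  memBits : ℕ
  mem : Ω → Fin memBits → Bool
  prog : List Instr
  h : Ω → Fin u → Fin r
  run_eq : ∀ (ω : Ω) (x : Fin u), run w (mem ω) prog (x : ℕ) = (h ω x : ℕ)

attribute [instance] HashDS.fintypeΩ HashDS.decEqΩ HashDS.nonemptyΩ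

/-- The evaluation time, the same for every key: the number of executed word operations. -/
def HashDS.time {u r w : ℕ} (ds : HashDS u r w) : ℕ := ds.prog.length

/-- The space in bits: the memory and all constants used by the evaluation procedure. -/
def HashDS.space {u r w : ℕ} (ds : HashDS u r w) : ℕ :=
  ds.memBits + (ds.prog.map Instr.constBits).sum

/-- Probability of an event under the uniform distribution on a finite set. -/
noncomputable def prob {Ω : Type} [Fintype Ω] (A : Finset Ω) : ℝ :=
  (A.card : ℝ) / Fintype.card Ω

/-- Conditioned on the complement of `B`, the restriction of `h` to `S` is uniform among all
functions from `S` to the range: `Pr(h|S = v|S and not B) = Pr(not B) / r ^ |S|`. -/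
def UniformOnOutside {Ω : Type} [Fintype Ω] [DecidableEq Ω] {u r : ℕ}
    (h : Ω → Fin u → Fin r) (S : Finset (Fin u)) (B : Finset Ω) : Prop :=
  ∀ v : Fin u → Fin r,
    prob (Finset.univ.filter fun ω => ω ∉ B ∧ ∀ x ∈ S, h ω x = v x)
      = prob Bᶜ / (r : ℝ) ^ S.card

/-! ### Hash classes

A hash class is a finite family of functions, from which a member is drawn by choosing its index
uniformly at random. -/

/-- `c`-universal: two distinct keys collide with probability at most `c / m`. -/
def IsUniversal (c : ℝ) {k N m : ℕ} (F : Fin k → Fin N → Fin m) : Prop :=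
  ∀ x y : Fin N, x ≠ y →
    prob (Finset.univ.filter fun i => F i x = F i y) ≤ c / m

/-- Two-wise independent. -/
def IsTwoIndependent {k N m : ℕ} (H : Fin k → Fin N → Fin m) : Prop :=
  ∀ x y : Fin N, x ≠ y → ∀ a b : Fin m,
    prob (Finset.univ.filter fun i => H i x = a ∧ H i y = b) = 1 / (m : ℝ) ^ 2

/-- The random choices behind a member of the class `𝒵^{c,d}_{ℓ,m}`: (indices of) the functions
`f₁, …, f_d` and `g₁, …, g_c`, and the tables `z⁽¹⁾, …, z⁽ᵈ⁾`. -/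
abbrev ZSeed (kH kF d c l m : ℕ) : Type :=
  (Fin d → Fin kH) × (Fin c → Fin kF) × (Fin d → Fin c → Fin l → Fin m)

/-- `h_i(x) = (f_i(x) + ∑_j z⁽ⁱ⁾[j, g_j(x)]) mod m`. -/
def zHash {kH kF d c l m N : ℕ} (H : Fin kH → Fin N → Fin m) (F : Fin kF → Fin N → Fin l)
    (ζ : ZSeed kH kF d c l m) (i : Fin d) (x : Fin N) : Fin m :=
  ⟨((H (ζ.1 i) x : ℕ) + ∑ j : Fin c, (ζ.2.2 i j (F (ζ.2.1 j) x) : ℕ)) % m,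
    Nat.mod_lt _ (H (ζ.1 i) x).pos⟩

/-- The random choices of the data structure: the function collapsing the universe, the pair
`(h₁, h₂)` from `𝒵`, the tables `t₁, t₂ ∈ R^m`, the tables `y₁, …, y_c ∈ R^ℓ`, and `f`. -/
abbrev DSSeed (kC kH kF kK c l m r : ℕ) : Type :=
  Fin kC × ZSeed kH kF 2 c l m × (Fin 2 → Fin m → Fin r) × (Fin c → Fin l → Fin r) × Fin kK

/-- `t₁[h₁(x')] ⊕ t₂[h₂(x')] ⊕ f(x') ⊕ y₁[g₁(x')] ⊕ … ⊕ y_c[g_c(x')]`, where `x'` is the image of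
`x` in the collapsed universe and `⊕` is addition modulo `r`. -/
def dsHash {kC kH kF kK c l m r u N : ℕ} (col : Fin kC → Fin u → Fin N)
    (H : Fin kH → Fin N → Fin m) (F : Fin kF → Fin N → Fin l) (K : Fin kK → Fin N → Fin r)
    (σ : DSSeed kC kH kF kK c l m r) (x : Fin u) : ℕ :=
  let x' := col σ.1 x
  let ζ := σ.2.1
  ((σ.2.2.1 0 (zHash H F ζ 0 x') : ℕ) + (σ.2.2.1 1 (zHash H F ζ 1 x') : ℕ)
    + (K σ.2.2.2.2 x' : ℕ) + ∑ j : Fin c, (σ.2.2.2.1 j (F (ζ.2.1 j) x') : ℕ)) % r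

/-- The random function represented by `ds` arises from a random pair `(h₁, h₂)` of the class
`𝒵^{c,2}_{ℓ,m}` and random tables, with `c ≥ (s+2)/δ`, `ℓ = ⌈n^δ⌉` and `m ≤ (1+ε)n`, after the
universe has been collapsed to size `O(n^{s+3})`. The map `π` reads off the random choices, and
having fibres of equal size it makes them uniformly distributed. -/
def BuiltFromZ {u r w : ℕ} (ds : HashDS u r w) (n : ℕ) (δ ε s D : ℝ) : Prop :=
  ∃ (N c l m kC kH kF kK : ℕ) (col : Fin kC → Fin u → Fin N)
    (H : Fin kH → Fin N → Fin m) (F : Fin kF → Fin N → Fin l) (K : Fin kK → Fin N → Fin r),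
    (s + 2) / δ ≤ c ∧ l = ⌈(n : ℝ) ^ δ⌉₊ ∧ (m : ℝ) ≤ (1 + ε) * n ∧
    (N : ℝ) ≤ D * (n : ℝ) ^ (s + 3) ∧
    (∀ x y : Fin u, x ≠ y →
      prob (Finset.univ.filter fun i => col i x = col i y) ≤ D / (n : ℝ) ^ (s + 3)) ∧
    IsTwoIndependent H ∧ IsUniversal 2 F ∧ IsTwoIndependent K ∧
    ∃ π : ds.Ω → DSSeed kC kH kF kK c l m r,
      (∀ σ, prob (Finset.univ.filter fun ω => π ω = σ)
        = 1 / (Fintype.card (DSSeed kC kH kF kK c l m r) : ℝ)) ∧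
      ∀ ω x, (ds.h ω x : ℕ) = dsHash col H F K (π ω) x

end UniformHashing

/-! Regard the keys of S as edges (h₁(x), h₂(x)) of a bipartite multigraph, and call a set of edges
leafless if each endpoint of each of its edges lies on a further edge. The union T of all leafless
subsets of S is leafless. Outside T the keys can be peeled off one by one: each owns, when its turn
comes, an endpoint used by no remaining key, so one entry of t₁ or t₂ sets its value freely. If some
g_j is injective on T, the table y_j sets the values on T. Then the map from (t, y) to the values on
S is a surjective homomorphism of finite groups; its fibres have equal size, the values on S are
uniform, and adding f is only a translation (`exists_tables_of_not_bad`, `card_tables_mul`).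

The bad event is thus a leafless set on which no g_j is injective. Pick a colliding pair for each
g_j. A walk in the leafless set, which may jump to a new key whenever it meets itself, visits these
at most 2c keys with at most 2c jumps (`Leafless.exists_walk`). Cut it at the first moment at which
no g_j is injective (`Bad.exists_walkPattern`). On the s+1 keys before the last, some g_j is still
injective, so the tables z make the 2(s+1) values of h₁ and h₂ uniform. Each of the s steps fixes
one value, whence a walk shape has probability at most (s+2)^{4c} / m^s, while no g_j is injective
on all s+2 keys with probability at most (2(s+2)²/ℓ)^c. There are at most n^{s+2} key sequences, and
m exceeds n by a constant factor, so the sum over s is bounded by a convergent series times m²/ℓ^c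
(`prob_bad_le`). With ℓ ≥ n^δ and c ≥ (s+3)/δ this is O(n^{-(s+1)}).

The universe is collapsed beforehand by reduction modulo a random small prime and multiplicative
hashing. This identifies two keys with probability O(n^{-(s+3)}), hence some pair from S with
probability O(n^{-(s+1)}), and it is described by O(log n + log log u) bits (`exists_collapse`). The
2-wise independent classes are tabulation hashing with O((s+4)/δ) tables of ℓ entries, and 𝓕 is
multiplicative hashing modulo a prime.

For the space bound, k entries of t₁, t₂ are packed into one number in base r, so that rounding to
whole bits costs one bit per k entries. All other tables have O(n^δ) entries and are absorbed into ε
n log r for large n. The function is written as an expression, compiled with one instruction per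
node, and every intermediate value is shown to fit into 8⌈log u⌉ bits (`exists_memory`,
`Admissible.fits`). For small n the bound D/n^{s+1} is at least 1, and a constant function suffices.
-/

namespace UniformHashing

/-! ### Compiling expressions to word programs -/

/-- Expressions over the key, constants, memory reads and word operations. -/
inductive Expr
  | key
  | cst (a : ℕ)
  | load (e : Expr)
  | bin (o : WordOp) (e f : Expr)

namespace Expr

/-- The word denoted by an expression. -/
def val (w : ℕ) {b : ℕ} (mem : Fin b → Bool) (x : ℕ) : Expr → ℕ
  | key => x % 2 ^ w
  | cst a => a % 2 ^ w
  | load e => memWord w mem (e.val w mem x)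
  | bin o e f => o.eval w (e.val w mem x) (f.val w mem x) % 2 ^ w

/-- The number of nodes. -/
def size : Expr → ℕ
  | key => 1
  | cst _ => 1
  | load e => e.size + 1
  | bin _ e f => e.size + f.size + 1

/-- Every constant of the expression is below `B`. -/
def ConstsLt (B : ℕ) : Expr → Prop
  | key => True
  | cst a => a < B
  | load e => e.ConstsLt B
  | bin _ e f => e.ConstsLt B ∧ f.ConstsLt B

/-- The program of an expression when `k` registers are in use; one instruction per node. -/
def code (k : ℕ) : Expr → List Instr
  -- A bitwise "or" of register 0 with itself copies the key and truncates it to a word, in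
  -- agreement with `val`.
  | key => [.op .or 0 0]
  | cst a => [.const a]
  | load e => e.code k ++ [.load (k + e.size - 1)]
  | bin o e f =>
    e.code k ++ f.code (k + e.size) ++ [.op o (k + e.size - 1) (k + e.size + f.size - 1)]

lemma size_pos (e : Expr) : 0 < e.size := by cases e <;> simp [size]

lemma length_code (e : Expr) (k : ℕ) : (e.code k).length = e.size := by
  induction e generalizing k with
  | key => rfl
  | cst a => rfl
  | load e ih => simp [code, size, ih]
  | bin o e f ih₁ ih₂ => simp [code, size, ih₁, ih₂, add_assoc]

/-- Compiled code only appends registers. The induction therefore starts from an arbitrary register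
list and records that old registers survive: the key stays in register 0, and the result of a left
operand remains readable while the right operand is executed. -/
lemma foldl_code {w b : ℕ} (mem : Fin b → Bool) (x : ℕ) (e : Expr) (regs : List ℕ)
    (hr : 0 < regs.length) (hx : regs.getD 0 0 = x) :
    let regs' := (e.code regs.length).foldl (fun regs ins => regs ++ [ins.eval w mem regs]) regs
    regs'.length = regs.length + e.size ∧ (∀ i < regs.length, regs'.getD i 0 = regs.getD i 0) ∧
      regs'.getD (regs.length + e.size - 1) 0 = e.val w mem x := by
  have snoc_lt : ∀ (l : List ℕ) (a i : ℕ), i < l.length → (l ++ [a]).getD i 0 = l.getD i 0 :=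
    fun l a i hi => List.getD_append _ _ _ _ hi
  have snoc_last : ∀ (l : List ℕ) (a : ℕ), (l ++ [a]).getD l.length 0 = a := by
    intro l a; simp
  induction e generalizing regs with
  | key =>
    refine ⟨by simp [code, size], fun i hi => by simpa [code] using snoc_lt _ _ i hi, ?_⟩
    simp [code, size, val, Instr.eval, WordOp.eval]
    simp at hx; simp [hx]
  | cst a =>
    exact ⟨by simp [code, size], fun i hi => by simpa [code] using snoc_lt _ _ i hi,
      by simp [code, size, val, Instr.eval]⟩
  | load e ih =>
    obtain ⟨h1, h2, h3⟩ := ih regs hr hx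
    simp only [code, List.foldl_append, List.foldl_cons, List.foldl_nil, size]
    set R := (e.code regs.length).foldl (fun regs ins => regs ++ [ins.eval w mem regs]) regs
    refine ⟨by simp [h1]; omega, fun i hi => ?_, ?_⟩
    · rw [snoc_lt _ _ i (by omega), h2 i hi]
    · rw [show regs.length + (e.size + 1) - 1 = R.length by omega, snoc_last]
      simp only [Instr.eval, val, h3]
  | bin o e f ih₁ ih₂ =>
    obtain ⟨h1, h2, h3⟩ := ih₁ regs hr hx
    simp only [code, List.foldl_append, List.foldl_cons, List.foldl_nil, size]
    set R := (e.code regs.length).foldl (fun regs ins => regs ++ [ins.eval w mem regs]) regs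
    obtain ⟨g1, g2, g3⟩ := ih₂ R (by omega) (by rw [h2 0 hr, hx])
    rw [h1] at g1 g2 g3
    set R' := (f.code (regs.length + e.size)).foldl
      (fun regs ins => regs ++ [ins.eval w mem regs]) R
    have := e.size_pos
    have := f.size_pos
    refine ⟨by simp [g1]; omega, fun i hi => ?_, ?_⟩
    · rw [snoc_lt _ _ i (by omega), g2 i (by omega), h2 i hi]
    · rw [show regs.length + (e.size + f.size + 1) - 1 = R'.length by omega, snoc_last]
      simp only [Instr.eval, val]
      rw [g3, g2 _ (by omega), h3]

/-- The compiled program computes the value of the expression. -/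
theorem run_code {w b : ℕ} (mem : Fin b → Bool) (x : ℕ) (e : Expr) :
    run w mem (e.code 1) x = e.val w mem x := by
  obtain ⟨h1, -, h3⟩ := foldl_code (w := w) mem x e [x] (by simp) (by simp)
  unfold run runRegs
  rw [← h3]
  simp only [List.length_singleton] at *
  set R := (e.code 1).foldl (fun regs ins => regs ++ [ins.eval w mem regs]) [x]
  have := e.size_pos
  rw [List.getLastD_eq_getLast?, List.getLast?_eq_getElem?, h1]
  rfl

lemma constBits_code_le {β : ℕ} (e : Expr) (he : e.ConstsLt (2 ^ β)) (k : ℕ) :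
    ((e.code k).map Instr.constBits).sum ≤ e.size * β := by
  induction e generalizing k with
  | key => simp [code, Instr.constBits]
  | cst a => simpa [code, Instr.constBits, size] using Nat.size_le.2 he
  | load e ih =>
    have := ih he k
    simp only [code, size, List.map_append, List.sum_append, List.map_cons, List.map_nil,
      List.sum_cons, List.sum_nil, Instr.constBits]
    nlinarith
  | bin o e f ih₁ ih₂ =>
    have := ih₁ he.1 k
    have := ih₂ he.2 (k + e.size)
    simp only [code, size, List.map_append, List.sum_append, List.map_cons, List.map_nil,
      List.sum_cons, List.sum_nil, Instr.constBits]
    nlinarith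

/-! ### Evaluation of expressions when no overflow occurs -/

section values

variable {w b : ℕ} {mem : Fin b → Bool} {x : ℕ} {e f : Expr} {v v' : ℕ}

lemma val_key (h : x < 2 ^ w) : key.val w mem x = x := Nat.mod_eq_of_lt h

lemma val_cst (h : v < 2 ^ w) : (cst v).val w mem x = v := Nat.mod_eq_of_lt h

lemma val_add (he : e.val w mem x = v) (hf : f.val w mem x = v') (h : v + v' < 2 ^ w) :
    (bin .add e f).val w mem x = v + v' := by
  simp only [val, WordOp.eval, he, hf]; exact Nat.mod_eq_of_lt h

lemma val_mul (he : e.val w mem x = v) (hf : f.val w mem x = v') (h : v * v' < 2 ^ w) :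
    (bin .mul e f).val w mem x = v * v' := by
  simp only [val, WordOp.eval, he, hf]; exact Nat.mod_eq_of_lt h

lemma val_div (he : e.val w mem x = v) (hf : f.val w mem x = v') (h : v < 2 ^ w) :
    (bin .div e f).val w mem x = v / v' := by
  simp only [val, WordOp.eval, he, hf]
  exact Nat.mod_eq_of_lt ((Nat.div_le_self _ _).trans_lt h)

lemma val_mod (he : e.val w mem x = v) (hf : f.val w mem x = v') (h : v < 2 ^ w) :
    (bin .mod e f).val w mem x = v % v' := by
  simp only [val, WordOp.eval, he, hf]
  exact Nat.mod_eq_of_lt ((Nat.mod_le _ _).trans_lt h)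

/-- The sum of the first `n` members of a sequence of expressions. -/
def sum (F : ℕ → Expr) : ℕ → Expr
  | 0 => cst 0
  | n + 1 => bin .add (sum F n) (F n)

/-- All partial sums are at most `n * B`, so no intermediate addition is truncated. -/
lemma val_sum {F : ℕ → Expr} {n B : ℕ} {a : ℕ → ℕ} (h : ∀ i < n, (F i).val w mem x = a i)
    (ha : ∀ i < n, a i ≤ B) (hB : n * B < 2 ^ w) :
    (sum F n).val w mem x = ∑ i ∈ Finset.range n, a i := by
  induction n with
  | zero => simp [sum, val]
  | succ n ih =>
    have h1 := ih (fun i hi => h i (by omega)) (fun i hi => ha i (by omega)) (by nlinarith)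
    rw [Finset.sum_range_succ]
    refine val_add h1 (h n (by omega)) (lt_of_le_of_lt ?_ hB)
    have h2 : ∑ i ∈ Finset.range n, a i ≤ n * B := by
      simpa using Finset.sum_le_card_nsmul (Finset.range n) a B
        (fun i hi => ha _ (by have := Finset.mem_range.1 hi; omega))
    have := ha n (by omega)
    nlinarith

lemma size_sum {F : ℕ → Expr} {B : ℕ} (h : ∀ i, (F i).size = B) (n : ℕ) :
    (sum F n).size = n * (B + 1) + 1 := by
  induction n with
  | zero => simp [sum, size]
  | succ n ih => simp only [sum, size, ih, h]; ring

lemma constsLt_sum {F : ℕ → Expr} {n B : ℕ} (hB : 0 < B) (h : ∀ i < n, (F i).ConstsLt B) :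
    (sum F n).ConstsLt B := by
  induction n with
  | zero => exact hB
  | succ n ih => exact ⟨ih fun i hi => h i (by omega), h n (by omega)⟩

end values

/-- Reads the `b` bits of the memory that start at the bit position given by `e`. -/
def field (w : ℕ) (e : Expr) (b : ℕ) : Expr :=
  bin .mod
    (bin .add
      (bin .shr (load (bin .div e (cst w))) (bin .mod e (cst w)))
      (bin .shl (load (bin .add (bin .div e (cst w)) (cst 1)))
        (bin .sub (cst w) (bin .mod e (cst w)))))
    (cst (2 ^ b))

lemma size_field (w : ℕ) (e : Expr) (b : ℕ) : (field w e b).size = 4 * e.size + 19 := by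
  simp only [field, size]; ring

lemma constsLt_field {w b B : ℕ} {e : Expr} (he : e.ConstsLt B) (hw : w < B) (h1 : 1 < B)
    (hb : 2 ^ b < B) : (field w e b).ConstsLt B := by
  simp [field, ConstsLt, *]

end Expr

/-! ### The memory as a number -/

/-- The memory whose bits are the first `b` binary digits of `M`. -/
def memOf (b M : ℕ) : Fin b → Bool := fun k => M.testBit k

lemma memBit_memOf {b M : ℕ} (hM : M < 2 ^ b) (k : ℕ) :
    memBit (memOf b M) k = (M.testBit k).toNat := by
  unfold memBit memOf
  split_ifs with h
  · rfl
  · rw [Nat.testBit_lt_two_pow (hM.trans_le (Nat.pow_le_pow_right two_pos (not_lt.1 h)))]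
    rfl

lemma sum_testBit_toNat (X w : ℕ) :
    ∑ t ∈ Finset.range w, (X.testBit t).toNat * 2 ^ t = X % 2 ^ w := by
  induction w with
  | zero => simp [Nat.mod_one]
  | succ w ih =>
    rw [Finset.sum_range_succ, ih, Nat.toNat_testBit, Nat.mod_pow_succ, mul_comm (2 ^ w)]

lemma memWord_memOf {b M : ℕ} (hM : M < 2 ^ b) (w a : ℕ) :
    memWord w (memOf b M) a = M / 2 ^ (a * w) % 2 ^ w := by
  rw [← sum_testBit_toNat]
  refine Finset.sum_congr rfl fun t _ => ?_
  rw [memBit_memOf hM, Nat.testBit_div_two_pow, add_comm]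

/-- A field shorter than a word meets at most two consecutive words. The first, shifted right by o
mod w, and the second, shifted left by w - o mod w, add up to M / 2^o modulo 2^w. Truncation to
words is harmless because 2^b divides 2^w; for o mod w = 0 the left shift by w contributes 0. -/
lemma Expr.val_field {w B M x o b : ℕ} {e : Expr} (hM : M < 2 ^ B)
    (he : e.val w (memOf B M) x = o) (ho : o + 1 < 2 ^ w) (hb : b < w) :
    (Expr.field w e b).val w (memOf B M) x = M / 2 ^ o % 2 ^ b := by
  have hw : w < 2 ^ w := Nat.lt_two_pow_self
  have hwp : 0 < w := by omega
  have hs : o % w < w := Nat.mod_lt _ hwp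
  have h2 : 2 ^ b < 2 ^ w := Nat.pow_lt_pow_right one_lt_two hb
  have hdvd : 2 ^ b ∣ 2 ^ w := Nat.pow_dvd_pow 2 hb.le
  have e1 : (Expr.bin .div e (.cst w)).val w (memOf B M) x = o / w :=
    Expr.val_div he (Expr.val_cst hw) (by omega)
  have e2 : (Expr.bin .mod e (.cst w)).val w (memOf B M) x = o % w :=
    Expr.val_mod he (Expr.val_cst hw) (by omega)
  have e3 : (Expr.bin .add (.bin .div e (.cst w)) (.cst 1)).val w (memOf B M) x = o / w + 1 :=
    Expr.val_add e1 (Expr.val_cst (by omega))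
      (lt_of_le_of_lt (Nat.add_le_add_right (Nat.div_le_self _ _) 1) ho)
  have e4 : (Expr.bin .sub (.cst w) (.bin .mod e (.cst w))).val w (memOf B M) x = w - o % w := by
    simp only [Expr.val, WordOp.eval] at e2 ⊢
    rw [e2, Nat.mod_eq_of_lt hw, show w + 2 ^ w - o % w = (w - o % w) + 2 ^ w by omega,
      Nat.add_mod_right, Nat.mod_eq_of_lt (by omega)]
  set X := M / 2 ^ (o / w * w) with hX
  have hXo : M / 2 ^ o = X / 2 ^ (o % w) := by
    rw [hX, Nat.div_div_eq_div_mul, ← pow_add, Nat.div_add_mod']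
  have hX1 : M / 2 ^ ((o / w + 1) * w) = X / 2 ^ w := by
    rw [hX, Nat.div_div_eq_div_mul, ← pow_add, add_mul, one_mul]
  have e5 : (Expr.bin .shr (.load (.bin .div e (.cst w))) (.bin .mod e (.cst w))).val w
      (memOf B M) x = (X % 2 ^ w / 2 ^ (o % w)) % 2 ^ w := by
    rw [Expr.val, WordOp.eval, e2, Expr.val, e1, memWord_memOf hM]
  have e6 : (Expr.bin .shl (.load (.bin .add (.bin .div e (.cst w)) (.cst 1)))
      (.bin .sub (.cst w) (.bin .mod e (.cst w)))).val w (memOf B M) x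
      = (X / 2 ^ w % 2 ^ w * 2 ^ (w - o % w)) % 2 ^ w := by
    rw [Expr.val, WordOp.eval, e4, Expr.val, e3, memWord_memOf hM, hX1]
  have hXs : X / 2 ^ (o % w) = X % 2 ^ w / 2 ^ (o % w) + X / 2 ^ w * 2 ^ (w - o % w) := by
    conv_lhs => rw [← Nat.mod_add_div X (2 ^ w)]
    rw [show (2 : ℕ) ^ w = 2 ^ (o % w) * 2 ^ (w - o % w) by rw [← pow_add]; congr 1; omega,
      mul_assoc, Nat.add_mul_div_left _ _ (by positivity), mul_comm (2 ^ (w - o % w))]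
  have hmod : ∀ {a a' : ℕ}, a ≡ a' [MOD 2 ^ w] → a ≡ a' [MOD 2 ^ b] := fun h => h.of_dvd hdvd
  rw [Expr.field, Expr.val, WordOp.eval, Expr.val_cst h2,
    Nat.mod_eq_of_lt ((Nat.mod_lt _ (by positivity)).trans h2), Expr.val, WordOp.eval, e5, e6]
  rw [hXo, hXs]
  apply hmod
  refine (Nat.mod_modEq _ _).trans (Nat.ModEq.add (Nat.mod_modEq _ _) ?_)
  exact (Nat.mod_modEq _ _).trans (Nat.ModEq.mul_right _ (Nat.mod_modEq _ _))

/-- A field that ends at or below bit `o` depends only on the low `o` bits, so appending data on top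
leaves earlier arrays readable. -/
lemma field_of_mod_eq {M M' o o' b : ℕ} (h : M' % 2 ^ o = M) (hb : o' + b ≤ o) :
    M' / 2 ^ o' % 2 ^ b = M / 2 ^ o' % 2 ^ b := by
  subst h
  refine Nat.eq_of_testBit_eq fun i => ?_
  simp only [Nat.testBit_mod_two_pow, Nat.testBit_div_two_pow]
  by_cases hi : i < b
  · simp [hi, show i + o' < o by omega]
  · simp [hi]

/-- An array of `b`-bit numbers can be appended to a memory. -/
lemma exists_append_array {M o b cnt : ℕ} (hM : M < 2 ^ o) (a : ℕ → ℕ)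
    (ha : ∀ i < cnt, a i < 2 ^ b) :
    ∃ M', M' < 2 ^ (o + cnt * b) ∧ M' % 2 ^ o = M ∧
      ∀ i < cnt, M' / 2 ^ (o + i * b) % 2 ^ b = a i := by
  induction cnt with
  | zero => exact ⟨M, by simpa using hM, Nat.mod_eq_of_lt hM, by simp⟩
  | succ k ih =>
    obtain ⟨M', h1, h2, h3⟩ := ih fun i hi => ha i (by omega)
    have hk := ha k (by omega)
    set P := 2 ^ (o + k * b) with hP
    have hPpos : 0 < P := by positivity
    have hlow : (M' + a k * P) % P = M' := by
      rw [Nat.add_mul_mod_self_right, Nat.mod_eq_of_lt h1]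
    refine ⟨M' + a k * P, ?_, ?_, fun i hi => ?_⟩
    · rw [show o + (k + 1) * b = (o + k * b) + b by ring, pow_add, ← hP]
      nlinarith
    · rw [← h2, ← Nat.mod_mod_of_dvd (M' + a k * P) (Nat.pow_dvd_pow 2 (Nat.le_add_right o (k * b))),
        ← hP, hlow]
    · rcases Nat.lt_succ_iff_lt_or_eq.1 hi with hi | rfl
      · rw [field_of_mod_eq (o := o + k * b) hlow (by nlinarith), h3 i hi]
      · rw [← hP, Nat.add_mul_div_right _ _ hPpos, Nat.div_eq_of_lt h1, zero_add,
          Nat.mod_eq_of_lt hk]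

/-- A memory consisting of three consecutive arrays. -/
lemma exists_three_arrays {n₁ b₁ n₂ b₂ n₃ b₃ : ℕ} (a₁ a₂ a₃ : ℕ → ℕ)
    (h₁ : ∀ i < n₁, a₁ i < 2 ^ b₁) (h₂ : ∀ i < n₂, a₂ i < 2 ^ b₂) (h₃ : ∀ i < n₃, a₃ i < 2 ^ b₃) :
    ∃ M, M < 2 ^ (n₁ * b₁ + n₂ * b₂ + n₃ * b₃) ∧
      (∀ i < n₁, M / 2 ^ (i * b₁) % 2 ^ b₁ = a₁ i) ∧
      (∀ i < n₂, M / 2 ^ (n₁ * b₁ + i * b₂) % 2 ^ b₂ = a₂ i) ∧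
      (∀ i < n₃, M / 2 ^ (n₁ * b₁ + n₂ * b₂ + i * b₃) % 2 ^ b₃ = a₃ i) := by
  obtain ⟨M₁, u₁, -, v₁⟩ := exists_append_array (M := 0) (o := 0) (by simp) a₁ h₁
  obtain ⟨M₂, u₂, w₂, v₂⟩ := exists_append_array u₁ a₂ h₂
  obtain ⟨M₃, u₃, w₃, v₃⟩ := exists_append_array u₂ a₃ h₃
  simp only [zero_add] at *
  refine ⟨M₃, u₃, fun i hi => ?_, fun i hi => ?_, v₃⟩
  · rw [field_of_mod_eq w₃ (by nlinarith), field_of_mod_eq w₂ (by nlinarith), v₁ i hi]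
  · rw [field_of_mod_eq w₃ (by nlinarith), v₂ i hi]

end UniformHashing

namespace UniformHashing

/-! ### Hash classes -/

/-- The fibres of a surjective additive map between finite groups have equal size. -/
lemma card_fiber_mul_card {G A : Type*} [AddCommGroup G] [AddCommGroup A] [Fintype G] [Fintype A]
    [DecidableEq A] (φ : G → A) (hadd : ∀ x y, φ (x + y) = φ x + φ y)
    (hsurj : Function.Surjective φ) (v : A) :
    (Finset.univ.filter fun g => φ g = v).card * Fintype.card A = Fintype.card G := by
  have key : ∀ v', (Finset.univ.filter fun g => φ g = v').card
      = (Finset.univ.filter fun g => φ g = v).card := fun v' =>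
    AddMonoidHom.card_fiber_eq_of_mem_range (AddMonoidHom.mk' φ hadd) (hsurj v') (hsurj v)
  have h := Finset.card_eq_sum_card_fiberwise (f := φ) (s := Finset.univ) (t := Finset.univ)
    (fun _ _ => Finset.mem_coe.2 (Finset.mem_univ _))
  rw [Finset.sum_congr rfl fun v' _ => key v'] at h
  rw [← Finset.card_univ (α := G), h, Finset.sum_const, Finset.card_univ, smul_eq_mul, mul_comm]

lemma prob_le_one {Ω : Type} [Fintype Ω] (A : Finset Ω) : prob A ≤ 1 :=
  div_le_one_of_le₀ (by exact_mod_cast A.card_le_univ) (by positivity)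

/-- Multiplicative hashing modulo a prime: the number of colliding multipliers. -/
lemma card_mul_mod_collisions {p l x y : ℕ} (hp : p.Prime) (hl : 0 < l) (hx : x < p) (hy : y < p)
    (hxy : x ≠ y) :
    ((Finset.univ : Finset (Fin (p - 1))).filter fun a : Fin (p - 1) =>
      x * ((a : ℕ) + 1) % p % l = y * ((a : ℕ) + 1) % p % l).card * l ≤ 2 * (p - 1) := by
  have hp0 : 0 < p := hp.pos
  -- The signed difference of the two residues is injective in the multiplier, nonzero, and at most
  -- p - 1 in absolute value. A collision makes it a multiple of l, and there are only 2⌊(p-1)/l⌋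
  -- nonzero multiples of l in that range.
  set d : Fin (p - 1) → ℤ := fun a => ((x * (a + 1) % p : ℕ) : ℤ) - ((y * (a + 1) % p : ℕ) : ℤ)
    with hd
  have hdmod : ∀ a, d a ≡ ((x : ℤ) - y) * ((a : ℤ) + 1) [ZMOD p] := by
    intro a
    rw [hd, sub_mul]
    push_cast
    exact Int.ModEq.sub (Int.mod_modEq _ _) (Int.mod_modEq _ _)
  have hndvd : ¬ (p : ℤ) ∣ (x : ℤ) - y := by
    intro h
    have := Int.eq_zero_of_abs_lt_dvd h (by rw [abs_lt]; omega)
    omega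
  have hpZ : Prime (p : ℤ) := Nat.prime_iff_prime_int.1 hp
  have hinj : Function.Injective d := by
    intro a a' h
    have h1 := (hdmod a).symm.trans (h ▸ hdmod a')
    have h2 := h1.dvd
    rw [← mul_sub] at h2
    have h3 := (hpZ.dvd_or_dvd h2).resolve_left hndvd
    have := a.2
    have := a'.2
    have := Int.eq_zero_of_abs_lt_dvd h3 (by rw [abs_lt]; omega)
    ext; omega
  have hne : ∀ a, d a ≠ 0 := by
    intro a h
    have h1 := (hdmod a).symm
    rw [h] at h1
    have h2 := (Int.modEq_zero_iff_dvd).1 h1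
    have h3 := (hpZ.dvd_or_dvd h2).resolve_left hndvd
    have := a.2
    have := Int.eq_zero_of_abs_lt_dvd h3 (by rw [abs_lt]; omega)
    omega
  have hlt : ∀ a, |d a| ≤ p - 1 := by
    intro a
    have h1 := Nat.mod_lt (x * (a + 1)) hp0
    have h2 := Nat.mod_lt (y * (a + 1)) hp0
    rw [abs_le]
    constructor <;> simp only [hd] <;> omega
  set J := (p - 1) / l
  set A := (Finset.univ : Finset (Fin (p - 1))).filter fun a : Fin (p - 1) =>
      x * ((a : ℕ) + 1) % p % l = y * ((a : ℕ) + 1) % p % l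
  have hdvd : ∀ a ∈ A, (l : ℤ) ∣ d a := by
    intro a ha
    have := (Finset.mem_filter.1 ha).2
    exact (Nat.modEq_iff_dvd.1 (Eq.symm this))
  have hcard : A.card ≤ ((Finset.Icc (-(J : ℤ)) J).erase 0).card := by
    refine Finset.card_le_card_of_injOn (fun a => d a / l) ?_ ?_
    · intro a ha
      obtain ⟨j, hj⟩ := hdvd a ha
      have hl' : (0 : ℤ) < l := by exact_mod_cast hl
      have hdj : d a / l = j := by rw [hj]; exact Int.mul_ediv_cancel_left _ hl'.ne'
      have hj0 : j ≠ 0 := by rintro rfl; exact hne a (by simpa using hj)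
      have habs : |j| ≤ J := by
        have h1 := hlt a
        rw [hj, abs_mul, abs_of_pos hl'] at h1
        have : |j| ≤ ((p : ℤ) - 1) / l := by
          rw [Int.le_ediv_iff_mul_le hl']; linarith
        have h2 : ((p - 1 : ℕ) : ℤ) = p - 1 := by omega
        simpa [J, h2] using this
      simp only [Finset.coe_erase, Set.mem_sdiff, Finset.mem_coe, Finset.mem_Icc,
        Set.mem_singleton_iff, hdj]
      exact ⟨abs_le.1 habs, hj0⟩
    · intro a ha a' ha' h
      apply hinj
      rw [← Int.ediv_mul_cancel (hdvd a ha), ← Int.ediv_mul_cancel (hdvd a' ha')]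
      simp only at h
      rw [h]
  rw [Finset.card_erase_of_mem (by simp), Int.card_Icc] at hcard
  have : A.card ≤ 2 * J := by omega
  calc A.card * l ≤ 2 * J * l := by gcongr
    _ = 2 * (J * l) := by ring
    _ ≤ 2 * (p - 1) := by gcongr; exact Nat.div_mul_le_self _ _

lemma prob_mul_mod_collisions {p l x y : ℕ} (hp : p.Prime) (hl : 0 < l) (hx : x < p) (hy : y < p)
    (hxy : x ≠ y) :
    prob ((Finset.univ : Finset (Fin (p - 1))).filter fun a : Fin (p - 1) =>
      x * ((a : ℕ) + 1) % p % l = y * ((a : ℕ) + 1) % p % l) ≤ 2 / l := by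
  have h := card_mul_mod_collisions hp hl hx hy hxy
  have h2 := hp.two_le
  unfold prob
  rw [Fintype.card_fin, div_le_div_iff₀ (by exact_mod_cast (by omega : 0 < p - 1))
    (by exact_mod_cast hl)]
  exact_mod_cast h

/-- Multiplicative hashing modulo a prime `p`. -/
def mulClass (p l N : ℕ) (hl : 0 < l) (a : Fin (p - 1)) (x : Fin N) : Fin l :=
  ⟨x * (a + 1) % p % l, Nat.mod_lt _ hl⟩

lemma isUniversal_mulClass {p l N : ℕ} (hp : p.Prime) (hl : 0 < l) (hN : N ≤ p) :
    IsUniversal 2 (mulClass p l N hl) := by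
  intro x y hxy
  simpa [mulClass, Fin.ext_iff] using prob_mul_mod_collisions hp hl (x.2.trans_le hN)
    (y.2.trans_le hN) (by simpa [Fin.ext_iff] using hxy)

/-- The `i`-th digit of `x` in base `l`. -/
def digit (l : ℕ) [NeZero l] (i x : ℕ) : Fin l := ⟨x / l ^ i % l, Nat.mod_lt _ (NeZero.pos l)⟩

lemma mod_pow_eq_of_digit_eq {l : ℕ} [NeZero l] {q x y : ℕ}
    (h : ∀ i < q, digit l i x = digit l i y) : x % l ^ q = y % l ^ q := by
  induction q with
  | zero => simp [Nat.mod_one]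
  | succ q ih =>
    have h1 := congrArg Fin.val (h q (by omega))
    simp only [digit] at h1
    rw [Nat.mod_pow_succ, Nat.mod_pow_succ, ih fun i hi => h i (by omega), h1]

lemma exists_digit_ne {l : ℕ} [NeZero l] {q x y : ℕ} (hx : x < l ^ q) (hy : y < l ^ q)
    (hxy : x ≠ y) : ∃ i : Fin q, digit l i x ≠ digit l i y := by
  by_contra! h
  have := mod_pow_eq_of_digit_eq (q := q) fun i hi => h ⟨i, hi⟩
  rw [Nat.mod_eq_of_lt hx, Nat.mod_eq_of_lt hy] at this
  exact hxy this

/-- Simple tabulation hashing: digits index independent tables of random group elements. -/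
def tabulate {l q m : ℕ} [NeZero l] [NeZero m] (θ : Fin q → Fin l → Fin m) (x : ℕ) : Fin m :=
  ∑ i, θ i (digit l i x)

/-- The number of tables used for tabulation. -/
abbrev tabCard (q l m : ℕ) : ℕ := Fintype.card (Fin q → Fin l → Fin m)

/-- The tables with a given index. -/
noncomputable def tabEquiv (q l m : ℕ) : Fin (tabCard q l m) ≃ (Fin q → Fin l → Fin m) :=
  (Fintype.equivFin _).symm

/-- The class of tabulation hash functions. -/
noncomputable def tabClass (q l m N : ℕ) [NeZero l] [NeZero m] (i : Fin (tabCard q l m))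
    (x : Fin N) : Fin m := tabulate (tabEquiv q l m i) x

/-- Distinct keys differ in some digit i, so they read two different entries of table i. These
entries alone reach every pair of values; the map from tables to the pair of values is thus a
surjective homomorphism, with fibres of equal size. -/
lemma isTwoIndependent_tabClass {q l m N : ℕ} [NeZero l] [NeZero m] (hN : N ≤ l ^ q) :
    IsTwoIndependent (tabClass q l m N) := by
  intro x y hxy a b
  obtain ⟨i, hi⟩ := exists_digit_ne (x.2.trans_le hN) (y.2.trans_le hN)
    (by simpa [Fin.ext_iff] using hxy)
  set φ : (Fin q → Fin l → Fin m) → Fin m × Fin m := fun θ => (tabulate θ x, tabulate θ y) with hφ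
  have hadd : ∀ θ θ', φ (θ + θ') = φ θ + φ θ' := by
    intro θ θ'
    simp [hφ, tabulate, Finset.sum_add_distrib]
  have hsurj : Function.Surjective φ := by
    rintro ⟨a, b⟩
    refine ⟨Pi.single i (Pi.single (digit l i x) a + Pi.single (digit l i y) b), ?_⟩
    have : ∀ z : ℕ, tabulate (Pi.single i (Pi.single (digit l i x) a
        + Pi.single (digit l i y) b)) z
        = (Pi.single (digit l i x) a + Pi.single (digit l i y) b : Fin l → Fin m)
          (digit l i z) := by
      intro z
      unfold tabulate
      rw [Finset.sum_eq_single i (fun j _ hj => by rw [Pi.single_eq_of_ne hj]; rfl) (by simp)]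
      simp
    simp only [hφ, this]
    simp [hi, hi.symm]
  have h := card_fiber_mul_card φ hadd hsurj (a, b)
  have hc : (Finset.univ.filter fun i => tabClass q l m N i x = a ∧ tabClass q l m N i y = b).card
      = (Finset.univ.filter fun θ => φ θ = (a, b)).card := by
    refine Finset.card_equiv (tabEquiv q l m) fun i => ?_
    rw [Finset.mem_filter, Finset.mem_filter]
    simp [hφ, tabClass]
  unfold prob
  rw [hc, Fintype.card_fin, tabCard, ← h]
  have hm : (m : ℝ) ≠ 0 := by exact_mod_cast NeZero.ne m
  have h0 : ((Finset.univ.filter fun θ => φ θ = (a, b)).card : ℝ) ≠ 0 := by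
    intro h0
    have h1 : (Finset.univ.filter fun θ => φ θ = (a, b)).card = 0 := by exact_mod_cast h0
    rw [h1, zero_mul] at h
    exact Fintype.card_ne_zero h.symm
  simp only [Fintype.card_prod, Fintype.card_fin]
  push_cast
  field_simp

end UniformHashing

namespace UniformHashing

/-! ### Collapsing the universe -/

/-- The first `Q` primes are at most `64 Q²`. -/
lemma nth_prime_le {Q i : ℕ} (hi : i < Q) : Nat.nth Nat.Prime i ≤ 64 * Q ^ 2 := by
  have hQ : 1 ≤ Q := by omega
  have hQ' : (1 : ℝ) ≤ Q := by exact_mod_cast hQ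
  have h := Chebyshev.pi_ge (64 * Q ^ 2)
  -- Since 64 Q² = (8Q)², the estimate log y ≤ y - 1 bounds the logarithm linearly in Q. This is
  -- crude but enough: Q log(64 Q²) stays below 16 Q², while 64 Q² log 2 exceeds 44 Q².
  have hlog : Real.log ((64 * Q ^ 2 : ℕ) : ℝ) ≤ 16 * Q - 2 := by
    push_cast
    rw [show (64 : ℝ) * Q ^ 2 = (8 * Q) ^ 2 by ring, Real.log_pow]
    have := Real.log_le_sub_one_of_pos (show (0 : ℝ) < 8 * Q by positivity)
    push_cast
    linarith
  have hlog0 : 0 < Real.log ((64 * Q ^ 2 : ℕ) : ℝ) := by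
    apply Real.log_pos
    push_cast
    nlinarith
  have hlog1 : Real.log (((64 * Q ^ 2 : ℕ) : ℝ) + 1) ≤ 16 * Q - 1 := by
    have h1 : Real.log (((64 * Q ^ 2 : ℕ) : ℝ) + 1) ≤ Real.log (2 * ((64 * Q ^ 2 : ℕ) : ℝ)) := by
      apply Real.log_le_log (by positivity)
      push_cast
      nlinarith
    rw [Real.log_mul (by norm_num) (by positivity)] at h1
    have := Real.log_two_lt_d9
    linarith
  have hl2 := Real.log_two_gt_d9
  have hpi : (Q : ℝ) ≤ Nat.primeCounting (64 * Q ^ 2) := by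
    refine le_trans ?_ h
    rw [le_div_iff₀ hlog0]
    have h1 : (Q : ℝ) * Real.log ((64 * Q ^ 2 : ℕ) : ℝ) ≤ Q * (16 * Q - 2) := by gcongr
    have h2 : (0.69 : ℝ) * (64 * Q ^ 2) ≤ ((64 * Q ^ 2 : ℕ) : ℝ) * Real.log 2 := by
      push_cast
      nlinarith [sq_nonneg (Q : ℝ)]
    nlinarith
  have hpi' : Q ≤ Nat.primeCounting (64 * Q ^ 2) := by exact_mod_cast hpi
  -- `Nat.primeCounting x` includes x itself, hence it is the count of primes below x + 1.
  have := Nat.nth_lt_of_lt_count (p := Nat.Prime) (k := i) (n := 64 * Q ^ 2 + 1)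
    (lt_of_lt_of_le hi hpi')
  omega

/-- A number below `2 ^ L` has at most `L` prime divisors. -/
lemma card_nth_prime_dvd_le {Q d L : ℕ} (hd : 0 < d) (hL : d ≤ 2 ^ L) :
    ((Finset.univ : Finset (Fin Q)).filter fun i : Fin Q => Nat.nth Nat.Prime i ∣ d).card ≤ L := by
  set A := (Finset.univ : Finset (Fin Q)).filter fun i : Fin Q => Nat.nth Nat.Prime i ∣ d
  have hinj : Function.Injective fun i : Fin Q => Nat.nth Nat.Prime i := fun i j h =>
    Fin.ext (Nat.nth_injective Nat.infinite_setOfPred_prime h)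
  have hdvd : ∏ p ∈ A.image fun i : Fin Q => Nat.nth Nat.Prime i, p ∣ d := by
    refine Finset.prod_primes_dvd d ?_ ?_
    · intro p hp
      obtain ⟨i, -, rfl⟩ := Finset.mem_image.1 hp
      exact (Nat.prime_nth_prime i).prime
    · intro p hp
      obtain ⟨i, hi, rfl⟩ := Finset.mem_image.1 hp
      exact (Finset.mem_filter.1 hi).2
  have hle : 2 ^ A.card ≤ ∏ p ∈ A.image fun i : Fin Q => Nat.nth Nat.Prime i, p := by
    rw [← Finset.card_image_of_injective A hinj]
    refine Finset.pow_card_le_prod _ _ _ ?_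
    intro p hp
    obtain ⟨i, -, rfl⟩ := Finset.mem_image.1 hp
    exact (Nat.prime_nth_prime i).two_le
  exact (Nat.pow_le_pow_iff_right one_lt_two).1 ((hle.trans (Nat.le_of_dvd hd hdvd)).trans hL)

lemma clog_two_le_self (u : ℕ) : Nat.clog 2 u ≤ u :=
  Nat.clog_le_of_le_pow Nat.lt_two_pow_self.le

/-- Reduction modulo a random prime followed by multiplicative hashing: two distinct keys collide
with probability at most `3 / E`. -/
lemma prob_collapse_le {E u p x y : ℕ} (hE : 0 < E) (hu : 2 ≤ u) (hp : p.Prime)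
    (hpQ : 64 * (E * Nat.clog 2 u) ^ 2 < p) (hx : x < u) (hy : y < u) (hxy : x ≠ y) :
    prob ((Finset.univ : Finset (Fin (E * Nat.clog 2 u) × Fin (p - 1))).filter fun i =>
      x % Nat.nth Nat.Prime i.1 * ((i.2 : ℕ) + 1) % p % E
        = y % Nat.nth Nat.Prime i.1 * ((i.2 : ℕ) + 1) % p % E) ≤ 3 / E := by
  set L := Nat.clog 2 u
  set Q := E * L
  have hL : 0 < L := Nat.clog_pos one_lt_two hu
  have hQ : 0 < Q := Nat.mul_pos hE hL
  have hp1 : 0 < p - 1 := by have := hp.two_le; omega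
  -- A prime that identifies x and y divides their difference, and at most L of the Q = E L primes
  -- do: this contributes 1/E. For the other primes the residues are distinct and below p, and
  -- multiplicative hashing contributes 2/E.
  set bad : Fin Q → Prop := fun i => x % Nat.nth Nat.Prime i = y % Nat.nth Nat.Prime i with hbad
  have hbadcard : (Finset.univ.filter bad).card ≤ L := by
    have huL : u ≤ 2 ^ L := Nat.le_pow_clog one_lt_two u
    rcases lt_or_gt_of_ne hxy with h | h
    · refine le_trans (Finset.card_le_card fun i hi => ?_)
        (card_nth_prime_dvd_le (Q := Q) (d := y - x) (L := L) (by omega) (by omega))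
      rw [Finset.mem_filter] at hi ⊢
      exact ⟨hi.1, (Nat.modEq_iff_dvd' h.le).1 hi.2⟩
    · refine le_trans (Finset.card_le_card fun i hi => ?_)
        (card_nth_prime_dvd_le (Q := Q) (d := x - y) (L := L) (by omega) (by omega))
      rw [Finset.mem_filter] at hi ⊢
      exact ⟨hi.1, (Nat.modEq_iff_dvd' h.le).1 hi.2.symm⟩
  set A := (Finset.univ : Finset (Fin Q × Fin (p - 1))).filter fun i =>
      x % Nat.nth Nat.Prime i.1 * ((i.2 : ℕ) + 1) % p % E
        = y % Nat.nth Nat.Prime i.1 * ((i.2 : ℕ) + 1) % p % E with hA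
  set Ai : Fin Q → Finset (Fin (p - 1)) := fun i =>
    (Finset.univ : Finset (Fin (p - 1))).filter fun a : Fin (p - 1) =>
      x % Nat.nth Nat.Prime i * ((a : ℕ) + 1) % p % E
        = y % Nat.nth Nat.Prime i * ((a : ℕ) + 1) % p % E with hAi
  have hAcard : A.card = ∑ i, (Ai i).card := by
    simp only [hA, hAi, Finset.card_filter]
    rw [← Finset.univ_product_univ, Finset.sum_product]
  have hE' : (0 : ℝ) < E := by exact_mod_cast hE
  have hp1' : (0 : ℝ) < ((p - 1 : ℕ) : ℝ) := by exact_mod_cast hp1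
  have hQ' : (0 : ℝ) < Q := by exact_mod_cast hQ
  have hAi_le : ∀ i, ((Ai i).card : ℝ)
      ≤ (if bad i then ((p - 1 : ℕ) : ℝ) else 0) + 2 * ((p - 1 : ℕ) : ℝ) / E := by
    intro i
    by_cases hb : bad i
    · rw [if_pos hb]
      have : (Ai i).card ≤ p - 1 := by simpa using (Ai i).card_le_univ
      have h2 : ((Ai i).card : ℝ) ≤ ((p - 1 : ℕ) : ℝ) := by exact_mod_cast this
      have : 0 ≤ 2 * ((p - 1 : ℕ) : ℝ) / E := by positivity
      linarith
    · rw [if_neg hb, zero_add, le_div_iff₀ hE']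
      have hP := nth_prime_le i.2
      have hP0 : 0 < Nat.nth Nat.Prime i := (Nat.prime_nth_prime i).pos
      have := card_mul_mod_collisions hp hE
        (x := x % Nat.nth Nat.Prime i) (y := y % Nat.nth Nat.Prime i)
        ((Nat.mod_lt _ hP0).trans (hP.trans_lt hpQ)) ((Nat.mod_lt _ hP0).trans (hP.trans_lt hpQ)) hb
      exact_mod_cast this
  have hA_le : (A.card : ℝ) ≤ L * ((p - 1 : ℕ) : ℝ) + Q * (2 * ((p - 1 : ℕ) : ℝ) / E) := by
    rw [hAcard]
    push_cast
    refine (Finset.sum_le_sum fun i _ => hAi_le i).trans ?_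
    rw [Finset.sum_add_distrib, ← Finset.sum_filter, Finset.sum_const, Finset.sum_const,
      nsmul_eq_mul, nsmul_eq_mul, Finset.card_univ, Fintype.card_fin]
    gcongr
  unfold prob
  rw [Fintype.card_prod, Fintype.card_fin, Fintype.card_fin]
  push_cast
  rw [div_le_div_iff₀ (by positivity) hE']
  have hQE : (Q : ℝ) = E * L := by simp [Q]
  calc (A.card : ℝ) * E ≤ (L * ((p - 1 : ℕ) : ℝ) + Q * (2 * ((p - 1 : ℕ) : ℝ) / E)) * E := by gcongr
    _ = 3 * (Q * ((p - 1 : ℕ) : ℝ)) := by rw [hQE]; field_simp; ring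

/-- A class collapsing `{0, …, u-1}` to a universe of size at most `2 e`, evaluated by
`x ↦ ((x mod P) A mod p) mod N`. -/
lemma exists_collapse {e : ℝ} (he : 1 ≤ e) {u : ℕ} (hu : 2 ≤ u) :
    ∃ (N k p : ℕ) (col : Fin k → Fin u → Fin N) (P A : Fin k → ℕ),
      0 < k ∧ 0 < N ∧ N ≤ u ∧ (N : ℝ) ≤ 2 * e ∧
      (∀ i x, (col i x : ℕ) = x % P i * A i % p % N) ∧ (∀ i, P i ≤ p) ∧ (∀ i, A i ≤ p) ∧
      N ≤ p ∧ p ≤ 128 * u ^ 4 ∧ p ≤ 128 * (⌈e⌉₊ * Nat.clog 2 u) ^ 2 ∧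
      ∀ x y : Fin u, x ≠ y →
        prob (Finset.univ.filter fun i => col i x = col i y) ≤ 3 / e := by
  have hL : 0 < Nat.clog 2 u := Nat.clog_pos one_lt_two hu
  have hE : 0 < ⌈e⌉₊ := Nat.ceil_pos.2 (by linarith)
  -- A universe of size at most e needs no collapsing; the identity has the required form with P = p
  -- = N = u and multiplier 1.
  rcases le_or_gt (u : ℝ) e with h | h
  · refine ⟨u, 1, u, fun _ x => x, fun _ => u, fun _ => 1, one_pos, by omega, le_rfl, by linarith,
      ?_, fun _ => le_rfl, fun _ => by show 1 ≤ u; omega, le_rfl, ?_, ?_, ?_⟩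
    · intro i x
      simp [Nat.mod_eq_of_lt x.2]
    · nlinarith [Nat.le_self_pow (show 4 ≠ 0 by norm_num) u]
    · have h1 : u ≤ ⌈e⌉₊ := by exact_mod_cast h.trans (Nat.le_ceil e)
      have h2 : ⌈e⌉₊ ≤ ⌈e⌉₊ * Nat.clog 2 u := Nat.le_mul_of_pos_right _ hL
      have h3 := Nat.le_self_pow (show 2 ≠ 0 by norm_num) (⌈e⌉₊ * Nat.clog 2 u)
      omega
    · intro x y hxy
      simp only [hxy, Finset.filter_false, prob, Finset.card_empty]
      simp only [Nat.cast_zero, zero_div]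
      positivity
  · set E := ⌈e⌉₊
    set L := Nat.clog 2 u
    have hEu : E ≤ u := Nat.ceil_le.2 h.le
    have hLu : L ≤ u := clog_two_le_self u
    -- By Bertrand's postulate the modulus can be chosen above the first E L primes and still of
    -- size O((E L)²).
    obtain ⟨p, hp, hp1, hp2⟩ := Nat.exists_prime_lt_and_le_two_mul (64 * (E * L) ^ 2)
      (by positivity)
    have hpb : p ≤ 128 * (E * L) ^ 2 := by omega
    have hp1' : 0 < p - 1 := by have := hp.two_le; omega
    have hEL : E ≤ E * L := Nat.le_mul_of_pos_right _ hL
    have hsq := Nat.le_self_pow (show 2 ≠ 0 by norm_num) (E * L)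
    let φ : Fin (E * L * (p - 1)) ≃ Fin (E * L) × Fin (p - 1) := finProdFinEquiv.symm
    refine ⟨E, E * L * (p - 1), p,
      fun i x => ⟨x % Nat.nth Nat.Prime (φ i).1 * ((φ i).2 + 1) % p % E, Nat.mod_lt _ hE⟩,
      fun i => Nat.nth Nat.Prime (φ i).1, fun i => (φ i).2 + 1, by positivity, hE, hEu, ?_,
      fun i x => rfl, fun i => ?_, fun i => ?_, ?_, ?_, hpb, ?_⟩
    · have := Nat.ceil_lt_add_one (show 0 ≤ e by linarith)
      linarith
    · exact (nth_prime_le (φ i).1.2).trans hp1.le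
    · have := (φ i).2.2
      show (φ i).2 + 1 ≤ p
      omega
    · omega
    · refine hpb.trans ?_
      refine Nat.mul_le_mul_left _ ?_
      calc (E * L) ^ 2 ≤ (u * u) ^ 2 := by gcongr
        _ = u ^ 4 := by ring
    · intro x y hxy
      have h1 := prob_collapse_le hE hu hp hp1 x.2 y.2 (by simpa [Fin.ext_iff] using hxy)
      have h2 : (3 : ℝ) / E ≤ 3 / e := by
        gcongr
        exact Nat.le_ceil e
      refine le_trans (le_of_eq ?_) (h1.trans h2)
      unfold prob
      congr 1
      · norm_cast
        refine Finset.card_equiv φ fun i => ?_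
        rw [Finset.mem_filter, Finset.mem_filter]
        simp [Fin.ext_iff]
      · norm_cast
        exact Fintype.card_congr φ

end UniformHashing

namespace UniformHashing

/-! ### Leafless sets of keys

A pair of functions `a 0`, `a 1` turns keys into the edges of a bipartite multigraph. -/

section graph

variable {α β γ : Type*}

/-- Every endpoint of an edge in `T` has degree at least two. -/
def Leafless (a : Fin 2 → α → β) (T : Finset α) : Prop :=
  ∀ x ∈ T, ∀ i, ∃ y ∈ T, y ≠ x ∧ a i y = a i x

/-- Some leafless set of keys from `S` on which none of the functions `G j` is injective. -/
def Bad {c : ℕ} (a : Fin 2 → α → β) (G : Fin c → α → γ) (S : Finset α) : Prop :=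
  ∃ T ⊆ S, Leafless a T ∧ ∀ j, ¬ Set.InjOn (G j) T

/-- The probability bound is proved for keys of the collapsed universe; this transfers it to S when
the collapsing function is injective on S. -/
lemma Bad.image {α' : Type*} [DecidableEq α'] {c : ℕ} {a : Fin 2 → α' → β} {G : Fin c → α' → γ}
    {S : Finset α} {q : α → α'} (hq : Set.InjOn q S)
    (h : Bad (fun i x => a i (q x)) (fun j x => G j (q x)) S) : Bad a G (S.image q) := by
  obtain ⟨T, hTS, hT, hG⟩ := h
  refine ⟨T.image q, Finset.image_subset_image hTS, ?_, fun j hj => hG j ?_⟩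
  · intro z hz i
    obtain ⟨x, hx, rfl⟩ := Finset.mem_image.1 hz
    obtain ⟨y, hy, hyx, hay⟩ := hT x hx i
    exact ⟨q y, Finset.mem_image_of_mem q hy, fun h => hyx (hq (hTS hy) (hTS hx) h), hay⟩
  · intro x hx y hy hxy
    exact hq (hTS hx) (hTS hy)
      (hj (Finset.mem_coe.2 (Finset.mem_image_of_mem q hx))
        (Finset.mem_coe.2 (Finset.mem_image_of_mem q hy)) hxy)

/-- Outside the bad event the tables can be filled so as to obtain prescribed values on `S`. -/
lemma exists_tables_of_not_bad {A : Type*} [AddCommGroup A] [DecidableEq α] [DecidableEq β]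
    [DecidableEq γ] {c : ℕ} {a : Fin 2 → α → β} {G : Fin c → α → γ} {S : Finset α}
    (h : ¬ Bad a G S) (v : α → A) :
    ∃ (t : Fin 2 → β → A) (y : Fin c → γ → A),
      ∀ x ∈ S, ∑ i, t i (a i x) + ∑ j, y j (G j x) = v x := by
  classical
  -- The union of leafless sets is leafless, so there is a largest one: it is what remains of S when
  -- edges with an unshared endpoint are removed repeatedly.
  set T := (S.powerset.filter (Leafless a)).sup id with hT
  have hTS : T ⊆ S := Finset.sup_le fun U hU => Finset.mem_powerset.1 (Finset.mem_filter.1 hU).1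
  have hTmax : ∀ U ⊆ S, Leafless a U → U ⊆ T := fun U hU hL =>
    Finset.le_sup (f := id) (Finset.mem_filter.2 ⟨Finset.mem_powerset.2 hU, hL⟩)
  have hTl : Leafless a T := by
    intro x hx i
    obtain ⟨U, hU, hxU⟩ := Finset.mem_sup.1 hx
    obtain ⟨hU1, hU2⟩ := Finset.mem_filter.1 hU
    obtain ⟨y, hy, hyx⟩ := hU2 x hxU i
    exact ⟨y, hTmax U (Finset.mem_powerset.1 hU1) hU2 hy, hyx⟩
  -- The tables are filled by induction on sets between T and S, which amounts to undoing the
  -- peeling of keys.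
  have key : ∀ k : ℕ, ∀ S' : Finset α, S'.card = k → T ⊆ S' → S' ⊆ S →
      ∃ (t : Fin 2 → β → A) (y : Fin c → γ → A),
        ∀ x ∈ S', ∑ i, t i (a i x) + ∑ j, y j (G j x) = v x := by
    intro k
    induction k with
    | zero =>
      intro S' hS' _ _
      exact ⟨0, 0, fun x hx => by simp [Finset.card_eq_zero.1 hS'] at hx⟩
    | succ k ih =>
      intro S' hS' hTS' hS'S
      by_cases hl : Leafless a S'
      · have hL : S' = T := (hTmax S' hS'S hl).antisymm hTS'
        rw [hL]
        obtain ⟨j, hj⟩ : ∃ j, Set.InjOn (G j) T := by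
          by_contra! hcon
          exact h ⟨T, hTS, hTl, hcon⟩
        -- On T itself the table of an injective `G j` does all the work: each entry serves at most
        -- one key, so the sum has at most one nonzero term.
        refine ⟨0, Pi.single j fun g => ∑ x ∈ T, if G j x = g then v x else 0, fun x hx => ?_⟩
        rw [Finset.sum_eq_single j (fun i _ hi => by rw [Pi.single_eq_of_ne hi]; rfl) (by simp)]
        rw [Pi.single_eq_same, Finset.sum_eq_single x]
        · simp
        · intro z hz hzx
          rw [if_neg fun hG => hzx (hj hz hx hG)]
        · exact fun hx' => absurd hx hx'
      · obtain ⟨x, hx, i, hxi⟩ : ∃ x ∈ S', ∃ i, ∀ y ∈ S', y ≠ x → a i y ≠ a i x := by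
          unfold Leafless at hl
          push Not at hl
          exact hl
        have hxT : x ∉ T := fun hxT => by
          obtain ⟨y, hy, hyx, hay⟩ := hTl x hxT i
          exact hxi y (hTS' hy) hyx hay
        obtain ⟨t, y, hty⟩ := ih (S'.erase x) (by rw [Finset.card_erase_of_mem hx, hS']; rfl)
          (fun z hz => Finset.mem_erase.2 ⟨fun hzx => hxT (hzx ▸ hz), hTS' hz⟩)
          ((Finset.erase_subset _ _).trans hS'S)
        -- The missing amount is added to the entry of `t i` at the endpoint `a i x`, which no other
        -- key of S' reads.
        set d := v x - (∑ i, t i (a i x) + ∑ j, y j (G j x)) with hd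
        have hsum : ∀ z, ∑ i', (t + Pi.single i (Pi.single (a i x) d) : Fin 2 → β → A) i' (a i' z)
            = ∑ i', t i' (a i' z) + if a i z = a i x then d else 0 := by
          intro z
          simp only [Pi.add_apply, Finset.sum_add_distrib]
          congr 1
          rw [Finset.sum_eq_single i (fun i' _ hi => by rw [Pi.single_eq_of_ne hi]; rfl) (by simp)]
          rw [Pi.single_eq_same, Pi.single_apply]
        refine ⟨t + Pi.single i (Pi.single (a i x) d), y, fun z hz => ?_⟩
        rw [hsum]
        by_cases hzx : z = x
        · subst hzx
          rw [if_pos rfl, hd]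
          abel
        · rw [if_neg (hxi z hz hzx), add_zero]
          exact hty z (Finset.mem_erase.2 ⟨hzx, hz⟩)
  exact key _ S rfl hTS subset_rfl

/-! ### Walks in leafless sets -/

/-- The side of the bipartite graph at which the `p`-th edge of a walk is left. -/
def side (p : ℕ) : Fin 2 := if p % 2 = 0 then 0 else 1

lemma eq_side_or (σ : Fin 2) (p : ℕ) : σ = side p ∨ σ = side (p + 1) := by
  unfold side
  rcases Nat.mod_two_eq_zero_or_one p with h | h <;> fin_cases σ <;>
    simp [h, Nat.add_mod]

lemma side_add_two (p : ℕ) : side (p + 2) = side p := by simp [side]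

/-- The keys `y 0, …, y (t-1)` form a walk with jumps: the `(p+1)`-st edge continues at the
endpoint of the `p`-th edge, unless `p + 1 ∈ J`, in which case the endpoint of the `p`-th edge
has been met before. -/
def IsWalk (a : Fin 2 → α → β) (y : ℕ → α) (t : ℕ) (J : Finset ℕ) : Prop :=
  ∀ p, p + 1 < t →
    (p + 1 ∉ J → a (side p) (y (p + 1)) = a (side p) (y p)) ∧
    (p + 1 ∈ J → ∃ i < p, a (side p) (y p) = a (side p) (y i))

/-- A walk of `t + 1` distinct keys from `T`. -/
structure WalkIn (a : Fin 2 → α → β) (T : Finset α) (y : ℕ → α) (t : ℕ) (J : Finset ℕ) : Prop where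
  walk : IsWalk a y (t + 1) J
  mem : ∀ p ≤ t, y p ∈ T
  inj : ∀ p ≤ t, ∀ p' ≤ t, y p = y p' → p = p'
  jumps : ∀ p ∈ J, p ≤ t

/-- Walks consist of distinct keys of T; this makes the extension of walks terminate. -/
lemma WalkIn.lt_card {a : Fin 2 → α → β} {T : Finset α} {y : ℕ → α} {t : ℕ} {J : Finset ℕ}
    (h : WalkIn a T y t J) : t < T.card := by
  have := Finset.card_le_card_of_injOn (s := Finset.range (t + 1)) (t := T) y
    (fun p hp => h.mem p (by simpa [Nat.lt_succ_iff] using hp))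
    (fun p hp p' hp' => h.inj p (by simpa [Nat.lt_succ_iff] using hp) p'
      (by simpa [Nat.lt_succ_iff] using hp'))
  simpa using this

/-- The new jump set is left general, so that one statement covers an ordinary step (`J' = J`) and a
jump (`J' = insert (t + 1) J`). -/
lemma WalkIn.snoc {a : Fin 2 → α → β} {T : Finset α} {y : ℕ → α} {t : ℕ}
    {J J' : Finset ℕ} (h : WalkIn a T y t J) {z : α} (hz : z ∈ T) (hnew : ∀ p ≤ t, y p ≠ z)
    (hJ : ∀ p ≤ t, p ∈ J' ↔ p ∈ J) (hJ' : ∀ p ∈ J', p ≤ t + 1)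
    (h1 : t + 1 ∉ J' → a (side t) z = a (side t) (y t))
    (h2 : t + 1 ∈ J' → ∃ i < t, a (side t) (y t) = a (side t) (y i)) :
    WalkIn a T (Function.update y (t + 1) z) (t + 1) J' := by
  have hy : ∀ p ≤ t, Function.update y (t + 1) z p = y p := fun p hp =>
    Function.update_of_ne (by omega) _ _
  have hy' : Function.update y (t + 1) z (t + 1) = z := Function.update_self _ _ _
  refine ⟨fun p hp => ?_, fun p hp => ?_, fun p hp p' hp' hpp => ?_, hJ'⟩
  · rcases Nat.lt_or_ge p t with hpt | hpt
    · obtain ⟨g1, g2⟩ := h.walk p (by omega)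
      rw [hJ (p + 1) hpt, hy p hpt.le, hy (p + 1) hpt]
      refine ⟨g1, fun hp => ?_⟩
      obtain ⟨i, hi, hi'⟩ := g2 hp
      exact ⟨i, hi, by rw [hi', hy i (by omega)]⟩
    · obtain rfl : p = t := by omega
      rw [hy', hy p le_rfl]
      refine ⟨h1, fun hp => ?_⟩
      obtain ⟨i, hi, hi'⟩ := h2 hp
      exact ⟨i, hi, by rw [hi', hy i (by omega)]⟩
  · rcases Nat.lt_or_ge t p with hpt | hpt
    · obtain rfl : p = t + 1 := by omega
      rwa [hy']
    · rw [hy p hpt]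
      exact h.mem p hpt
  · rcases Nat.lt_or_ge t p with hpt | hpt <;> rcases Nat.lt_or_ge t p' with hpt' | hpt'
    · omega
    · obtain rfl : p = t + 1 := by omega
      rw [hy', hy p' hpt'] at hpp
      exact absurd hpp.symm (hnew p' hpt')
    · obtain rfl : p' = t + 1 := by omega
      rw [hy', hy p hpt] at hpp
      exact absurd hpp (hnew p hpt)
    · rw [hy p hpt, hy p' hpt'] at hpp
      refine h.inj p hpt p' hpt' ?_
      exact hpp

/-- In a leafless set every walk can be continued until it meets itself. -/
lemma WalkIn.exists_closed {a : Fin 2 → α → β} {T : Finset α} (hT : Leafless a T) {y : ℕ → α}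
    {t : ℕ} {J : Finset ℕ} (h : WalkIn a T y t J) :
    ∃ y' t', t ≤ t' ∧ (∀ p ≤ t, y' p = y p) ∧ WalkIn a T y' t' J ∧
      ∃ i < t', a (side t') (y' t') = a (side t') (y' i) := by
  by_cases hc : ∃ i < t, a (side t) (y t) = a (side t) (y i)
  · exact ⟨y, t, le_rfl, fun _ _ => rfl, h, hc⟩
  -- Leaflessness gives another key at the endpoint where the walk stops. It is new, because an
  -- earlier key at this endpoint would mean that the walk already meets itself.
  · obtain ⟨z, hz, hzy, haz⟩ := hT (y t) (h.mem t le_rfl) (side t)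
    have hnew : ∀ p ≤ t, y p ≠ z := by
      rintro p hp rfl
      rcases Nat.lt_or_ge p t with hpt | hpt
      · exact hc ⟨p, hpt, haz.symm⟩
      · exact hzy (by rw [show p = t by omega])
    have hJ : t + 1 ∉ J := fun hJ => by have := h.jumps _ hJ; omega
    have h' := h.snoc (J' := J) hz hnew (fun _ _ => Iff.rfl)
      (fun p hp => (h.jumps p hp).trans (Nat.le_succ t)) (fun _ => haz) (fun h => absurd h hJ)
    have := h'.lt_card
    obtain ⟨y', t', ht, hy', hw, hcl⟩ := h'.exists_closed hT
    refine ⟨y', t', by omega, fun p hp => ?_, hw, hcl⟩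
    rw [hy' p (by omega), Function.update_of_ne (by omega)]
termination_by T.card - t

/-- A leafless set contains a walk through any given keys, with one jump for each key but the
first. -/
lemma Leafless.exists_walk [DecidableEq α] {a : Fin 2 → α → β} {T : Finset α}
    (hT : Leafless a T) {x₀ : α} (hx₀ : x₀ ∈ T) (X : Finset α) (hX : X ⊆ T) :
    ∃ y t J, J.card ≤ X.card ∧ WalkIn a T y t J ∧ (∀ x ∈ X, ∃ p ≤ t, y p = x) ∧
      ∃ i < t, a (side t) (y t) = a (side t) (y i) := by
  induction X using Finset.induction_on with
  | empty =>
    have h : WalkIn a T (fun _ => x₀) 0 ∅ :=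
      ⟨fun p hp => by omega, fun _ _ => hx₀, fun p hp p' hp' _ => by omega, by simp⟩
    obtain ⟨y, t, -, -, hw, hcl⟩ := h.exists_closed hT
    exact ⟨y, t, ∅, by simp, hw, by simp, hcl⟩
  | insert x X hxX ih =>
    obtain ⟨y, t, J, hJ, hw, hcov, hcl⟩ := ih fun z hz => hX (Finset.mem_insert_of_mem hz)
    by_cases hx : ∃ p ≤ t, y p = x
    · refine ⟨y, t, J, hJ.trans (Finset.card_le_card (Finset.subset_insert _ _)), hw, ?_, hcl⟩
      intro z hz
      rcases Finset.mem_insert.1 hz with rfl | hz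
      · exact hx
      · exact hcov z hz
    -- The walk meets itself, which permits a jump to the missing key; it is then continued until it
    -- meets itself again. The starting key needs no jump.
    · push Not at hx
      have h' := hw.snoc (J' := insert (t + 1) J) (hX (Finset.mem_insert_self x X)) hx
        (fun p hp => by simp [show p ≠ t + 1 by omega])
        (fun p hp => by
          rcases Finset.mem_insert.1 hp with rfl | hp
          · exact le_rfl
          · exact (hw.jumps p hp).trans (Nat.le_succ t))
        (fun h => absurd (Finset.mem_insert_self _ _) h) (fun _ => hcl)
      obtain ⟨y', t', ht, hy', hw', hcl'⟩ := h'.exists_closed hT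
      refine ⟨y', t', _, ?_, hw', ?_, hcl'⟩
      · rw [Finset.card_insert_of_notMem hxX]
        exact (Finset.card_insert_le _ _).trans (by omega)
      · intro z hz
        rcases Finset.mem_insert.1 hz with rfl | hz
        · exact ⟨t + 1, ht, by rw [hy' _ le_rfl, Function.update_self]⟩
        · obtain ⟨p, hp, rfl⟩ := hcov z hz
          exact ⟨p, by omega, by rw [hy' p (by omega), Function.update_of_ne (by omega)]⟩

/-- A pair of functions on `s + 1` positions that looks like a walk with at most `K` jumps. -/
def WalkPattern (K : ℕ) {s : ℕ} (b : Fin 2 → Fin (s + 1) → β) : Prop :=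
  ∃ J : Finset ℕ, J.card ≤ K ∧
    IsWalk (fun σ p => b σ (Fin.ofNat (s + 1) p)) (fun p => p) (s + 1) J

/-- In the bad event there is a critical walk: none of the functions `G j` is injective on it, but
one of them is injective on all keys but the last. -/
lemma Bad.exists_walkPattern [DecidableEq α] {c : ℕ} (hc : 0 < c) {a : Fin 2 → α → β}
    {G : Fin c → α → γ} {S : Finset α} (h : Bad a G S) :
    ∃ s, s + 2 ≤ S.card ∧ ∃ y : Fin (s + 2) → α, (∀ p, y p ∈ S) ∧
      Function.Injective y ∧ (∀ j, ¬ Function.Injective fun p => G j (y p)) ∧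
      (∃ j, Function.Injective fun p : Fin (s + 1) => G j (y p.castSucc)) ∧
      WalkPattern (2 * c) fun σ (p : Fin (s + 1)) => a σ (y p.castSucc) := by
  obtain ⟨T, hTS, hT, hG⟩ := h
  have hG' : ∀ j, ∃ x ∈ T, ∃ x' ∈ T, G j x = G j x' ∧ x ≠ x' := by
    intro j
    have := hG j
    unfold Set.InjOn at this
    push Not at this
    obtain ⟨x, hx, x', hx', h1, h2⟩ := this
    exact ⟨x, hx, x', hx', h1, h2⟩
  choose x hx x' hx' hxx hne using hG'
  -- One colliding pair for each function: a walk through these at most 2c keys witnesses that none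
  -- is injective.
  set X := Finset.univ.image x ∪ Finset.univ.image x' with hXdef
  have hXT : X ⊆ T := by
    intro z hz
    simp only [hXdef, Finset.mem_union, Finset.mem_image, Finset.mem_univ, true_and] at hz
    rcases hz with ⟨j, rfl⟩ | ⟨j, rfl⟩
    · exact hx j
    · exact hx' j
  have hXcard : X.card ≤ 2 * c := by
    refine (Finset.card_union_le _ _).trans ?_
    have h1 := Finset.card_image_le (s := (Finset.univ : Finset (Fin c))) (f := x)
    have h2 := Finset.card_image_le (s := (Finset.univ : Finset (Fin c))) (f := x')
    rw [Finset.card_univ, Fintype.card_fin] at h1 h2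
    omega
  obtain ⟨y, t, J, hJ, hw, hcov, -⟩ := hT.exists_walk (hx ⟨0, hc⟩) X hXT
  have hall : ∃ k, ∀ j, ¬ Set.InjOn (fun p => G j (y p)) {p | p < k} := by
    refine ⟨t + 1, fun j hj => ?_⟩
    obtain ⟨p, hp, hpx⟩ := hcov (x j) (by simp [hXdef])
    obtain ⟨p', hp', hpx'⟩ := hcov (x' j) (by simp [hXdef])
    have := hj (Nat.lt_succ_of_le hp) (Nat.lt_succ_of_le hp') (by simp [hpx, hpx', hxx])
    exact hne j (by rw [← hpx, ← hpx', this])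
  classical
  -- The walk is cut after the least number of keys on which every function has a collision.
  -- Minimality then supplies a function that is injective when the last key is dropped.
  have hspec := Nat.find_spec hall
  have hmin := fun k => Nat.find_min hall (m := k)
  have hle : Nat.find hall ≤ t + 1 := by
    by_contra! hcon
    refine hmin _ hcon fun j hj => ?_
    obtain ⟨p, hp, hpx⟩ := hcov (x j) (by simp [hXdef])
    obtain ⟨p', hp', hpx'⟩ := hcov (x' j) (by simp [hXdef])
    have := hj (Nat.lt_succ_of_le hp) (Nat.lt_succ_of_le hp') (by simp [hpx, hpx', hxx])
    exact hne j (by rw [← hpx, ← hpx', this])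
  set k := Nat.find hall
  -- Every function is injective on at most one key, and c > 0 provides a function to which this
  -- applies.
  have hk2 : 2 ≤ k := by
    by_contra! hk
    refine hspec ⟨0, hc⟩ fun p hp p' hp' _ => ?_
    simp only [Set.mem_ofPred_eq] at hp hp'
    omega
  obtain ⟨s, hs⟩ : ∃ s, k = s + 2 := ⟨k - 2, by omega⟩
  have hcardT := hw.lt_card
  have hcardS := Finset.card_le_card hTS
  refine ⟨s, by omega, fun p => y p, fun p => hTS (hw.mem p (by have := p.2; omega)), ?_, ?_, ?_, ?_⟩
  · intro p p' hpp
    exact Fin.ext (hw.inj p (by have := p.2; omega) p' (by have := p'.2; omega) hpp)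
  · intro j hj
    refine hspec j fun p hp p' hp' hpp => ?_
    simp only [Set.mem_ofPred_eq] at hp hp'
    exact congrArg Fin.val (hj (a₁ := ⟨p, by omega⟩) (a₂ := ⟨p', by omega⟩) hpp)
  · have := hmin (s + 1) (by omega)
    push Not at this
    obtain ⟨j, hj⟩ := this
    refine ⟨j, fun p p' hpp => Fin.ext (hj ?_ ?_ hpp)⟩
    · exact p.2
    · exact p'.2
  -- The jump set need not be cut down to the prefix: jumps at later positions are never consulted.
  · refine ⟨J, hJ.trans hXcard, fun p hp => ?_⟩
    have hv : ∀ i < s + 1, ((Fin.ofNat (s + 1) i).castSucc : ℕ) = i := fun i hi => by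
      simp [Nat.mod_eq_of_lt hi]
    have hwp := hw.walk p (by omega)
    simp only [hv (p + 1) hp, hv p (by omega)]
    refine ⟨hwp.1, fun hJ => ?_⟩
    obtain ⟨i, hi, hi'⟩ := hwp.2 hJ
    exact ⟨i, hi, by rw [hi', hv i (by omega)]⟩

end graph

end UniformHashing

namespace UniformHashing

/-! ### Counting walk patterns -/

section patterns

variable {β : Type*} {s : ℕ}

/-- The pair `b` is a walk whose jumps and their targets are given by `ψ`. -/
def FollowsJumps (ψ : ℕ → Option ℕ) (b : Fin 2 → Fin (s + 1) → β) : Prop :=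
  ∀ p < s, (ψ (p + 1) = none →
      b (side p) (Fin.ofNat (s + 1) (p + 1)) = b (side p) (Fin.ofNat (s + 1) p)) ∧
    ∀ i, ψ (p + 1) = some i →
      i < p ∧ b (side p) (Fin.ofNat (s + 1) p) = b (side p) (Fin.ofNat (s + 1) i)

/-- The values of a walk that are not determined by earlier ones. -/
def freeValues (ψ : ℕ → Option ℕ) (b : Fin 2 → Fin (s + 1) → β) (k : Fin (s + 2)) : β :=
  -- Of the 2(s+1) values, each of the s steps determines one, leaving s+2. Index 0 is the value of
  -- the first key on the side not used for leaving it. Without a jump at k, key k-1 has a free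
  -- leaving value, which key k inherits. With a jump, the leaving value of key k-1 repeats an
  -- earlier one, and the value at which key k is entered is free instead. The last key has no
  -- successor, so its leaving value is always free.
  if (k : ℕ) = 0 then b (side 1) 0
  else if ψ k = none ∨ (k : ℕ) = s + 1 then b (side (k - 1)) (Fin.ofNat (s + 1) (k - 1))
  else b (side (k - 1)) (Fin.ofNat (s + 1) k)

/-- Strong induction on the position: the value on the leaving side is governed by `ψ (p + 1)`, the
value on the entering side by `ψ p`, and each is either free or equal to a value at an earlier
position. -/
lemma FollowsJumps.eq_of_freeValues_eq {ψ : ℕ → Option ℕ} {b b' : Fin 2 → Fin (s + 1) → β}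
    (h : FollowsJumps ψ b) (h' : FollowsJumps ψ b') (hf : freeValues ψ b = freeValues ψ b') :
    b = b' := by
  have key : ∀ p, p ≤ s → ∀ σ, b σ (Fin.ofNat (s + 1) p) = b' σ (Fin.ofNat (s + 1) p) := by
    intro p
    induction p using Nat.strong_induction_on with
    | _ p ih =>
      intro hp σ
      rcases eq_side_or σ p with rfl | rfl
      · have hk := congrFun hf ⟨p + 1, by omega⟩
        simp only [freeValues, Nat.add_sub_cancel, Nat.succ_ne_zero, if_false] at hk
        by_cases hψ : ψ (p + 1) = none ∨ p + 1 = s + 1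
        · simpa only [hψ, if_true] using hk
        · push Not at hψ
          obtain ⟨i, hi⟩ := Option.ne_none_iff_exists'.1 hψ.1
          obtain ⟨hip, e1⟩ := (h p (by omega)).2 i hi
          obtain ⟨-, e2⟩ := (h' p (by omega)).2 i hi
          rw [e1, e2, ih i hip (by omega)]
      · rcases Nat.eq_zero_or_pos p with rfl | hp0
        · simpa [freeValues] using congrFun hf 0
        · obtain ⟨k, rfl⟩ : ∃ k, p = k + 1 := ⟨p - 1, by omega⟩
          rw [side_add_two]
          by_cases hψ : ψ (k + 1) = none
          · rw [(h k (by omega)).1 hψ, (h' k (by omega)).1 hψ, ih k (by omega) (by omega)]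
          · have hk := congrFun hf ⟨k + 1, by omega⟩
            simpa only [freeValues, Nat.add_sub_cancel, Nat.succ_ne_zero, if_false, hψ,
              show ¬ k + 1 = s + 1 by omega, or_self] using hk
  funext σ p
  have hp : Fin.ofNat (s + 1) (p : ℕ) = p := Fin.ext (by simp)
  rw [← hp]
  exact key p (by have := p.2; omega) σ

open Classical in
/-- The jumps listed by a code of `K` pairs (position, target). -/
noncomputable def jumpsOf {K : ℕ} (code : Fin K → Fin (s + 2) × Fin (s + 2)) (p : ℕ) : Option ℕ :=
  if h : ∃ k, ((code k).1 : ℕ) = p then some ((code h.choose).2 : ℕ) else none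

/-- Jumps beyond the last position are dropped, and unused code entries are padded with position
s+1, which `FollowsJumps` never inspects. The target depends only on the position, so several
entries with the same position agree. -/
lemma WalkPattern.exists_code {K : ℕ} {b : Fin 2 → Fin (s + 1) → β} (h : WalkPattern K b) :
    ∃ code : Fin K → Fin (s + 2) × Fin (s + 2), FollowsJumps (jumpsOf code) b := by
  classical
  obtain ⟨J, hJ, hw⟩ := h
  have hI : ∀ p, ∃ i, i ≤ s ∧ (p < s → p + 1 ∈ J → i < p ∧
      b (side p) (Fin.ofNat (s + 1) p) = b (side p) (Fin.ofNat (s + 1) i)) := by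
    intro p
    by_cases hp : p < s ∧ p + 1 ∈ J
    · obtain ⟨i, hi, hi'⟩ := (hw p (by omega)).2 hp.2
      exact ⟨i, by omega, fun _ _ => ⟨hi, hi'⟩⟩
    · exact ⟨0, by omega, fun h1 h2 => absurd ⟨h1, h2⟩ hp⟩
  choose I hIs hI using hI
  set J' := J.filter (· < s + 1) with hJ'
  set f : ℕ → ℕ := fun k => J'.toList.getD k (s + 1) with hf
  have hf1 : ∀ k, f k ∈ J' ∨ f k = s + 1 := by
    intro k
    rcases Nat.lt_or_ge k J'.toList.length with hk | hk
    · left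
      rw [hf]
      simp only
      rw [List.getD_eq_getElem _ _ hk]
      exact Finset.mem_toList.1 (List.getElem_mem hk)
    · right
      exact List.getD_eq_default _ _ hk
  have hfs : ∀ k, f k < s + 2 := by
    intro k
    rcases hf1 k with h | h
    · have := (Finset.mem_filter.1 h).2
      omega
    · omega
  have hf2 : ∀ p ∈ J', ∃ k : Fin K, f k = p := by
    intro p hp
    obtain ⟨k, hk, hkp⟩ := List.getElem_of_mem (Finset.mem_toList.2 hp)
    have hk' : k < K := by
      have := Finset.card_le_card (Finset.filter_subset (· < s + 1) J)
      rw [Finset.length_toList] at hk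
      exact hk.trans_le (this.trans hJ)
    exact ⟨⟨k, hk'⟩, by rw [hf]; simp only; rw [List.getD_eq_getElem _ _ hk, hkp]⟩
  refine ⟨fun k => (⟨f k, hfs k⟩, ⟨I (f k - 1), by have := hIs (f k - 1); omega⟩),
    fun p hp => ⟨fun hn => ?_, fun i hi => ?_⟩⟩
  · refine (hw p (by omega)).1 fun hpJ => ?_
    obtain ⟨k, hk⟩ := hf2 (p + 1) (Finset.mem_filter.2 ⟨hpJ, by omega⟩)
    have hex : ∃ k : Fin K, f k = p + 1 := ⟨k, hk⟩
    simp [jumpsOf, hex] at hn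
  · unfold jumpsOf at hi
    split_ifs at hi with hex
    have hspec := hex.choose_spec
    simp only at hspec hi
    rw [hspec, Option.some.injEq, Nat.add_sub_cancel] at hi
    subst hi
    refine hI p hp ?_
    rcases hf1 hex.choose with h | h
    · rw [hspec] at h
      exact (Finset.mem_filter.1 h).1
    · omega

-- A pattern is determined by its code, for which there are (s+2)² choices per jump, and by its s+2
-- free values.
open Classical in
lemma card_walkPattern_le [Fintype β] (K s : ℕ) :
    (Finset.univ.filter fun b : Fin 2 → Fin (s + 1) → β => WalkPattern K b).card
      ≤ (s + 2) ^ (2 * K) * Fintype.card β ^ (s + 2) := by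
  have hsub : (Finset.univ.filter fun b : Fin 2 → Fin (s + 1) → β => WalkPattern K b)
      ⊆ (Finset.univ : Finset (Fin K → Fin (s + 2) × Fin (s + 2))).biUnion fun code =>
        Finset.univ.filter fun b => FollowsJumps (jumpsOf code) b := by
    intro b hb
    obtain ⟨code, hcode⟩ := (Finset.mem_filter.1 hb).2.exists_code
    exact Finset.mem_biUnion.2 ⟨code, Finset.mem_univ _, Finset.mem_filter.2
      ⟨Finset.mem_univ _, hcode⟩⟩
  refine (Finset.card_le_card hsub).trans ?_
  refine (Finset.card_biUnion_le_card_mul _ _ (Fintype.card β ^ (s + 2)) fun code _ => ?_).trans ?_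
  · have := Finset.card_le_card_of_injOn
      (s := Finset.univ.filter fun b : Fin 2 → Fin (s + 1) → β => FollowsJumps (jumpsOf code) b)
      (t := (Finset.univ : Finset (Fin (s + 2) → β))) (freeValues (jumpsOf code))
      (fun _ _ => Finset.mem_coe.2 (Finset.mem_univ _))
      (fun b hb b' hb' h => (Finset.mem_filter.1 hb).2.eq_of_freeValues_eq
        (Finset.mem_filter.1 hb').2 h)
    simpa using this
  · refine Nat.mul_le_mul_right _ ?_
    simp only [Finset.card_univ, Fintype.card_fun, Fintype.card_prod, Fintype.card_fin]
    rw [← pow_two, ← pow_mul]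

end patterns

end UniformHashing

namespace UniformHashing

/-! ### The probability of the bad event -/

lemma fin_val_sum {ι : Type*} {m : ℕ} [NeZero m] (t : Finset ι) (f : ι → Fin m) :
    ((∑ i ∈ t, f i : Fin m) : ℕ) = (∑ i ∈ t, (f i : ℕ)) % m := by
  classical
  induction t using Finset.induction_on with
  | empty => simp
  | insert i t hi ih => rw [Finset.sum_insert hi, Finset.sum_insert hi, Fin.val_add, ih,
      Nat.add_mod_mod]

/-- Addition modulo m is addition in `Fin m`, which exhibits the value as a translate of a
homomorphism in the tables. -/
lemma zHash_eq_sum {kH kF d c l m N : ℕ} [NeZero m] (H : Fin kH → Fin N → Fin m)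
    (F : Fin kF → Fin N → Fin l) (ζ : ZSeed kH kF d c l m) (i : Fin d) (x : Fin N) :
    zHash H F ζ i x = H (ζ.1 i) x + ∑ j, ζ.2.2 i j (F (ζ.2.1 j) x) := by
  apply Fin.ext
  rw [Fin.val_add, fin_val_sum, Nat.add_mod_mod]
  rfl

open Classical in
/-- A uniform element of a finite group stays uniform under a surjective affine map. -/
lemma card_filter_affine {G A : Type*} [AddCommGroup G] [AddCommGroup A] [Fintype G] [Fintype A]
    (φ : G → A) (hadd : ∀ x y, φ (x + y) = φ x + φ y) (hsurj : Function.Surjective φ) (a₀ : A)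
    (P : A → Prop) :
    (Finset.univ.filter fun g => P (a₀ + φ g)).card * Fintype.card A
      = (Finset.univ.filter fun a => P a).card * Fintype.card G := by
  have h : (Finset.univ.filter fun g => P (a₀ + φ g)).card
      = ∑ a ∈ Finset.univ.filter fun a => P a,
        (Finset.univ.filter fun g => φ g = a - a₀).card := by
    rw [Finset.card_eq_sum_card_fiberwise (f := fun g => a₀ + φ g)
      (t := Finset.univ.filter fun a => P a)
      (fun g hg => by simpa using hg)]
    refine Finset.sum_congr rfl fun a ha => ?_
    congr 1
    ext g
    simp only [Finset.mem_filter, Finset.mem_univ, true_and] at ha ⊢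
    constructor
    · rintro ⟨-, rfl⟩
      abel
    · intro hg
      have : a₀ + φ g = a := by rw [hg]; abel
      exact ⟨by rwa [this], this⟩
  have h2 : ∀ a ∈ Finset.univ.filter fun a => P a,
      (Finset.univ.filter fun g => φ g = a - a₀).card * Fintype.card A = Fintype.card G :=
    fun a _ => card_fiber_mul_card φ hadd hsurj (a - a₀)
  rw [h, Finset.sum_mul, Finset.sum_congr rfl h2, Finset.sum_const, smul_eq_mul]

open Classical in
/-- If some component `G j` is injective on the positions, the table lookups are uniform. -/
lemma card_lookup_mul {c l m k d : ℕ} [NeZero m] (G : Fin c → Fin k → Fin l)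
    (hG : ∃ j, Function.Injective (G j)) (b₀ : Fin d → Fin k → Fin m)
    (P : (Fin d → Fin k → Fin m) → Prop) :
    (Finset.univ.filter fun z : Fin d → Fin c → Fin l → Fin m =>
        P fun σ p => b₀ σ p + ∑ j, z σ j (G j p)).card * (m ^ k) ^ d
      = (Finset.univ.filter fun b => P b).card * Fintype.card (Fin d → Fin c → Fin l → Fin m) := by
  obtain ⟨j, hj⟩ := hG
  have := card_filter_affine (G := Fin d → Fin c → Fin l → Fin m) (A := Fin d → Fin k → Fin m)
    (fun z σ p => ∑ j, z σ j (G j p)) ?_ ?_ b₀ P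
  · have hcard : Fintype.card (Fin d → Fin k → Fin m) = (m ^ k) ^ d := by simp
    rw [hcard] at this
    exact this
  · intro z z'
    funext σ p
    simp [Finset.sum_add_distrib]
  · intro b
    -- Only the table of the injective component is used; each of its entries is read by at most one
    -- position.
    refine ⟨fun σ => Pi.single j fun g => ∑ p, if G j p = g then b σ p else 0, ?_⟩
    funext σ p
    simp only
    rw [Finset.sum_eq_single j (fun i _ hi => by rw [Pi.single_eq_of_ne hi]; rfl) (by simp),
      Pi.single_eq_same, Finset.sum_eq_single p]
    · simp
    · intro p' _ hp'
      rw [if_neg fun h => hp' (hj h)]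
    · simp

open Classical in
/-- For a universal class a random member is rarely non-injective on few keys. -/
lemma card_not_injective_le {kF N l k : ℕ} {F : Fin kF → Fin N → Fin l} (hF : IsUniversal 2 F)
    {y : Fin k → Fin N} (hy : Function.Injective y) :
    ((Finset.univ.filter fun i => ¬ Function.Injective fun p => F i (y p)).card : ℝ)
      ≤ kF * (2 * (k : ℝ) ^ 2 / l) := by
  have hsub : (Finset.univ.filter fun i => ¬ Function.Injective fun p => F i (y p))
      ⊆ (Finset.univ : Finset (Fin k × Fin k)).biUnion fun pp =>
        if pp.1 = pp.2 then ∅ else Finset.univ.filter fun i => F i (y pp.1) = F i (y pp.2) := by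
    intro i hi
    have hi' := (Finset.mem_filter.1 hi).2
    unfold Function.Injective at hi'
    push Not at hi'
    obtain ⟨p, p', h1, h2⟩ := hi'
    refine Finset.mem_biUnion.2 ⟨(p, p'), Finset.mem_univ _, ?_⟩
    rw [if_neg h2]
    exact Finset.mem_filter.2 ⟨Finset.mem_univ _, h1⟩
  have hone : ∀ pp : Fin k × Fin k, (((if pp.1 = pp.2 then ∅ else
      Finset.univ.filter fun i => F i (y pp.1) = F i (y pp.2) : Finset (Fin kF)).card : ℕ) : ℝ)
        ≤ kF * (2 / l) := by
    intro pp
    split_ifs with h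
    · simp only [Finset.card_empty, Nat.cast_zero]
      positivity
    · have h1 := hF (y pp.1) (y pp.2) (hy.ne h)
      unfold prob at h1
      rw [Fintype.card_fin] at h1
      rcases Nat.eq_zero_or_pos kF with h0 | h0
      · subst h0
        simp
      · rw [div_le_iff₀ (by exact_mod_cast h0)] at h1
        rw [mul_comm (kF : ℝ)]
        convert h1
  calc ((Finset.univ.filter fun i => ¬ Function.Injective fun p => F i (y p)).card : ℝ)
      ≤ ∑ pp : Fin k × Fin k, (((if pp.1 = pp.2 then ∅ else
        Finset.univ.filter fun i => F i (y pp.1) = F i (y pp.2) : Finset (Fin kF)).card : ℕ) : ℝ) := by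
        exact_mod_cast (Finset.card_le_card hsub).trans Finset.card_biUnion_le
    _ ≤ ∑ _pp : Fin k × Fin k, (kF : ℝ) * (2 / l) := Finset.sum_le_sum fun pp _ => hone pp
    _ = kF * (2 * (k : ℝ) ^ 2 / l) := by
        rw [Finset.sum_const, Finset.card_univ, Fintype.card_prod, Fintype.card_fin, nsmul_eq_mul]
        push_cast
        ring

open Classical in
/-- The probability that given keys form a critical walk. -/
lemma card_critical_le {kH kF c l m N s : ℕ} [NeZero m] (H : Fin kH → Fin N → Fin m)
    {F : Fin kF → Fin N → Fin l} (hF : IsUniversal 2 F) {y : Fin (s + 2) → Fin N}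
    (hy : Function.Injective y) (K : ℕ) :
    ((Finset.univ.filter fun ζ : ZSeed kH kF 2 c l m =>
      (∀ j, ¬ Function.Injective fun p => F (ζ.2.1 j) (y p)) ∧
      (∃ j, Function.Injective fun p : Fin (s + 1) => F (ζ.2.1 j) (y p.castSucc)) ∧
      WalkPattern K fun σ (p : Fin (s + 1)) => zHash H F ζ σ (y p.castSucc)).card : ℝ)
      ≤ Fintype.card (ZSeed kH kF 2 c l m)
        * ((2 * (s + 2 : ℝ) ^ 2 / l) ^ c * (s + 2 : ℝ) ^ (2 * K) / (m : ℝ) ^ s) := by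
  -- The choices are split: first the g_j, which must all fail to be injective, then the tables z
  -- for fixed f and g. The two factors multiply since the bound `W` for the tables does not depend
  -- on f or g.
  set Γ : Finset (Fin c → Fin kF) :=
    Fintype.piFinset fun _ => Finset.univ.filter fun i => ¬ Function.Injective fun p => F i (y p)
    with hΓ
  set W : ℝ := Fintype.card (Fin 2 → Fin c → Fin l → Fin m) * (s + 2 : ℝ) ^ (2 * K) / (m : ℝ) ^ s
    with hW
  have hm : (0 : ℝ) < m := by exact_mod_cast NeZero.pos m
  have hW0 : 0 ≤ W := by positivity
  have hz : ∀ (f : Fin 2 → Fin kH) (g : Fin c → Fin kF),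
      ((Finset.univ.filter fun z : Fin 2 → Fin c → Fin l → Fin m =>
        (∀ j, ¬ Function.Injective fun p => F (g j) (y p)) ∧
        (∃ j, Function.Injective fun p : Fin (s + 1) => F (g j) (y p.castSucc)) ∧
        WalkPattern K fun σ (p : Fin (s + 1)) => zHash H F (f, g, z) σ (y p.castSucc)).card : ℝ)
        ≤ if g ∈ Γ then W else 0 := by
    intro f g
    by_cases hg : ∀ j, ¬ Function.Injective fun p => F (g j) (y p)
    · rw [if_pos (by simpa [hΓ, Fintype.mem_piFinset] using hg)]
      by_cases hj : ∃ j, Function.Injective fun p : Fin (s + 1) => F (g j) (y p.castSucc)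
      · have h1 := card_lookup_mul (fun j (p : Fin (s + 1)) => F (g j) (y p.castSucc)) hj
          (fun σ p => H (f σ) (y p.castSucc)) (WalkPattern K)
        have h2 := card_walkPattern_le (β := Fin m) K s
        rw [Fintype.card_fin] at h2
        simp only [hg, hj, true_and, not_false_eq_true, implies_true, zHash_eq_sum]
        -- Some g_j is injective on the s+1 positions, so the lookups are uniform among m^{2(s+1)}
        -- value pairs, of which at most (s+2)^{2K} m^{s+2} are walk patterns.
        set X := (Finset.univ.filter fun z : Fin 2 → Fin c → Fin l → Fin m =>
          WalkPattern K fun σ (p : Fin (s + 1)) =>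
            H (f σ) (y p.castSucc) + ∑ j, z σ j (F (g j) (y p.castSucc))).card
        have h3 : X * (m ^ (s + 1)) ^ 2 ≤ (s + 2) ^ (2 * K) * m ^ (s + 2)
            * Fintype.card (Fin 2 → Fin c → Fin l → Fin m) := by
          rw [h1]
          exact Nat.mul_le_mul_right _ h2
        have h4 : (X : ℝ) * ((m : ℝ) ^ (s + 1)) ^ 2 ≤ (s + 2 : ℝ) ^ (2 * K) * (m : ℝ) ^ (s + 2)
            * Fintype.card (Fin 2 → Fin c → Fin l → Fin m) := by exact_mod_cast h3
        rw [hW, le_div_iff₀ (by positivity)]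
        have h5 : (X : ℝ) * (m : ℝ) ^ s * (m : ℝ) ^ (s + 2)
            ≤ Fintype.card (Fin 2 → Fin c → Fin l → Fin m) * (s + 2 : ℝ) ^ (2 * K)
              * (m : ℝ) ^ (s + 2) := by
          calc (X : ℝ) * (m : ℝ) ^ s * (m : ℝ) ^ (s + 2) = X * ((m : ℝ) ^ (s + 1)) ^ 2 := by ring
            _ ≤ _ := h4
            _ = _ := by ring
        exact le_of_mul_le_mul_right h5 (by positivity)
      · simpa [hj] using hW0
    · simp only [hg, false_and, Finset.filter_false, Finset.card_empty, Nat.cast_zero]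
      split_ifs
      · exact hW0
      · exact le_rfl
  have hΓcard : (Γ.card : ℝ) ≤ (kF : ℝ) ^ c * (2 * (s + 2 : ℝ) ^ 2 / l) ^ c := by
    rw [hΓ, Fintype.card_piFinset, Finset.prod_const, Finset.card_univ, Fintype.card_fin,
      ← mul_pow]
    push_cast
    gcongr
    have := card_not_injective_le hF hy
    push_cast at this
    exact this
  have hsplit : (Finset.univ.filter fun ζ : ZSeed kH kF 2 c l m =>
      (∀ j, ¬ Function.Injective fun p => F (ζ.2.1 j) (y p)) ∧
      (∃ j, Function.Injective fun p : Fin (s + 1) => F (ζ.2.1 j) (y p.castSucc)) ∧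
      WalkPattern K fun σ (p : Fin (s + 1)) => zHash H F ζ σ (y p.castSucc)).card
      = ∑ f : Fin 2 → Fin kH, ∑ g : Fin c → Fin kF,
      (Finset.univ.filter fun z : Fin 2 → Fin c → Fin l → Fin m =>
        (∀ j, ¬ Function.Injective fun p => F (g j) (y p)) ∧
        (∃ j, Function.Injective fun p : Fin (s + 1) => F (g j) (y p.castSucc)) ∧
        WalkPattern K fun σ (p : Fin (s + 1)) => zHash H F (f, g, z) σ (y p.castSucc)).card := by
    simp only [Finset.card_filter]
    rw [← Finset.univ_product_univ, Finset.sum_product]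
    refine Finset.sum_congr rfl fun f _ => ?_
    rw [← Finset.univ_product_univ, Finset.sum_product]
  rw [hsplit]
  push_cast
  calc _ ≤ ∑ f : Fin 2 → Fin kH, ∑ g : Fin c → Fin kF, (if g ∈ Γ then W else 0) :=
        Finset.sum_le_sum fun f _ => Finset.sum_le_sum fun g _ => hz f g
    _ = (kH : ℝ) ^ 2 * (Γ.card * W) := by
        simp [Finset.sum_ite_mem]
    _ ≤ (kH : ℝ) ^ 2 * ((kF : ℝ) ^ c * (2 * (s + 2 : ℝ) ^ 2 / l) ^ c * W) := by gcongr
    _ = _ := by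
        rw [hW]
        simp only [Fintype.card_prod, Fintype.card_fun, Fintype.card_fin]
        push_cast
        ring

open Classical in
/-- The bad event has probability `O(m² / ℓ^c)`. -/
theorem prob_bad_le {kH kF c l m N n : ℕ} [NeZero m] (hc : 0 < c) (H : Fin kH → Fin N → Fin m)
    {F : Fin kF → Fin N → Fin l} (hF : IsUniversal 2 F) (S : Finset (Fin N)) (hS : S.card = n)
    {ρ A : ℝ} (hρ : (n : ℝ) ≤ ρ * m)
    (hA : ∀ k, ∑ t ∈ Finset.range k, (t : ℝ) ^ (6 * c) * ρ ^ t ≤ A) :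
    prob (Finset.univ.filter fun ζ : ZSeed kH kF 2 c l m =>
      Bad (zHash H F ζ) (fun j => F (ζ.2.1 j)) S) ≤ (2 / l : ℝ) ^ c * (m : ℝ) ^ 2 * A := by
  have hm : (0 : ℝ) < m := by exact_mod_cast NeZero.pos m
  have hρ0 : 0 ≤ ρ := nonneg_of_mul_nonneg_left ((Nat.cast_nonneg n).trans hρ) hm
  set Ev : (s : ℕ) → (Fin (s + 2) → Fin N) → Finset (ZSeed kH kF 2 c l m) := fun s y =>
    Finset.univ.filter fun ζ : ZSeed kH kF 2 c l m =>
      (∀ j, ¬ Function.Injective fun p => F (ζ.2.1 j) (y p)) ∧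
      (∃ j, Function.Injective fun p : Fin (s + 1) => F (ζ.2.1 j) (y p.castSucc)) ∧
      WalkPattern (2 * c) fun σ (p : Fin (s + 1)) => zHash H F ζ σ (y p.castSucc) with hEv
  set Y : (s : ℕ) → Finset (Fin (s + 2) → Fin N) := fun s =>
    (Fintype.piFinset fun _ => S).filter Function.Injective with hY
  have hsub : (Finset.univ.filter fun ζ : ZSeed kH kF 2 c l m =>
      Bad (zHash H F ζ) (fun j => F (ζ.2.1 j)) S)
      ⊆ (Finset.range n).biUnion fun s => (Y s).biUnion fun y => Ev s y := by
    intro ζ hζ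
    obtain ⟨s, hs, y, hyS, hy, h1, h2, h3⟩ := (Finset.mem_filter.1 hζ).2.exists_walkPattern hc
    refine Finset.mem_biUnion.2 ⟨s, Finset.mem_range.2 (by omega), Finset.mem_biUnion.2
      ⟨y, Finset.mem_filter.2 ⟨Fintype.mem_piFinset.2 hyS, hy⟩,
        Finset.mem_filter.2 ⟨Finset.mem_univ _, h1, h2, h3⟩⟩⟩
  set Z : ℝ := (Fintype.card (ZSeed kH kF 2 c l m) : ℝ) with hZ
  have hYcard : ∀ s, ((Y s).card : ℝ) ≤ (n : ℝ) ^ (s + 2) := by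
    intro s
    have := Finset.card_filter_le (Fintype.piFinset fun _ : Fin (s + 2) => S) Function.Injective
    rw [Fintype.card_piFinset, Finset.prod_const, Finset.card_univ, Fintype.card_fin, hS] at this
    exact_mod_cast this
  have hcard : ((Finset.univ.filter fun ζ : ZSeed kH kF 2 c l m =>
      Bad (zHash H F ζ) (fun j => F (ζ.2.1 j)) S).card : ℝ)
      ≤ ∑ s ∈ Finset.range n, (n : ℝ) ^ (s + 2) * (Z *
        ((2 * (s + 2 : ℝ) ^ 2 / l) ^ c * (s + 2 : ℝ) ^ (2 * (2 * c)) / (m : ℝ) ^ s)) := by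
    have h1 : ((Finset.univ.filter fun ζ : ZSeed kH kF 2 c l m =>
        Bad (zHash H F ζ) (fun j => F (ζ.2.1 j)) S).card : ℝ)
        ≤ ∑ s ∈ Finset.range n, ∑ y ∈ Y s, ((Ev s y).card : ℝ) := by
      have := (Finset.card_le_card hsub).trans (Finset.card_biUnion_le.trans
        (Finset.sum_le_sum fun s _ => Finset.card_biUnion_le))
      exact_mod_cast this
    refine h1.trans (Finset.sum_le_sum fun s _ => ?_)
    refine (Finset.sum_le_sum fun y hy => card_critical_le H hF
      (Finset.mem_filter.1 hy).2 (2 * c)).trans ?_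
    rw [Finset.sum_const, nsmul_eq_mul]
    gcongr
    exact hYcard s
  -- Shift of the index to t = s+2; the omitted terms t = 0, 1 are nonnegative.
  have hA0 : ∑ s ∈ Finset.range n, ((s + 2 : ℕ) : ℝ) ^ (6 * c) * ρ ^ (s + 2) ≤ A := by
    refine le_trans ?_ (hA (n + 2))
    rw [Finset.sum_range_succ', Finset.sum_range_succ']
    have : (0 : ℝ) ≤ ((0 + 1 : ℕ) : ℝ) ^ (6 * c) * ρ ^ (0 + 1)
        + ((0 : ℕ) : ℝ) ^ (6 * c) * ρ ^ 0 := by positivity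
    rw [add_assoc]
    exact le_add_of_nonneg_right this
  -- From n ≤ ρ m, n^{s+2} / m^s ≤ m² ρ^{s+2}. The exponent 6c consists of 2c from the pairs of
  -- colliding keys and 4c from the codes of at most 2c jumps.
  have hterm : ∀ s : ℕ, (n : ℝ) ^ (s + 2) * (Z *
        ((2 * (s + 2 : ℝ) ^ 2 / l) ^ c * (s + 2 : ℝ) ^ (2 * (2 * c)) / (m : ℝ) ^ s))
      ≤ Z * ((2 / l : ℝ) ^ c * (m : ℝ) ^ 2) * (((s + 2 : ℕ) : ℝ) ^ (6 * c) * ρ ^ (s + 2)) := by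
    intro s
    have h1 : (n : ℝ) ^ (s + 2) ≤ (ρ * m) ^ (s + 2) := by gcongr
    calc _ ≤ (ρ * m) ^ (s + 2) * (Z *
        ((2 * (s + 2 : ℝ) ^ 2 / l) ^ c * (s + 2 : ℝ) ^ (2 * (2 * c)) / (m : ℝ) ^ s)) := by gcongr
      _ = _ := by
        have e1 : (2 * (s + 2 : ℝ) ^ 2 / l) ^ c = (2 / l : ℝ) ^ c * (s + 2 : ℝ) ^ (2 * c) := by
          rw [pow_mul, ← mul_pow]
          congr 1
          ring
        have e2 : (s + 2 : ℝ) ^ (6 * c) = (s + 2 : ℝ) ^ (2 * c) * (s + 2 : ℝ) ^ (2 * (2 * c)) := by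
          rw [← pow_add]
          congr 1
          ring
        push_cast
        rw [e1, e2, mul_pow, pow_add (m : ℝ)]
        field_simp
  have hfin := hcard.trans (Finset.sum_le_sum fun s _ => hterm s)
  rw [← Finset.mul_sum] at hfin
  have hZ0 : 0 ≤ Z := by positivity
  unfold prob
  refine div_le_of_le_mul₀ hZ0 ?_ ?_
  · have : 0 ≤ A := le_trans (by simp) (hA 0)
    positivity
  · calc _ ≤ _ := hfin
      _ ≤ Z * ((2 / l : ℝ) ^ c * (m : ℝ) ^ 2) * A := by gcongr
      _ = _ := by ring

end UniformHashing

namespace UniformHashing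

/-! ### The random function -/

/-- The function built from `𝒵` and random tables, with values in `{0, …, r-1}`. -/
def dsFun {kC kH kF kK c l m r u N : ℕ} [NeZero r] (col : Fin kC → Fin u → Fin N)
    (H : Fin kH → Fin N → Fin m) (F : Fin kF → Fin N → Fin l) (K : Fin kK → Fin N → Fin r)
    (σ : DSSeed kC kH kF kK c l m r) (x : Fin u) : Fin r :=
  ⟨dsHash col H F K σ x, Nat.mod_lt _ (NeZero.pos r)⟩

lemma dsFun_eq_sum {kC kH kF kK c l m r u N : ℕ} [NeZero r] (col : Fin kC → Fin u → Fin N)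
    (H : Fin kH → Fin N → Fin m) (F : Fin kF → Fin N → Fin l) (K : Fin kK → Fin N → Fin r)
    (q : Fin kC) (ζ : ZSeed kH kF 2 c l m) (t : Fin 2 → Fin m → Fin r)
    (y : Fin c → Fin l → Fin r) (f : Fin kK) (x : Fin u) :
    dsFun col H F K (q, ζ, t, y, f) x = (∑ i, t i (zHash H F ζ i (col q x))
      + ∑ j, y j (F (ζ.2.1 j) (col q x))) + K f (col q x) := by
  apply Fin.ext
  simp only [dsFun, dsHash, Fin.val_add, fin_val_sum, Fin.sum_univ_two]
  simp only [Nat.add_mod_mod, Nat.mod_add_mod]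
  congr 1
  ring

lemma card_filter_prod {α β : Type*} [Fintype α] [Fintype β] (P : α → β → Prop)
    [∀ a, DecidablePred (P a)] [DecidablePred fun p : α × β => P p.1 p.2] :
    (Finset.univ.filter fun p : α × β => P p.1 p.2).card
      = ∑ a, (Finset.univ.filter (P a)).card := by
  rw [Finset.card_filter, ← Finset.univ_product_univ, Finset.sum_product]
  refine Finset.sum_congr rfl fun a _ => ?_
  rw [Finset.card_filter]
  exact Finset.sum_congr rfl fun b _ => if_congr Iff.rfl rfl rfl

/-- The bad event is decided by the first two components alone, so uniformity for each fixed good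
pair adds up to uniformity conditioned on the complement of the bad event. -/
lemma card_filter_triple_mul {α β γ : Type*} [Fintype α] [Fintype β] [Fintype γ]
    (P : α → β → Prop) (R : α → β → γ → Prop) [∀ a, DecidablePred (P a)]
    [∀ a b, DecidablePred (R a b)] [DecidablePred fun σ : α × β × γ => ¬ P σ.1 σ.2.1]
    [DecidablePred fun σ : α × β × γ => ¬ P σ.1 σ.2.1 ∧ R σ.1 σ.2.1 σ.2.2] {M : ℕ}
    (h : ∀ a b, ¬ P a b → (Finset.univ.filter (R a b)).card * M = Fintype.card γ) :
    (Finset.univ.filter fun σ : α × β × γ => ¬ P σ.1 σ.2.1 ∧ R σ.1 σ.2.1 σ.2.2).card * M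
      = (Finset.univ.filter fun σ : α × β × γ => ¬ P σ.1 σ.2.1).card := by
  classical
  rw [card_filter_prod fun (a : α) (τ : β × γ) => ¬ P a τ.1 ∧ R a τ.1 τ.2,
    card_filter_prod fun (a : α) (τ : β × γ) => ¬ P a τ.1, Finset.sum_mul]
  refine Finset.sum_congr rfl fun a _ => ?_
  rw [card_filter_prod fun (b : β) (g : γ) => ¬ P a b ∧ R a b g,
    card_filter_prod fun (b : β) (_ : γ) => ¬ P a b, Finset.sum_mul]
  refine Finset.sum_congr rfl fun b _ => ?_
  by_cases hb : P a b
  · simp [hb]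
  · simp only [hb, not_false_eq_true, true_and, Finset.filter_true, Finset.card_univ]
    rw [← h a b hb]

lemma uniformOnOutside_of_card {Ω : Type} [Fintype Ω] [DecidableEq Ω] {u r : ℕ} [NeZero r]
    {h : Ω → Fin u → Fin r} {S : Finset (Fin u)} {B : Finset Ω}
    (hcard : ∀ v : Fin u → Fin r,
      (Finset.univ.filter fun ω => ω ∉ B ∧ ∀ x ∈ S, h ω x = v x).card * r ^ S.card
        = (Finset.univ.filter fun ω => ω ∉ B).card) :
    UniformOnOutside h S B := by
  intro v
  have hr : (r : ℝ) ≠ 0 := by exact_mod_cast NeZero.ne r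
  have hBc : Bᶜ = Finset.univ.filter fun ω => ω ∉ B := by
    ext ω
    simp
  unfold prob
  rw [hBc, ← hcard v]
  push_cast
  field_simp

/-- The random choices that do not influence the graph. -/
abbrev TableSeed (kK c l m r : ℕ) : Type :=
  (Fin 2 → Fin m → Fin r) × (Fin c → Fin l → Fin r) × Fin kK

/-- The random choices for which uniformity on `S` may fail. -/
def BadSeed {kC kH kF c l m u N : ℕ} (col : Fin kC → Fin u → Fin N)
    (H : Fin kH → Fin N → Fin m) (F : Fin kF → Fin N → Fin l) (S : Finset (Fin u))
    (q : Fin kC) (ζ : ZSeed kH kF 2 c l m) : Prop :=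
  Bad (fun i x => zHash H F ζ i (col q x)) (fun j x => F (ζ.2.1 j) (col q x)) S

/-- Outside the bad event the values on `S` are uniform. -/
lemma card_tables_mul {kC kH kF kK c l m r u N : ℕ} [NeZero r] (col : Fin kC → Fin u → Fin N)
    (H : Fin kH → Fin N → Fin m) (F : Fin kF → Fin N → Fin l) (K : Fin kK → Fin N → Fin r)
    (q : Fin kC) (ζ : ZSeed kH kF 2 c l m) {S : Finset (Fin u)}
    (h : ¬ BadSeed col H F S q ζ)
    (v : Fin u → Fin r) :
    (Finset.univ.filter fun τ : TableSeed kK c l m r =>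
      ∀ x ∈ S, dsFun col H F K (q, ζ, τ) x = v x).card * r ^ S.card
      = Fintype.card (TableSeed kK c l m r) := by
  classical
  let e : TableSeed kK c l m r
      ≃ Fin kK × ((Fin 2 → Fin m → Fin r) × (Fin c → Fin l → Fin r)) :=
    (Equiv.prodAssoc _ _ _).symm.trans (Equiv.prodComm _ _)
  set φ : (Fin 2 → Fin m → Fin r) × (Fin c → Fin l → Fin r) → (S → Fin r) := fun τ x =>
    ∑ i, τ.1 i (zHash H F ζ i (col q x)) + ∑ j, τ.2 j (F (ζ.2.1 j) (col q x)) with hφ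
  have hadd : ∀ τ τ', φ (τ + τ') = φ τ + φ τ' := by
    intro τ τ'
    funext x
    simp only [hφ, Prod.fst_add, Prod.snd_add, Pi.add_apply, Finset.sum_add_distrib]
    abel
  have hsurj : Function.Surjective φ := by
    intro w
    obtain ⟨t, y, hty⟩ := exists_tables_of_not_bad h
      (fun x => if hx : x ∈ S then w ⟨x, hx⟩ else 0)
    refine ⟨(t, y), funext fun x => ?_⟩
    have := hty x x.2
    rwa [dif_pos x.2] at this
  -- For fixed f the prescribed values are only translated, and all fibres of φ have the same size.
  have hf : ∀ f : Fin kK, (Finset.univ.filter fun τ => φ τ = fun x : S => v x - K f (col q x)).card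
      * r ^ S.card = Fintype.card ((Fin 2 → Fin m → Fin r) × (Fin c → Fin l → Fin r)) := by
    intro f
    have := card_fiber_mul_card φ hadd hsurj fun x : S => v x - K f (col q x)
    have hcard : Fintype.card (S → Fin r) = r ^ S.card := by simp
    rw [hcard] at this
    exact this
  have hcount : (Finset.univ.filter fun τ : TableSeed kK c l m r => ∀ x ∈ S, dsFun col H F K (q, ζ, τ) x = v x).card
      = ∑ f : Fin kK, (Finset.univ.filter fun τ => φ τ = fun x : S => v x - K f (col q x)).card := by
    rw [← card_filter_prod fun (f : Fin kK) τ => φ τ = fun x : S => v x - K f (col q x)]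
    refine Finset.card_equiv e fun τ => ?_
    obtain ⟨t, y, f⟩ := τ
    rw [Finset.mem_filter, Finset.mem_filter]
    simp only [Finset.mem_univ, true_and, dsFun_eq_sum]
    change _ ↔ φ (t, y) = fun x : S => v x - K f (col q x)
    rw [funext_iff]
    simp only [hφ, Subtype.forall, eq_sub_iff_add_eq]
  rw [hcount, Finset.sum_mul, Finset.sum_congr rfl fun f _ => hf f, Finset.sum_const,
    Finset.card_univ, smul_eq_mul, Fintype.card_congr e]
  simp only [Fintype.card_prod]

open Classical in
/-- Keys from `S` are rarely identified by a random function of small collision probability. -/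
lemma card_not_injOn_le {kC u N : ℕ} {col : Fin kC → Fin u → Fin N} {η : ℝ} (hη : 0 ≤ η)
    (hcol : ∀ x y : Fin u, x ≠ y →
      prob (Finset.univ.filter fun i => col i x = col i y) ≤ η) (S : Finset (Fin u)) :
    ((Finset.univ.filter fun i => ¬ Set.InjOn (col i) S).card : ℝ) ≤ kC * ((S.card : ℝ) ^ 2 * η) := by
  have hsub : (Finset.univ.filter fun i => ¬ Set.InjOn (col i) S)
      ⊆ (S ×ˢ S).biUnion fun pp =>
        if pp.1 = pp.2 then ∅ else Finset.univ.filter fun i => col i pp.1 = col i pp.2 := by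
    intro i hi
    have hi' := (Finset.mem_filter.1 hi).2
    unfold Set.InjOn at hi'
    push Not at hi'
    obtain ⟨p, hp, p', hp', h1, h2⟩ := hi'
    refine Finset.mem_biUnion.2 ⟨(p, p'), Finset.mem_product.2 ⟨hp, hp'⟩, ?_⟩
    rw [if_neg h2]
    exact Finset.mem_filter.2 ⟨Finset.mem_univ _, h1⟩
  have hone : ∀ pp : Fin u × Fin u, (((if pp.1 = pp.2 then ∅ else
      Finset.univ.filter fun i => col i pp.1 = col i pp.2 : Finset (Fin kC)).card : ℕ) : ℝ)
        ≤ kC * η := by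
    intro pp
    split_ifs with h
    · simp only [Finset.card_empty, Nat.cast_zero]
      positivity
    · have h1 := hcol pp.1 pp.2 h
      unfold prob at h1
      rw [Fintype.card_fin] at h1
      rcases Nat.eq_zero_or_pos kC with h0 | h0
      · subst h0
        simp
      · rw [div_le_iff₀ (by exact_mod_cast h0)] at h1
        rw [mul_comm (kC : ℝ)]
        convert h1
  calc ((Finset.univ.filter fun i => ¬ Set.InjOn (col i) S).card : ℝ)
      ≤ ∑ pp ∈ S ×ˢ S, (((if pp.1 = pp.2 then ∅ else
        Finset.univ.filter fun i => col i pp.1 = col i pp.2 : Finset (Fin kC)).card : ℕ) : ℝ) := by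
        exact_mod_cast (Finset.card_le_card hsub).trans Finset.card_biUnion_le
    _ ≤ ∑ _pp ∈ S ×ˢ S, (kC : ℝ) * η := Finset.sum_le_sum fun pp _ => hone pp
    _ = kC * ((S.card : ℝ) ^ 2 * η) := by
        rw [Finset.sum_const, Finset.card_product, nsmul_eq_mul]
        push_cast
        ring

/-- The random function is uniform on `S` outside a set of seeds of small probability. -/
theorem exists_uniformOnOutside {kC kH kF kK c l m r u N : ℕ} [NeZero r] [NeZero m] (hc : 0 < c)
    (col : Fin kC → Fin u → Fin N) (H : Fin kH → Fin N → Fin m) {F : Fin kF → Fin N → Fin l}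
    (K : Fin kK → Fin N → Fin r) {η : ℝ} (hη : 0 ≤ η)
    (hcol : ∀ x y : Fin u, x ≠ y →
      prob (Finset.univ.filter fun i => col i x = col i y) ≤ η)
    (hF : IsUniversal 2 F) {S : Finset (Fin u)} {ρ A : ℝ} (hρ : (S.card : ℝ) ≤ ρ * m)
    (hA : ∀ k, ∑ t ∈ Finset.range k, (t : ℝ) ^ (6 * c) * ρ ^ t ≤ A) :
    ∃ B : Finset (DSSeed kC kH kF kK c l m r),
      prob B ≤ (S.card : ℝ) ^ 2 * η + (2 / l : ℝ) ^ c * (m : ℝ) ^ 2 * A ∧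
      UniformOnOutside (dsFun col H F K) S B := by
  classical
  set B : Finset (DSSeed kC kH kF kK c l m r) := Finset.univ.filter fun σ => BadSeed col H F S σ.1 σ.2.1 with hB
  set ε : ℝ := (2 / l : ℝ) ^ c * (m : ℝ) ^ 2 * A with hε
  have hε0 : 0 ≤ ε := by
    have : 0 ≤ A := le_trans (by simp) (hA 0)
    positivity
  refine ⟨B, ?_, ?_⟩
  · have hcard : B.card = ∑ q, (Finset.univ.filter fun ζ : ZSeed kH kF 2 c l m => BadSeed col H F S q ζ).card * Fintype.card (TableSeed kK c l m r) := by
      rw [hB, card_filter_prod fun (q : Fin kC) (τ : ZSeed kH kF 2 c l m × TableSeed kK c l m r) => BadSeed col H F S q τ.1]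
      refine Finset.sum_congr rfl fun q _ => ?_
      rw [card_filter_prod fun (ζ : ZSeed kH kF 2 c l m) (_ : TableSeed kK c l m r) => BadSeed col H F S q ζ, Finset.card_filter,
        Finset.sum_mul]
      refine Finset.sum_congr rfl fun ζ _ => ?_
      by_cases hb : BadSeed col H F S q ζ <;> simp [hb]
    -- If the collapsing function identifies keys of S, the trivial bound 1 is used; otherwise the
    -- image of S has the same size and the graph estimate applies to it.
    have hq : ∀ q, ((Finset.univ.filter fun ζ : ZSeed kH kF 2 c l m => BadSeed col H F S q ζ).card : ℝ) ≤
        (Fintype.card (ZSeed kH kF 2 c l m) : ℝ)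
          * ((if ¬ Set.InjOn (col q) S then 1 else 0) + ε) := by
      intro q
      by_cases hinj : Set.InjOn (col q) S
      · rw [if_neg (not_not.2 hinj), zero_add]
        have h1 := prob_bad_le hc H hF (S.image (col q)) (Finset.card_image_of_injOn hinj) hρ hA
        have h2 : (Finset.univ.filter fun ζ : ZSeed kH kF 2 c l m => BadSeed col H F S q ζ).card ≤ (Finset.univ.filter
            fun ζ : ZSeed kH kF 2 c l m => Bad (zHash H F ζ) (fun j => F (ζ.2.1 j)) (S.image (col q))).card := by
          refine Finset.card_le_card fun ζ hζ => ?_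
          rw [Finset.mem_filter] at hζ ⊢
          exact ⟨hζ.1, hζ.2.image hinj⟩
        rcases Nat.eq_zero_or_pos (Fintype.card (ZSeed kH kF 2 c l m)) with h0 | h0
        · have : (Finset.univ.filter fun ζ : ZSeed kH kF 2 c l m => BadSeed col H F S q ζ).card ≤ 0 := h0 ▸ Finset.card_le_univ _
          rw [h0, Nat.le_zero.1 this]
          simp
        · unfold prob at h1
          rw [div_le_iff₀ (by exact_mod_cast h0)] at h1
          rw [mul_comm]
          refine le_trans ?_ h1
          exact_mod_cast h2
      · rw [if_pos hinj]
        have : ((Finset.univ.filter fun ζ : ZSeed kH kF 2 c l m => BadSeed col H F S q ζ).card : ℝ) ≤ Fintype.card (ZSeed kH kF 2 c l m) := by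
          exact_mod_cast Finset.card_le_univ _
        nlinarith [(Nat.cast_nonneg (Fintype.card (ZSeed kH kF 2 c l m)) : (0 : ℝ) ≤ _)]
    have hinj := card_not_injOn_le hη hcol S
    have hle : (B.card : ℝ) ≤ (kC * (Fintype.card (ZSeed kH kF 2 c l m) * Fintype.card (TableSeed kK c l m r)) : ℝ)
        * ((S.card : ℝ) ^ 2 * η + ε) := by
      rw [hcard]
      push_cast
      calc _ ≤ ∑ q, ((Fintype.card (ZSeed kH kF 2 c l m) : ℝ)
            * ((if ¬ Set.InjOn (col q) S then 1 else 0) + ε)) * Fintype.card (TableSeed kK c l m r) := by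
            gcongr with q _
            exact hq q
        _ = (Fintype.card (ZSeed kH kF 2 c l m) * Fintype.card (TableSeed kK c l m r) : ℝ)
            * (((Finset.univ.filter fun i => ¬ Set.InjOn (col i) S).card : ℝ) + kC * ε) := by
            rw [← Finset.sum_mul, ← Finset.mul_sum, Finset.sum_add_distrib, Finset.sum_boole,
              Finset.sum_const, Finset.card_univ, Fintype.card_fin, nsmul_eq_mul]
            ring
        _ ≤ (Fintype.card (ZSeed kH kF 2 c l m) * Fintype.card (TableSeed kK c l m r) : ℝ)
            * (kC * ((S.card : ℝ) ^ 2 * η) + kC * ε) := by gcongr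
        _ = _ := by ring
    unfold prob
    refine div_le_of_le_mul₀ (by positivity) (by positivity) ?_
    have hDS : (Fintype.card (DSSeed kC kH kF kK c l m r) : ℝ)
        = kC * (Fintype.card (ZSeed kH kF 2 c l m) * Fintype.card (TableSeed kK c l m r)) := by
      rw [Fintype.card_prod, Fintype.card_prod, Fintype.card_fin]
      push_cast
      rfl
    rw [hDS, mul_comm]
    exact hle
  · refine uniformOnOutside_of_card fun v => ?_
    have hBc : (Finset.univ.filter fun σ : DSSeed kC kH kF kK c l m r => σ ∉ B) = Finset.univ.filter fun σ : DSSeed kC kH kF kK c l m r =>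
        ¬ BadSeed col H F S σ.1 σ.2.1 := by
      ext σ
      simp [hB]
    have h1 : (Finset.univ.filter fun σ : DSSeed kC kH kF kK c l m r =>
        σ ∉ B ∧ ∀ x ∈ S, dsFun col H F K σ x = v x)
        = Finset.univ.filter fun σ : DSSeed kC kH kF kK c l m r =>
          ¬ BadSeed col H F S σ.1 σ.2.1 ∧ ∀ x ∈ S, dsFun col H F K (σ.1, σ.2.1, σ.2.2) x = v x := by
      ext σ
      simp [hB]
    suffices hmain : (Finset.univ.filter fun σ : DSSeed kC kH kF kK c l m r =>
        σ ∉ B ∧ ∀ x ∈ S, dsFun col H F K σ x = v x).card * r ^ S.card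
        = (Finset.univ.filter fun σ : DSSeed kC kH kF kK c l m r => σ ∉ B).card by
      convert hmain
    rw [h1, hBc]
    exact card_filter_triple_mul (BadSeed col H F S)
      (fun q ζ τ => ∀ x ∈ S, dsFun col H F K (q, ζ, τ) x = v x)
      (fun q ζ hb => card_tables_mul col H F K q ζ hb v)

end UniformHashing

namespace UniformHashing

/-! ### The evaluation program -/

/-- The numbers that determine the memory layout and the evaluation program. The memory consists
of two words of `wp` bits describing the collapsing function, of `4c + 3q` tables with `l` entries
of `W` bits, and of an array of `bt`-bit numbers: the powers of `r` below `r ^ k`, and the tables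
`t₁, t₂` cut into blocks of `k` entries, each block being read as a number in base `r`. -/
structure Layout where
  (w wp W bt k c q l m r N p pF : ℕ)

namespace Layout

variable (L : Layout)

/-- The position of the third part of the memory. -/
def start : ℕ := 2 * L.wp + (4 * L.c + 3 * L.q) * L.l * L.W

/-- The number of memory bits. -/
def bits : ℕ := L.start + (L.k + (2 * L.m / L.k + 1)) * L.bt

open _root_.UniformHashing.Expr

/-- The image of the key in the collapsed universe. -/
def collapsedE : Expr :=
  bin .mod (bin .mod (bin .mul (bin .mod key (field L.w (cst 0) L.wp))
    (field L.w (cst L.wp) L.wp)) (cst L.p)) (cst L.N)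

/-- Entry number `e` of table `τ`. -/
def tableE (τ : ℕ) (e : Expr) : Expr :=
  field L.w (bin .add (cst (2 * L.wp + τ * L.l * L.W)) (bin .mul e (cst L.W))) L.W

/-- The value `g_j`. -/
def gE (j : ℕ) : Expr :=
  -- The multiplier of g_j is entry 0 of a table of its own. The remaining l - 1 entries are wasted,
  -- which costs only lower-order space and keeps the layout uniform.
  bin .mod (bin .mod (bin .mul L.collapsedE (L.tableE (3 * L.c + 3 * L.q + j) (cst 0)))
    (cst L.pF)) (cst L.l)

/-- The `d`-th digit of the collapsed key. -/
def digitE (d : ℕ) : Expr := bin .mod (bin .div L.collapsedE (cst (L.l ^ d))) (cst L.l)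

/-- Tabulation with the tables `3c + iq, …`, plus the lookups in the tables `ic, …`. -/
def lookupE (i : ℕ) : Expr :=
  bin .add (sum (fun d => L.tableE (3 * L.c + i * L.q + d) (L.digitE d)) L.q)
    (sum (fun j => L.tableE (i * L.c + j) (L.gE j)) L.c)

/-- The value `i m + h_i`. -/
def indexE (i : ℕ) : Expr := bin .add (cst (i * L.m)) (bin .mod (L.lookupE i) (cst L.m))

/-- The `bt`-bit number at position `e` of the third part of the memory. -/
def arrayE (o : ℕ) (e : Expr) : Expr :=
  field L.w (bin .add (cst (L.start + o)) (bin .mul e (cst L.bt))) L.bt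

/-- The value `t_i[h_i]`. -/
def entryE (i : ℕ) : Expr :=
  -- The quotient of the index by k selects the block and the remainder selects the stored power of
  -- r; dividing and reducing modulo r isolates one base-r digit.
  bin .mod (bin .div (L.arrayE (L.k * L.bt) (bin .div (L.indexE i) (cst L.k)))
    (L.arrayE 0 (bin .mod (L.indexE i) (cst L.k)))) (cst L.r)

/-- The hash value. -/
def hashE : Expr :=
  bin .mod (bin .add (bin .add (L.entryE 0) (L.entryE 1)) (L.lookupE 2)) (cst L.r)

/-! #### Running time -/

/-- Subexpressions are recomputed at each use, and `field` repeats its offset four times. The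
nesting depth is fixed, so the size remains linear in the number c + q of lookups. -/
lemma size_hashE : L.hashE.size ≤ 20000 * (L.c + L.q + 1) := by
  have h1 : L.collapsedE.size = 53 := by simp [collapsedE, size, size_field]
  have h2 : ∀ τ e, (L.tableE τ e).size = 4 * e.size + 35 := by
    intro τ e
    simp only [tableE, size, size_field]
    ring
  have h3 : ∀ j, (L.gE j).size = 97 := by
    intro j
    simp [gE, size, h1, h2]
  have h4 : ∀ d, (L.digitE d).size = 57 := by
    intro j
    simp [digitE, size, h1]
  have h5 : ∀ i, (L.lookupE i).size = L.q * 264 + L.c * 424 + 3 := by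
    intro i
    simp only [lookupE, size]
    rw [size_sum (B := 263) (fun d => by rw [h2, h4]), size_sum (B := 423) (fun d => by rw [h2, h3])]
    ring
  have h6 : ∀ o e, (L.arrayE o e).size = 4 * e.size + 35 := by
    intro τ e
    simp only [arrayE, size, size_field]
    ring
  simp only [hashE, entryE, indexE, size, h5, h6]
  omega

/-! #### Constants -/

/-- Every address offset in the program is at most the number of memory bits, so a few bounds on the
parameters control all constants at once. -/
lemma constsLt_hashE {B : ℕ} (h1 : 1 < B) (hw : L.w < B) (hwp : 2 ^ L.wp < B) (hW : 2 ^ L.W < B)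
    (hbt : 2 ^ L.bt < B) (hk : L.k < B) (hl : L.l < B) (hq : ∀ d < L.q, L.l ^ d < B)
    (hm : L.m < B) (hr : L.r < B) (hN : L.N < B) (hp : L.p < B) (hpF : L.pF < B)
    (hbits : L.bits < B) : L.hashE.ConstsLt B := by
  have e1 : L.wp < B := Nat.lt_two_pow_self.trans hwp
  have e2 : L.W < B := Nat.lt_two_pow_self.trans hW
  have e3 : L.bt < B := Nat.lt_two_pow_self.trans hbt
  have hstart : L.start + L.k * L.bt < B := by
    refine lt_of_le_of_lt ?_ hbits
    rw [bits, add_mul]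
    omega
  have c1 : L.collapsedE.ConstsLt B := by
    refine ⟨⟨⟨⟨trivial, constsLt_field ?_ hw h1 hwp⟩, constsLt_field ?_ hw h1 hwp⟩, hp⟩, hN⟩
    · show 0 < B; omega
    · exact e1
  have c2 : ∀ τ e, τ < 4 * L.c + 3 * L.q → e.ConstsLt B → (L.tableE τ e).ConstsLt B := by
    intro τ e hτ he
    refine constsLt_field ⟨?_, he, e2⟩ hw h1 hW
    show 2 * L.wp + τ * L.l * L.W < B
    refine lt_of_le_of_lt ?_ hstart
    rw [start, add_assoc]
    have : τ * L.l * L.W ≤ (4 * L.c + 3 * L.q) * L.l * L.W := by gcongr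
    omega
  have c3 : ∀ j < L.c, (L.gE j).ConstsLt B := by
    intro j hj
    refine ⟨⟨⟨c1, c2 _ _ (by omega) ?_⟩, hpF⟩, hl⟩
    show 0 < B; omega
  have c4 : ∀ d < L.q, (L.digitE d).ConstsLt B := fun d hd => ⟨⟨c1, hq d hd⟩, hl⟩
  have c5 : ∀ i ≤ 2, (L.lookupE i).ConstsLt B := by
    intro i hi
    refine ⟨constsLt_sum (by omega) fun d hd => c2 _ _ ?_ (c4 d hd),
      constsLt_sum (by omega) fun d hd => c2 _ _ ?_ (c3 d hd)⟩
    · have : i * L.q ≤ 2 * L.q := by gcongr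
      omega
    · have : i * L.c ≤ 2 * L.c := by gcongr
      omega
  have c6 : ∀ i ≤ 1, (L.indexE i).ConstsLt B := by
    intro i hi
    refine ⟨?_, c5 i (by omega), hm⟩
    show i * L.m < B
    have : i * L.m ≤ 1 * L.m := by gcongr
    omega
  have c7 : ∀ o e, o ≤ L.k * L.bt → e.ConstsLt B → (L.arrayE o e).ConstsLt B := by
    intro o e ho he
    refine constsLt_field ⟨?_, he, e3⟩ hw h1 hbt
    show L.start + o < B
    omega
  have c8 : ∀ i ≤ 1, (L.entryE i).ConstsLt B := fun i hi =>
    ⟨⟨c7 _ _ le_rfl ⟨c6 i hi, hk⟩, c7 _ _ (Nat.zero_le _) ⟨c6 i hi, hk⟩⟩, hr⟩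
  exact ⟨⟨⟨c8 0 (by omega), c8 1 le_rfl⟩, c5 2 le_rfl⟩, hr⟩

/-! #### Correctness -/

/-- All numbers occurring in the evaluation fit into words. -/
structure Fits (u : ℕ) : Prop where
  wp_lt : L.wp < L.w
  W_lt : L.W < L.w
  bt_lt : L.bt < L.w
  bits_lt : L.bits + 1 < 2 ^ L.w
  u_mul_p : u * L.p < 2 ^ L.w
  u_pos : 0 < u
  N_pos : 0 < L.N
  N_le_u : L.N ≤ u
  N_le_p : L.N ≤ L.p
  N_mul_pF : L.N * L.pF < 2 ^ L.w
  l_pos : 0 < L.l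
  l_lt : L.l < 2 ^ L.w
  l_pow_lt : ∀ d < L.q, L.l ^ d < 2 ^ L.w
  m_pos : 0 < L.m
  m_lt : (L.c + L.q + 2) * L.m < 2 ^ L.w
  r_lt : (L.c + L.q + 2) * L.r < 2 ^ L.w
  two_le_r : 2 ≤ L.r
  k_pos : 0 < L.k
  k_lt : L.k < 2 ^ L.w
  r_pow_le : L.r ^ L.k ≤ 2 ^ L.bt
  m_le_W : L.m ≤ 2 ^ L.W
  r_le_W : L.r ≤ 2 ^ L.W
  pF_le_W : L.pF ≤ 2 ^ L.W

/-- The hash value as a function of the stored parameters `P`, `A`, the tables `tab` and the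
entries `T` of `t₁, t₂`. -/
structure Data where
  (P A : ℕ)
  (tab : ℕ → ℕ → ℕ)
  (T : ℕ → ℕ)

variable {L} (D : Data)

/-- The collapsed key. -/
def Data.x (L : Layout) (key : ℕ) : ℕ := key % D.P * D.A % L.p % L.N

/-- The value `g_j`. -/
def Data.g (L : Layout) (key j : ℕ) : ℕ :=
  D.x L key * D.tab (3 * L.c + 3 * L.q + j) 0 % L.pF % L.l

/-- The sum of the lookups numbered `i`. -/
def Data.lookup (L : Layout) (key i : ℕ) : ℕ :=
  ∑ d ∈ Finset.range L.q, D.tab (3 * L.c + i * L.q + d) (D.x L key / L.l ^ d % L.l)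
    + ∑ j ∈ Finset.range L.c, D.tab (i * L.c + j) (D.g L key j)

/-- The hash value. -/
def Data.hash (L : Layout) (key : ℕ) : ℕ :=
  (D.T (0 * L.m + D.lookup L key 0 % L.m) + D.T (1 * L.m + D.lookup L key 1 % L.m)
    + D.lookup L key 2) % L.r

/-- The stored numbers respect their ranges. -/
structure Data.Valid (L : Layout) : Prop where
  P_lt : D.P < 2 ^ L.wp
  A_lt : D.A < 2 ^ L.wp
  A_le : D.A ≤ L.p
  z_lt : ∀ i ≤ 1, ∀ j < L.c, ∀ v < L.l, D.tab (i * L.c + j) v < L.m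
  y_lt : ∀ j < L.c, ∀ v < L.l, D.tab (2 * L.c + j) v < L.r
  f_lt : ∀ i ≤ 1, ∀ d < L.q, ∀ v < L.l, D.tab (3 * L.c + i * L.q + d) v < L.m
  K_lt : ∀ d < L.q, ∀ v < L.l, D.tab (3 * L.c + 2 * L.q + d) v < L.r
  a_le : ∀ j < L.c, ∀ v < L.l, D.tab (3 * L.c + 3 * L.q + j) v < L.pF
  T_lt : ∀ i, D.T i < L.r

/-! ### Base-r blocks and the correctness of the program -/

lemma sum_digits_lt {r k : ℕ} (a : ℕ → ℕ) (ha : ∀ i, a i < r) :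
    ∑ d ∈ Finset.range k, a d * r ^ d < r ^ k := by
  induction k with
  | zero => simp
  | succ k ih =>
    rw [Finset.sum_range_succ, pow_succ]
    have := ha k
    nlinarith [pow_pos (show 0 < r by omega) k]

lemma sum_digits_div_mod {r k e : ℕ} (a : ℕ → ℕ) (ha : ∀ i, a i < r) (he : e < k) :
    (∑ d ∈ Finset.range k, a d * r ^ d) / r ^ e % r = a e := by
  have hr : 0 < r := (Nat.zero_le _).trans_lt (ha 0)
  induction e generalizing k a with
  | zero =>
    obtain ⟨k, rfl⟩ : ∃ i, k = i + 1 := ⟨k - 1, by omega⟩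
    rw [Finset.sum_range_succ', pow_zero, Nat.div_one, mul_one]
    simp only [pow_succ, ← mul_assoc]
    rw [← Finset.sum_mul, Nat.mul_add_mod_of_lt (ha 0)]
  | succ e ih =>
    obtain ⟨k, rfl⟩ : ∃ i, k = i + 1 := ⟨k - 1, by omega⟩
    have := ih (k := k) (fun i => a (i + 1)) (fun i => ha _) (by omega)
    rw [← this, pow_succ', ← Nat.div_div_eq_div_mul, Finset.sum_range_succ', pow_zero, mul_one]
    simp only [pow_succ, ← mul_assoc]
    rw [← Finset.sum_mul, mul_comm _ r, Nat.mul_add_div hr, Nat.div_eq_of_lt (ha 0), add_zero]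

set_option maxHeartbeats 1000000 in
/-- Any valid data can be stored such that the program computes the hash value. -/
theorem exists_memory {u : ℕ} (hL : L.Fits u) (hD : D.Valid L) :
    ∃ mem : Fin L.bits → Bool, ∀ x < u, L.hashE.val L.w mem x = D.hash L x := by
  have hr0 : 0 < L.r := by have := hL.two_le_r; omega
  have htab : ∀ τ < 4 * L.c + 3 * L.q, ∀ v < L.l, D.tab τ v < 2 ^ L.W := by
    intro τ hτ v hv
    have h1 := hL.m_le_W
    have h2 := hL.r_le_W
    have h3 := hL.pF_le_W
    rcases Nat.lt_or_ge τ L.c with h | h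
    · have := hD.z_lt 0 (by omega) τ h v hv
      simp only [zero_mul, zero_add] at this
      omega
    rcases Nat.lt_or_ge τ (2 * L.c) with h' | h'
    · have := hD.z_lt 1 le_rfl (τ - L.c) (by omega) v hv
      rw [one_mul, Nat.add_sub_cancel' h] at this
      omega
    rcases Nat.lt_or_ge τ (3 * L.c) with h | h
    · have := hD.y_lt (τ - 2 * L.c) (by omega) v hv
      rw [Nat.add_sub_cancel' h'] at this
      omega
    rcases Nat.lt_or_ge τ (3 * L.c + L.q) with h' | h'
    · have := hD.f_lt 0 (by omega) (τ - 3 * L.c) (by omega) v hv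
      rw [zero_mul, add_zero, Nat.add_sub_cancel' h] at this
      omega
    rcases Nat.lt_or_ge τ (3 * L.c + 2 * L.q) with h | h
    · have := hD.f_lt 1 le_rfl (τ - (3 * L.c + L.q)) (by omega) v hv
      rw [one_mul, Nat.add_sub_cancel' h'] at this
      omega
    rcases Nat.lt_or_ge τ (3 * L.c + 3 * L.q) with h' | h'
    · have := hD.K_lt (τ - (3 * L.c + 2 * L.q)) (by omega) v hv
      rw [Nat.add_sub_cancel' h] at this
      omega
    · have := hD.a_le (τ - (3 * L.c + 3 * L.q)) (by omega) v hv
      rw [Nat.add_sub_cancel' h'] at this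
      omega
  -- The last block may reach beyond index 2m; `D.T` is below r everywhere, so the block is still a
  -- valid base-r number.
  set blk : ℕ → ℕ := fun b => ∑ d ∈ Finset.range L.k, D.T (b * L.k + d) * L.r ^ d with hblk
  have hblk_lt : ∀ b, blk b < 2 ^ L.bt := fun b =>
    (sum_digits_lt (fun d => D.T (b * L.k + d)) fun d => hD.T_lt _).trans_le hL.r_pow_le
  have hpow_lt : ∀ i < L.k, L.r ^ i < 2 ^ L.bt := fun i hi =>
    (Nat.pow_lt_pow_right hL.two_le_r hi).trans_le hL.r_pow_le
  obtain ⟨M, hM, hM1, hM2, hM3⟩ := exists_three_arrays (n₁ := 2) (b₁ := L.wp)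
    (n₂ := (4 * L.c + 3 * L.q) * L.l) (b₂ := L.W) (n₃ := L.k + (2 * L.m / L.k + 1)) (b₃ := L.bt)
    (fun i => if i = 0 then D.P else D.A) (fun i => D.tab (i / L.l) (i % L.l))
    (fun i => if i < L.k then L.r ^ i else blk (i - L.k))
    (fun i _ => by
      split_ifs
      · exact hD.P_lt
      · exact hD.A_lt)
    (fun i hi => htab _ (Nat.div_lt_of_lt_mul (by rwa [mul_comm] at hi)) _ (Nat.mod_lt _ hL.l_pos))
    (fun i _ => by
      split_ifs with h
      · exact hpow_lt i h
      · exact hblk_lt _)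
  change M < 2 ^ L.bits at hM
  change ∀ i < L.k + (2 * L.m / L.k + 1), M / 2 ^ (L.start + i * L.bt) % 2 ^ L.bt = _ at hM3
  have hMP : M / 2 ^ 0 % 2 ^ L.wp = D.P := by simpa using hM1 0 (by omega)
  have hMA : M / 2 ^ L.wp % 2 ^ L.wp = D.A := by simpa using hM1 1 (by omega)
  have hw := hL.bits_lt
  have hstart : L.start ≤ L.bits := Nat.le_add_right _ _
  have hu1 := hL.u_pos
  have hN0 := hL.N_pos
  have hNp := hL.N_le_p
  have hu : u < 2 ^ L.w ∨ L.p = 0 := by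
    rcases Nat.eq_zero_or_pos L.p with h | h
    · exact Or.inr h
    · exact Or.inl (lt_of_le_of_lt (Nat.le_mul_of_pos_right _ h) hL.u_mul_p)
  have hu : u < 2 ^ L.w := hu.resolve_right (by omega)
  have hp : L.p < 2 ^ L.w := lt_of_le_of_lt (Nat.le_mul_of_pos_left _ hu1) hL.u_mul_p
  have hN : L.N < 2 ^ L.w := hL.N_le_u.trans_lt hu
  have hwp2 : 2 * L.wp ≤ L.start := Nat.le_add_right _ _
  have hm : L.m < 2 ^ L.w :=
    lt_of_le_of_lt (Nat.le_mul_of_pos_left _ (by omega)) hL.m_lt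
  have hr : L.r < 2 ^ L.w :=
    lt_of_le_of_lt (Nat.le_mul_of_pos_left _ (by omega)) hL.r_lt
  have hWw : L.W < 2 ^ L.w := hL.W_lt.trans Nat.lt_two_pow_self
  have hbw : L.bt < 2 ^ L.w := hL.bt_lt.trans Nat.lt_two_pow_self
  refine ⟨memOf L.bits M, fun x hx => ?_⟩
  have v0 : ∀ {a : ℕ}, a < 2 ^ L.w → (cst a).val L.w (memOf L.bits M) x = a := fun h => val_cst h
  have v1 : L.collapsedE.val L.w (memOf L.bits M) x = D.x L x := by
    have f1 := val_field (x := x) hM (v0 (show 0 < 2 ^ L.w by positivity)) (by omega) hL.wp_lt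
    have f2 := val_field (x := x) hM (v0 (show L.wp < 2 ^ L.w by omega)) (by omega) hL.wp_lt
    rw [hMP] at f1
    rw [hMA] at f2
    have hmul : x % D.P * D.A < 2 ^ L.w := by
      refine lt_of_le_of_lt ?_ hL.u_mul_p
      exact Nat.mul_le_mul ((Nat.mod_le _ _).trans hx.le) hD.A_le
    exact val_mod (val_mod (val_mul (val_mod (val_key (hx.trans hu)) f1 (hx.trans hu)) f2 hmul)
      (v0 hp) hmul) (v0 hN) ((Nat.mod_le _ _).trans_lt hmul)
  have hxN : D.x L x < L.N := Nat.mod_lt _ hN0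
  have v2 : ∀ τ < 4 * L.c + 3 * L.q, ∀ (e : Expr) (v : ℕ), v < L.l →
      e.val L.w (memOf L.bits M) x = v →
      (L.tableE τ e).val L.w (memOf L.bits M) x = D.tab τ v := by
    intro τ hτ e v hv he
    have hi : τ * L.l + v < (4 * L.c + 3 * L.q) * L.l := by
      calc τ * L.l + v < (τ + 1) * L.l := by rw [add_mul]; omega
        _ ≤ _ := Nat.mul_le_mul_right _ hτ
    have hoff : 2 * L.wp + τ * L.l * L.W + v * L.W ≤ L.start := by
      rw [add_assoc, ← add_mul]
      exact Nat.add_le_add_left (Nat.mul_le_mul_right _ hi.le) _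
    have hvW : v * L.W < 2 ^ L.w := by omega
    have := val_field (x := x) hM (val_add (v0 (show 2 * L.wp + τ * L.l * L.W < 2 ^ L.w by omega))
      (val_mul he (v0 hWw) hvW) (by omega)) (by omega) hL.W_lt
    rw [tableE, this, add_assoc, ← add_mul, hM2 _ hi]
    congr 1
    · rw [mul_comm, Nat.mul_add_div hL.l_pos, Nat.div_eq_of_lt hv, add_zero]
    · rw [Nat.mul_add_mod_of_lt hv]
  have v3 : ∀ j < L.c, (L.gE j).val L.w (memOf L.bits M) x = D.g L x j := by
    intro j hj
    have ha := hD.a_le j hj 0 hL.l_pos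
    have hmul : D.x L x * D.tab (3 * L.c + 3 * L.q + j) 0 < 2 ^ L.w :=
      lt_of_le_of_lt (Nat.mul_le_mul hxN.le ha.le) hL.N_mul_pF
    have hpF : L.pF < 2 ^ L.w := lt_of_le_of_lt (Nat.le_mul_of_pos_left _ hN0) hL.N_mul_pF
    exact val_mod (val_mod (val_mul v1 (v2 _ (by omega) _ 0 hL.l_pos (v0 (by positivity))) hmul)
      (v0 hpF) hmul) (v0 hL.l_lt) ((Nat.mod_le _ _).trans_lt hmul)
  have hgl : ∀ j, D.g L x j < L.l := fun j => Nat.mod_lt _ hL.l_pos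
  have v4 : ∀ d < L.q, (L.digitE d).val L.w (memOf L.bits M) x = D.x L x / L.l ^ d % L.l := by
    intro d hd
    exact val_mod (val_div v1 (v0 (hL.l_pow_lt d hd)) (hxN.trans hN)) (v0 hL.l_lt)
      ((Nat.div_le_self _ _).trans_lt (hxN.trans hN))
  -- The common bound B is m for the two graph functions and r for the final sum; adding c + q
  -- entries below B stays within a word.
  have v5 : ∀ i ≤ 2, ∀ B, (∀ d < L.q, ∀ v < L.l, D.tab (3 * L.c + i * L.q + d) v ≤ B) →
      (∀ j < L.c, ∀ v < L.l, D.tab (i * L.c + j) v ≤ B) → (L.c + L.q + 2) * B < 2 ^ L.w →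
      (L.lookupE i).val L.w (memOf L.bits M) x = D.lookup L x i ∧
        D.lookup L x i ≤ (L.c + L.q) * B := by
    intro i hi B hB1 hB2 hB
    have hiq : i * L.q ≤ 2 * L.q := by gcongr
    have hic : i * L.c ≤ 2 * L.c := by gcongr
    have s1 := val_sum (w := L.w) (mem := memOf L.bits M) (x := x) (n := L.q) (B := B)
      (F := fun d => L.tableE (3 * L.c + i * L.q + d) (L.digitE d))
      (a := fun d => D.tab (3 * L.c + i * L.q + d) (D.x L x / L.l ^ d % L.l))
      (fun d hd => v2 _ (by omega) _ _ (Nat.mod_lt _ hL.l_pos) (v4 d hd))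
      (fun d hd => hB1 d hd _ (Nat.mod_lt _ hL.l_pos)) (by nlinarith)
    have s2 := val_sum (w := L.w) (mem := memOf L.bits M) (x := x) (n := L.c) (B := B)
      (F := fun j => L.tableE (i * L.c + j) (L.gE j))
      (a := fun j => D.tab (i * L.c + j) (D.g L x j))
      (fun j hj => v2 _ (by omega) _ _ (hgl j) (v3 j hj))
      (fun j hj => hB2 j hj _ (hgl j)) (by nlinarith)
    have b1 : ∑ d ∈ Finset.range L.q, D.tab (3 * L.c + i * L.q + d) (D.x L x / L.l ^ d % L.l)
        ≤ L.q * B := by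
      simpa using Finset.sum_le_card_nsmul (Finset.range L.q) _ B
        (fun d hd => hB1 d (Finset.mem_range.1 hd) _ (Nat.mod_lt _ hL.l_pos))
    have b2 : ∑ j ∈ Finset.range L.c, D.tab (i * L.c + j) (D.g L x j) ≤ L.c * B := by
      simpa using Finset.sum_le_card_nsmul (Finset.range L.c) _ B
        (fun j hj => hB2 j (Finset.mem_range.1 hj) _ (hgl j))
    have hb : D.lookup L x i ≤ (L.c + L.q) * B := by
      unfold Data.lookup
      nlinarith
    exact ⟨val_add s1 s2 (lt_of_le_of_lt hb (by nlinarith)), hb⟩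
  have v6 : ∀ i ≤ 1, (L.indexE i).val L.w (memOf L.bits M) x
      = i * L.m + D.lookup L x i % L.m := by
    intro i hi
    obtain ⟨e1, e2⟩ := v5 i (by omega) L.m (fun d hd v hv => (hD.f_lt i hi d hd v hv).le)
      (fun j hj v hv => (hD.z_lt i hi j hj v hv).le) hL.m_lt
    have h3 : D.lookup L x i < 2 ^ L.w := lt_of_le_of_lt e2 (by have := hL.m_lt; nlinarith)
    have h4 := Nat.mod_lt (D.lookup L x i) hL.m_pos
    have h5 : i * L.m ≤ 1 * L.m := by gcongr
    have h6 : 2 * L.m < 2 ^ L.w := lt_of_le_of_lt (Nat.mul_le_mul_right _ (by omega)) hL.m_lt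
    exact val_add (v0 (by omega)) (val_mod e1 (v0 hm) h3) (by omega)
  have hidx : ∀ i ≤ 1, i * L.m + D.lookup L x i % L.m < 2 * L.m := by
    intro i hi
    have h4 := Nat.mod_lt (D.lookup L x i) hL.m_pos
    have h5 : i * L.m ≤ 1 * L.m := by gcongr
    omega
  -- The array holds the k powers of r followed by the blocks, so o = 0 addresses a power and o = k
  -- a block.
  have v7 : ∀ o i (e : Expr), o + i < L.k + (2 * L.m / L.k + 1) →
      e.val L.w (memOf L.bits M) x = i →
      (L.arrayE (o * L.bt) e).val L.w (memOf L.bits M) x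
        = if o + i < L.k then L.r ^ (o + i) else blk (o + i - L.k) := by
    intro o i e hoi he
    have hoff : L.start + o * L.bt + i * L.bt ≤ L.bits := by
      rw [add_assoc, ← add_mul]
      exact Nat.add_le_add_left (Nat.mul_le_mul_right _ hoi.le) _
    have := val_field (x := x) hM (val_add (v0 (show L.start + o * L.bt < 2 ^ L.w by omega))
      (val_mul he (v0 hbw) (by omega)) (by omega)) (by omega) hL.bt_lt
    rw [arrayE, this, add_assoc, ← add_mul, hM3 _ hoi]
  have v8 : ∀ i ≤ 1, (L.entryE i).val L.w (memOf L.bits M) x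
      = D.T (i * L.m + D.lookup L x i % L.m) := by
    intro i hi
    set n := i * L.m + D.lookup L x i % L.m with hn
    have h1 := hidx i hi
    have h2 : 2 * L.m < 2 ^ L.w := lt_of_le_of_lt (Nat.mul_le_mul_right _ (by omega)) hL.m_lt
    have hdiv : n / L.k ≤ 2 * L.m / L.k := Nat.div_le_div_right h1.le
    have hmod := Nat.mod_lt n hL.k_pos
    have e1 := v7 L.k (n / L.k) _ (by omega) (val_div (v6 i hi) (v0 hL.k_lt) (by omega))
    have e2 := v7 0 (n % L.k) _ (by rw [zero_add]; exact Nat.lt_add_right _ hmod) (val_mod (v6 i hi) (v0 hL.k_lt) (by omega))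
    rw [if_neg (not_lt.2 (Nat.le_add_right _ _)), Nat.add_sub_cancel_left] at e1
    rw [zero_add, if_pos hmod, zero_mul] at e2
    have hb : blk (n / L.k) < 2 ^ L.w :=
      (hblk_lt _).trans (Nat.pow_lt_pow_right one_lt_two hL.bt_lt)
    have e3 : (L.entryE i).val L.w (memOf L.bits M) x = blk (n / L.k) / L.r ^ (n % L.k) % L.r :=
      val_mod (val_div e1 e2 hb) (v0 hr) ((Nat.div_le_self _ _).trans_lt hb)
    rw [e3, hblk]
    rw [sum_digits_div_mod (fun d => D.T (n / L.k * L.k + d)) (fun d => hD.T_lt _) hmod,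
      Nat.div_add_mod']
  obtain ⟨e1, e2⟩ := v5 2 le_rfl L.r (fun d hd v hv => (hD.K_lt d hd v hv).le)
    (fun j hj v hv => (hD.y_lt j hj v hv).le) hL.r_lt
  have t0 := hD.T_lt (0 * L.m + D.lookup L x 0 % L.m)
  have t1 := hD.T_lt (1 * L.m + D.lookup L x 1 % L.m)
  have hrl := hL.r_lt
  have hb : D.T (0 * L.m + D.lookup L x 0 % L.m) + D.T (1 * L.m + D.lookup L x 1 % L.m)
      + D.lookup L x 2 < 2 ^ L.w := by nlinarith
  exact val_mod (val_add (val_add (v8 0 (by omega)) (v8 1 le_rfl) (by omega)) e1 hb) (v0 hr) hb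

end Layout

end UniformHashing

namespace UniformHashing

/-! ### The data structure -/

/-- A table as a function on natural numbers. -/
def tableNat {a b M : ℕ} (f : Fin a → Fin b → Fin M) (i v : ℕ) : ℕ :=
  if h : i < a ∧ v < b then f ⟨i, h.1⟩ ⟨v, h.2⟩ else 0

lemma tableNat_fin {a b M : ℕ} (f : Fin a → Fin b → Fin M) (i : Fin a) (v : Fin b) :
    tableNat f i v = f i v := by
  simp [tableNat]

lemma tableNat_lt {a b M i v : ℕ} (f : Fin a → Fin b → Fin M) (hi : i < a) (hv : v < b) :
    tableNat f i v < M := by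
  simp [tableNat, hi, hv]

namespace Layout

/-- The random choices of the data structure with a given layout. -/
abbrev Seed (L : Layout) (kC : ℕ) : Type :=
  DSSeed kC (tabCard L.q L.l L.m) (L.pF - 1) (tabCard L.q L.l L.r) L.c L.l L.m L.r

variable (L : Layout) {kC u : ℕ}

/-- The tables determined by the random choices. -/
noncomputable def seedTab (ω : L.Seed kC) (τ v : ℕ) : ℕ :=
  if τ < L.c then tableNat (ω.2.1.2.2 0) τ v
  else if τ < 2 * L.c then tableNat (ω.2.1.2.2 1) (τ - L.c) v
  else if τ < 3 * L.c then tableNat ω.2.2.2.1 (τ - 2 * L.c) v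
  else if τ < 3 * L.c + L.q then tableNat (tabEquiv _ _ _ (ω.2.1.1 0)) (τ - 3 * L.c) v
  else if τ < 3 * L.c + 2 * L.q then
    tableNat (tabEquiv _ _ _ (ω.2.1.1 1)) (τ - (3 * L.c + L.q)) v
  else if τ < 3 * L.c + 3 * L.q then
    tableNat (tabEquiv _ _ _ ω.2.2.2.2) (τ - (3 * L.c + 2 * L.q)) v
  else if h : τ - (3 * L.c + 3 * L.q) < L.c then ω.2.1.2.1 ⟨_, h⟩ + 1 else 0

/-- The concatenation of the tables `t₁` and `t₂`. -/
def seedEntry (ω : L.Seed kC) (i : ℕ) : ℕ :=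
  if h : i < L.m then ω.2.2.1 0 ⟨i, h⟩ else if h : i - L.m < L.m then ω.2.2.1 1 ⟨i - L.m, h⟩ else 0

/-- The data to be stored. -/
noncomputable def seedData (P A : Fin kC → ℕ) (ω : L.Seed kC) : Data :=
  ⟨P ω.1, A ω.1, L.seedTab ω, L.seedEntry ω⟩

/-! ### Agreement of the stored tables with the random choices -/

variable {L} (ω : L.Seed kC)

lemma seedTab_z₀ {j : ℕ} (hj : j < L.c) (v : ℕ) :
    L.seedTab ω (0 * L.c + j) v = tableNat (ω.2.1.2.2 0) j v := by
  simp [seedTab, hj]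

lemma seedTab_z₁ {j : ℕ} (hj : j < L.c) (v : ℕ) :
    L.seedTab ω (1 * L.c + j) v = tableNat (ω.2.1.2.2 1) j v := by
  unfold seedTab
  rw [if_neg (by omega), if_pos (by omega)]
  congr 1
  omega

lemma seedTab_y {j : ℕ} (hj : j < L.c) (v : ℕ) :
    L.seedTab ω (2 * L.c + j) v = tableNat ω.2.2.2.1 j v := by
  unfold seedTab
  rw [if_neg (by omega), if_neg (by omega), if_pos (by omega)]
  congr 1
  omega

lemma seedTab_f₀ {d : ℕ} (hd : d < L.q) (v : ℕ) :
    L.seedTab ω (3 * L.c + 0 * L.q + d) v = tableNat (tabEquiv _ _ _ (ω.2.1.1 0)) d v := by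
  unfold seedTab
  rw [if_neg (by omega), if_neg (by omega), if_neg (by omega), if_pos (by omega)]
  congr 1
  omega

lemma seedTab_f₁ {d : ℕ} (hd : d < L.q) (v : ℕ) :
    L.seedTab ω (3 * L.c + 1 * L.q + d) v = tableNat (tabEquiv _ _ _ (ω.2.1.1 1)) d v := by
  unfold seedTab
  rw [if_neg (by omega), if_neg (by omega), if_neg (by omega), if_neg (by omega),
    if_pos (by omega)]
  congr 1
  omega

lemma seedTab_K {d : ℕ} (hd : d < L.q) (v : ℕ) :
    L.seedTab ω (3 * L.c + 2 * L.q + d) v = tableNat (tabEquiv _ _ _ ω.2.2.2.2) d v := by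
  unfold seedTab
  rw [if_neg (by omega), if_neg (by omega), if_neg (by omega), if_neg (by omega),
    if_neg (by omega), if_pos (by omega)]
  congr 1
  omega

lemma seedTab_a {j : ℕ} (hj : j < L.c) (v : ℕ) :
    L.seedTab ω (3 * L.c + 3 * L.q + j) v = ω.2.1.2.1 ⟨j, hj⟩ + 1 := by
  unfold seedTab
  rw [if_neg (by omega), if_neg (by omega), if_neg (by omega), if_neg (by omega),
    if_neg (by omega), if_neg (by omega), dif_pos (by omega)]
  simp

lemma seedData_valid {P A : Fin kC → ℕ} (hP : ∀ i, P i ≤ L.p) (hA : ∀ i, A i ≤ L.p)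
    (hp : L.p < 2 ^ L.wp) (hr : 0 < L.r) : (L.seedData P A ω).Valid L where
  P_lt := (hP _).trans_lt hp
  A_lt := (hA _).trans_lt hp
  A_le := hA _
  z_lt i hi j hj v hv := by
    interval_cases i
    · exact (seedTab_z₀ ω hj v).trans_lt (tableNat_lt _ hj hv)
    · exact (seedTab_z₁ ω hj v).trans_lt (tableNat_lt _ hj hv)
  y_lt j hj v hv := (seedTab_y ω hj v).trans_lt (tableNat_lt _ hj hv)
  f_lt i hi d hd v hv := by
    interval_cases i
    · exact (seedTab_f₀ ω hd v).trans_lt (tableNat_lt _ hd hv)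
    · exact (seedTab_f₁ ω hd v).trans_lt (tableNat_lt _ hd hv)
  K_lt d hd v hv := (seedTab_K ω hd v).trans_lt (tableNat_lt _ hd hv)
  a_le j hj v _ := by
    refine (seedTab_a ω hj v).trans_lt ?_
    have := (ω.2.1.2.1 ⟨j, hj⟩).2
    omega
  T_lt i := by
    show L.seedEntry ω i < L.r
    unfold seedEntry
    split_ifs
    · exact Fin.isLt _
    · exact Fin.isLt _
    · exact hr

variable [NeZero L.l] [NeZero L.m] [NeZero L.r]

/-- The program sums natural numbers and reduces once, whereas the hash classes reduce at each
stage; the results agree modulo m and modulo r. It remains to match the entries through the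
numbering of the tables. -/
lemma hash_seedData {P A : Fin kC → ℕ} {col : Fin kC → Fin u → Fin L.N}
    (hcol : ∀ i x, (col i x : ℕ) = x % P i * A i % L.p % L.N) (x : Fin u) :
    (L.seedData P A ω).hash L x
      = dsHash col (tabClass L.q L.l L.m L.N) (mulClass L.pF L.l L.N (NeZero.pos L.l))
        (tabClass L.q L.l L.r L.N) ω x := by
  set D := L.seedData P A ω with hD
  set F := mulClass L.pF L.l L.N (NeZero.pos L.l) with hF
  set x' := col ω.1 x with hx'
  have hx : D.x L x = x' := (hcol ω.1 x).symm
  have hg : ∀ j : Fin L.c, D.g L x j = F (ω.2.1.2.1 j) x' := by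
    intro j
    have h1 : D.tab (3 * L.c + 3 * L.q + j) 0 = ω.2.1.2.1 j + 1 := seedTab_a ω j.2 0
    rw [Data.g, h1, hx]
    rfl
  have hdig : ∀ d : ℕ, D.x L x / L.l ^ d % L.l = digit L.l d x' := by
    intro d
    rw [hx]
    rfl
  have hz : ∀ (i : Fin 2), D.lookup L x i % L.m
      = zHash (tabClass L.q L.l L.m L.N) F ω.2.1 i x' := by
    intro i
    have e1 : ∀ d : Fin L.q, D.tab (3 * L.c + i * L.q + d) (D.x L x / L.l ^ (d : ℕ) % L.l)
        = tabEquiv _ _ _ (ω.2.1.1 i) d (digit L.l d x') := by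
      intro d
      rw [hdig]
      fin_cases i
      · exact (seedTab_f₀ ω d.2 _).trans (tableNat_fin _ _ _)
      · exact (seedTab_f₁ ω d.2 _).trans (tableNat_fin _ _ _)
    have e2 : ∀ j : Fin L.c, D.tab (i * L.c + j) (D.g L x j)
        = ω.2.1.2.2 i j (F (ω.2.1.2.1 j) x') := by
      intro j
      rw [hg]
      fin_cases i
      · exact (seedTab_z₀ ω j.2 _).trans (tableNat_fin _ _ _)
      · exact (seedTab_z₁ ω j.2 _).trans (tableNat_fin _ _ _)
    unfold Data.lookup zHash
    rw [Finset.sum_range, Finset.sum_range, Finset.sum_congr rfl fun d _ => e1 d,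
      Finset.sum_congr rfl fun j _ => e2 j]
    simp only [tabClass, tabulate, fin_val_sum, Nat.mod_add_mod]
  have hK : D.lookup L x 2 % L.r = ((tabClass L.q L.l L.r L.N ω.2.2.2.2 x' : ℕ)
      + ∑ j, (ω.2.2.2.1 j (F (ω.2.1.2.1 j) x') : ℕ)) % L.r := by
    have e1 : ∀ d : Fin L.q, D.tab (3 * L.c + 2 * L.q + d) (D.x L x / L.l ^ (d : ℕ) % L.l)
        = tabEquiv _ _ _ ω.2.2.2.2 d (digit L.l d x') := by
      intro d
      rw [hdig]
      exact (seedTab_K ω d.2 _).trans (tableNat_fin _ _ _)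
    have e2 : ∀ j : Fin L.c, D.tab (2 * L.c + j) (D.g L x j)
        = ω.2.2.2.1 j (F (ω.2.1.2.1 j) x') := by
      intro j
      rw [hg]
      exact (seedTab_y ω j.2 _).trans (tableNat_fin _ _ _)
    unfold Data.lookup
    rw [Finset.sum_range, Finset.sum_range, Finset.sum_congr rfl fun d _ => e1 d,
      Finset.sum_congr rfl fun j _ => e2 j]
    simp only [tabClass, tabulate, fin_val_sum, Nat.mod_add_mod]
  have hT0 : D.T (0 * L.m + D.lookup L x 0 % L.m)
      = ω.2.2.1 0 (zHash (tabClass L.q L.l L.m L.N) F ω.2.1 0 x') := by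
    have := hz 0
    simp only [Fin.isValue, Fin.val_zero] at this
    rw [this, zero_mul, zero_add]
    show L.seedEntry ω _ = _
    simp [seedEntry]
  have hT1 : D.T (1 * L.m + D.lookup L x 1 % L.m)
      = ω.2.2.1 1 (zHash (tabClass L.q L.l L.m L.N) F ω.2.1 1 x') := by
    have := hz 1
    simp only [Fin.isValue, Fin.val_one] at this
    rw [this, one_mul]
    show L.seedEntry ω _ = _
    simp [seedEntry]
  unfold Data.hash dsHash
  rw [hT0, hT1, Nat.add_mod, hK, ← Nat.add_mod, ← add_assoc]

/-- The data structure with a given layout. -/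
noncomputable def ds (hL : L.Fits u) (hne : Nonempty (L.Seed kC)) {P A : Fin kC → ℕ}
    (hP : ∀ i, P i ≤ L.p) (hA : ∀ i, A i ≤ L.p) (hp : L.p < 2 ^ L.wp)
    (col : Fin kC → Fin u → Fin L.N)
    (hcol : ∀ i x, (col i x : ℕ) = x % P i * A i % L.p % L.N) : HashDS u L.r L.w where
  Ω := L.Seed kC
  nonemptyΩ := hne
  memBits := L.bits
  mem ω := (exists_memory _ hL (seedData_valid ω hP hA hp (NeZero.pos L.r))).choose
  prog := L.hashE.code 1
  h := dsFun col (tabClass L.q L.l L.m L.N) (mulClass L.pF L.l L.N (NeZero.pos L.l))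
    (tabClass L.q L.l L.r L.N)
  run_eq ω x := by
    rw [Expr.run_code,
      (exists_memory _ hL (seedData_valid ω hP hA hp (NeZero.pos L.r))).choose_spec x x.2,
      hash_seedData ω hcol]
    rfl

end Layout

end UniformHashing

namespace UniformHashing

/-! ### Choice of the parameters -/

/-- The layout for given parameters, with fields as narrow as possible and words of
`8 ⌈log₂ u⌉` bits. -/
def mkLayout (u k c q l m r N p pF : ℕ) : Layout where
  w := 8 * Nat.clog 2 u
  wp := Nat.size p
  W := Nat.clog 2 (pF + m + r)
  bt := Nat.clog 2 (r ^ k)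
  k := k
  c := c
  q := q
  l := l
  m := m
  r := r
  N := N
  p := p
  pF := pF

/-- The inequalities between the parameters. -/
structure Admissible (n u k c q l m r N p pF : ℕ) : Prop where
  u_large : 16 ≤ u
  n_le : n ≤ u
  small : 4 * c + 3 * q + 5 ≤ n
  two_le_r : 2 ≤ r
  r_le : r ≤ u
  N_pos : 0 < N
  N_le : N ≤ u
  N_le_p : N ≤ p
  p_le : p ≤ 128 * u ^ 4
  pF_le : pF ≤ 2 * N
  l_pos : 0 < l
  l_le : l ≤ n
  l_pow : ∀ d < q, l ^ d < N
  m_pos : 0 < m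
  m_le : m ≤ 2 * n
  k_pos : 0 < k
  k_le : k ≤ n
  r_pow : r ^ k ≤ u

lemma two_pow_clog_le {x : ℕ} (hx : 0 < x) : 2 ^ Nat.clog 2 x ≤ 2 * x := by
  rcases Nat.eq_or_lt_of_le (show 1 ≤ x from hx) with rfl | h
  · simp
  · have h1 := Nat.pow_pred_clog_lt_self one_lt_two h
    have h2 := Nat.clog_pos one_lt_two h
    obtain ⟨j, hj⟩ : ∃ j, Nat.clog 2 x = j + 1 := ⟨Nat.clog 2 x - 1, by omega⟩
    rw [hj] at h1 ⊢
    rw [Nat.pred_succ] at h1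
    rw [pow_succ]
    omega

lemma two_pow_size_le {x : ℕ} (hx : 0 < x) : 2 ^ Nat.size x ≤ 2 * x := by
  have h1 := Nat.size_pos.2 hx
  obtain ⟨j, hj⟩ : ∃ j, Nat.size x = j + 1 := ⟨Nat.size x - 1, by omega⟩
  have h2 : 2 ^ j ≤ x := Nat.lt_size.1 (by omega)
  rw [hj, pow_succ]
  omega

variable {n u k c q l m r N p pF : ℕ}

namespace Admissible

lemma pow_le_two_pow_w : u ^ 8 ≤ 2 ^ (mkLayout u k c q l m r N p pF).w := by
  show u ^ 8 ≤ 2 ^ (8 * Nat.clog 2 u)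
  rw [mul_comm, pow_mul]
  exact Nat.pow_le_pow_left (Nat.le_pow_clog one_lt_two u) 8

lemma wp_lt (h : Admissible n u k c q l m r N p pF) :
    (mkLayout u k c q l m r N p pF).wp < (mkLayout u k c q l m r N p pF).w := by
  have hp : 0 < p := h.N_pos.trans_le h.N_le_p
  have h1 : 2 ^ Nat.size p ≤ 2 * p := two_pow_size_le hp
  have h2 := pow_le_two_pow_w (u := u) (k := k) (c := c) (q := q) (l := l) (m := m) (r := r)
    (N := N) (p := p) (pF := pF)
  have h3 : 256 * u ^ 4 < u ^ 8 := by
    have : 16 ^ 4 ≤ u ^ 4 := Nat.pow_le_pow_left h.u_large 4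
    calc 256 * u ^ 4 < 16 ^ 4 * u ^ 4 := by nlinarith
      _ ≤ u ^ 4 * u ^ 4 := Nat.mul_le_mul_right _ this
      _ = u ^ 8 := by ring
  have := h.p_le
  exact (Nat.pow_lt_pow_iff_right one_lt_two).1
    (show 2 ^ Nat.size p < 2 ^ (mkLayout u k c q l m r N p pF).w by omega)

lemma W_lt (h : Admissible n u k c q l m r N p pF) :
    (mkLayout u k c q l m r N p pF).W < (mkLayout u k c q l m r N p pF).w := by
  have h0 := h.two_le_r
  have h1 : 2 ^ Nat.clog 2 (pF + m + r) ≤ 2 * (pF + m + r) := two_pow_clog_le (by omega)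
  have h2 := pow_le_two_pow_w (u := u) (k := k) (c := c) (q := q) (l := l) (m := m) (r := r)
    (N := N) (p := p) (pF := pF)
  have h3 : 10 * u < u ^ 8 := by
    have hu := h.u_large
    calc 10 * u < 16 * u := by omega
      _ ≤ u * u := Nat.mul_le_mul_right _ hu
      _ = u ^ 2 := by ring
      _ ≤ u ^ 8 := Nat.pow_le_pow_right (by omega) (by norm_num)
  have := h.pF_le
  have := h.m_le
  have := h.r_le
  have := h.N_le
  have := h.n_le
  exact (Nat.pow_lt_pow_iff_right one_lt_two).1
    (show 2 ^ Nat.clog 2 (pF + m + r) < 2 ^ (mkLayout u k c q l m r N p pF).w by omega)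

lemma bt_lt (h : Admissible n u k c q l m r N p pF) :
    (mkLayout u k c q l m r N p pF).bt < (mkLayout u k c q l m r N p pF).w := by
  have h1 : Nat.clog 2 (r ^ k) ≤ Nat.clog 2 u := Nat.clog_mono_right 2 h.r_pow
  have h2 : 0 < Nat.clog 2 u := Nat.clog_pos one_lt_two (by have := h.u_large; omega)
  show Nat.clog 2 (r ^ k) < 8 * Nat.clog 2 u
  omega

/-- A crude bound, needed only to keep addresses within a word and the constants short; the sharp
count is made in `space_le`. -/
lemma bits_le (h : Admissible n u k c q l m r N p pF) :
    (mkLayout u k c q l m r N p pF).bits ≤ 9 * n ^ 2 * (8 * Nat.clog 2 u) := by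
  have h1 := h.wp_lt
  have h2 := h.W_lt
  have h3 := h.bt_lt
  have hdiv : 2 * m / k ≤ 2 * m := Nat.div_le_self _ _
  set L := mkLayout u k c q l m r N p pF
  have hb : L.bits = 2 * L.wp + (4 * c + 3 * q) * l * L.W + (k + (2 * m / k + 1)) * L.bt := rfl
  have hw : L.w = 8 * Nat.clog 2 u := rfl
  rw [hb, ← hw]
  have hs := h.small
  have hm := h.m_le
  have hk := h.k_le
  have e1 : (4 * c + 3 * q) * l * L.W ≤ n * n * L.w := by
    have := h.l_le
    gcongr
    omega
  have e2 : (k + (2 * m / k + 1)) * L.bt ≤ (5 * n + 1) * L.w :=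
    Nat.mul_le_mul (by omega) h3.le
  have e3 : 2 * L.wp ≤ 2 * L.w := by gcongr
  have e4 : 3 ≤ n := by omega
  have e5 : 2 + n * n + (5 * n + 1) ≤ 9 * n ^ 2 := by nlinarith
  calc _ ≤ 2 * L.w + n * n * L.w + (5 * n + 1) * L.w := by omega
    _ = (2 + n * n + (5 * n + 1)) * L.w := by ring
    _ ≤ _ := Nat.mul_le_mul_right _ e5

/-- Words have at least u^8 values and u ≥ 16 absorbs numerical factors. The most demanding product
is u p ≤ 128 u^5, which arises when the key is collapsed. -/
lemma fits (h : Admissible n u k c q l m r N p pF) :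
    (mkLayout u k c q l m r N p pF).Fits u := by
  have hw := pow_le_two_pow_w (u := u) (k := k) (c := c) (q := q) (l := l) (m := m) (r := r)
    (N := N) (p := p) (pF := pF)
  have hu := h.u_large
  have hn := h.n_le
  have hs := h.small
  have hu1 : 1 ≤ u := by omega
  have hpow : ∀ e ≤ 8, u ^ e ≤ u ^ 8 := fun e he => Nat.pow_le_pow_right hu1 he
  have hsq : ∀ a b, a ≤ 2 * u → b ≤ 2 * u → a * b < u ^ 8 := by
    intro a b ha hb
    calc a * b ≤ (2 * u) * (2 * u) := Nat.mul_le_mul ha hb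
      _ = 4 * u ^ 2 := by ring
      _ < 16 * u ^ 2 := by nlinarith [Nat.pow_pos (n := 2) (show 0 < u by omega)]
      _ ≤ u * u ^ 2 := Nat.mul_le_mul_right _ hu
      _ = u ^ 3 := by ring
      _ ≤ u ^ 8 := hpow 3 (by norm_num)
  have hu8 : u * 1 < u ^ 8 := hsq u 1 (by omega) (by omega)
  refine
    { wp_lt := h.wp_lt, W_lt := h.W_lt, bt_lt := h.bt_lt, bits_lt := ?_, u_mul_p := ?_,
      u_pos := hu1, N_pos := h.N_pos, N_le_u := h.N_le, N_le_p := h.N_le_p, N_mul_pF := ?_,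
      l_pos := h.l_pos, l_lt := ?_, l_pow_lt := ?_, m_pos := h.m_pos, m_lt := ?_, r_lt := ?_,
      two_le_r := h.two_le_r, k_pos := h.k_pos, k_lt := ?_,
      r_pow_le := Nat.le_pow_clog one_lt_two _,
      m_le_W := ?_, r_le_W := ?_, pF_le_W := ?_ }
  · have h1 := h.bits_le
    have h2 : 9 * n ^ 2 * (8 * Nat.clog 2 u) + 1 < u ^ 8 := by
      have hc := clog_two_le_self u
      calc 9 * n ^ 2 * (8 * Nat.clog 2 u) + 1 ≤ 9 * u ^ 2 * (8 * u) + 1 := by gcongr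
        _ = 72 * u ^ 3 + 1 := by ring
        _ < 256 * u ^ 3 := by nlinarith [Nat.pow_pos (n := 3) (show 0 < u by omega)]
        _ = 16 * 16 * u ^ 3 := by ring
        _ ≤ u * u * u ^ 3 := by gcongr
        _ = u ^ 5 := by ring
        _ ≤ u ^ 8 := hpow 5 (by norm_num)
    omega
  · refine lt_of_lt_of_le ?_ hw
    show u * p < u ^ 8
    calc u * p ≤ u * (128 * u ^ 4) := Nat.mul_le_mul_left _ h.p_le
      _ = 128 * u ^ 5 := by ring
      _ < 16 * 16 * u ^ 5 := by nlinarith [Nat.pow_pos (n := 5) (show 0 < u by omega)]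
      _ ≤ u * u * u ^ 5 := by gcongr
      _ = u ^ 7 := by ring
      _ ≤ u ^ 8 := hpow 7 (by norm_num)
  · refine lt_of_lt_of_le (hsq N pF ?_ ?_) hw
    · have := h.N_le; omega
    · have := h.N_le; have := h.pF_le; omega
  · refine lt_of_lt_of_le ?_ hw
    show l < u ^ 8
    have := h.l_le
    omega
  · intro d hd
    refine lt_of_lt_of_le ?_ hw
    show l ^ d < u ^ 8
    have := h.l_pow d hd
    have := h.N_le
    omega
  · refine lt_of_lt_of_le (hsq (c + q + 2) m (by omega) ?_) hw
    have := h.m_le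
    omega
  · refine lt_of_lt_of_le (hsq (c + q + 2) r (by omega) ?_) hw
    have := h.r_le
    omega
  · refine lt_of_lt_of_le ?_ hw
    show k < u ^ 8
    have := h.k_le
    omega
  all_goals
    refine le_trans ?_ (Nat.le_pow_clog one_lt_two (pF + m + r))
    show _ ≤ pF + m + r
    simp only [mkLayout]
    omega

/-- All constants of the program are bounded by a power of `2 n r ⌈log₂ u⌉`. -/
lemma constsLt (h : Admissible n u k c q l m r N p pF) {σ k₀ : ℕ} (hNσ : N ≤ 2 * n ^ (σ + 3))
    (hpσ : p ≤ 128 * (n ^ (σ + 3) * Nat.clog 2 u) ^ 2) (hk : k ≤ k₀) :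
    (mkLayout u k c q l m r N p pF).hashE.ConstsLt
      (2 ^ ((2 * σ + k₀ + 20) * Nat.clog 2 (2 * n * r * Nat.clog 2 u))) := by
  have hu := h.u_large
  have hΛ1 : 1 ≤ Nat.clog 2 u := Nat.clog_pos one_lt_two (by omega)
  have hbits := h.bits_le
  have hwl : (mkLayout u k c q l m r N p pF).w = 8 * Nat.clog 2 u := rfl
  generalize Nat.clog 2 u = Λ at *
  -- With y above n, r and ⌈log u⌉, every constant is at most a fixed power of y. Constants thus
  -- take O(log n + log r + log log u) bits, without a term log u that the space bound could not
  -- afford for small r. The exponent covers 2^wp ≤ y^{2σ+13} and 2^bt ≤ y^{k₀+1}.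
  obtain ⟨y, hy⟩ : ∃ y, y = 2 * n * r * Λ := ⟨_, rfl⟩
  rw [← hy]
  have hs := h.small
  have hn : 1 ≤ n := by omega
  have hr := h.two_le_r
  have hB : y ^ (2 * σ + k₀ + 20) ≤ 2 ^ ((2 * σ + k₀ + 20) * Nat.clog 2 y) := by
    rw [pow_mul' 2]
    exact Nat.pow_le_pow_left (Nat.le_pow_clog one_lt_two y) _
  have hy4 : 4 ≤ y := by
    rw [hy]
    exact Nat.mul_le_mul (Nat.mul_le_mul (Nat.mul_le_mul (le_refl 2) hn) hr) hΛ1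
  have hny : n ≤ y := by
    calc n = 1 * n * 1 * 1 := by ring
      _ ≤ 2 * n * r * Λ := by gcongr <;> omega
      _ = y := hy.symm
  have hry : r ≤ y := by
    calc r = 1 * 1 * r * 1 := by ring
      _ ≤ 2 * n * r * Λ := by gcongr; norm_num
      _ = y := hy.symm
  have hΛy : Λ ≤ y := by
    calc Λ = 1 * 1 * 1 * Λ := by ring
      _ ≤ 2 * n * r * Λ := by gcongr <;> omega
      _ = y := hy.symm
  have mono : ∀ {a e : ℕ}, a ≤ y ^ e → e < 2 * σ + k₀ + 20 →
      a < 2 ^ ((2 * σ + k₀ + 20) * Nat.clog 2 y) := fun {a e} ha he =>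
    (ha.trans_lt (Nat.pow_lt_pow_right (by omega) he)).trans_le hB
  have hnσ : n ^ (σ + 3) ≤ y ^ (σ + 3) := Nat.pow_le_pow_left hny _
  have hNy : N ≤ y ^ (σ + 4) := by
    calc N ≤ 2 * n ^ (σ + 3) := hNσ
      _ ≤ y * y ^ (σ + 3) := Nat.mul_le_mul (by omega) hnσ
      _ = y ^ (σ + 4) := by ring
  have hpFy : pF ≤ y ^ (σ + 5) := by
    calc pF ≤ 2 * N := h.pF_le
      _ ≤ y * y ^ (σ + 4) := Nat.mul_le_mul (by omega) hNy
      _ = y ^ (σ + 5) := by ring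
  have hpy : p ≤ y ^ (2 * σ + 12) := by
    calc p ≤ 128 * (n ^ (σ + 3) * Λ) ^ 2 := hpσ
      _ ≤ 4 ^ 4 * (y ^ (σ + 3) * y) ^ 2 := by gcongr; norm_num
      _ ≤ y ^ 4 * (y ^ (σ + 3) * y) ^ 2 := by gcongr
      _ = y ^ (2 * σ + 12) := by ring
  have hm2 : m ≤ y ^ 2 := by
    calc m ≤ 2 * n := h.m_le
      _ ≤ y * y := Nat.mul_le_mul (by omega) hny
      _ = y ^ 2 := by ring
  have hy1 : 1 ≤ y := by omega
  have up : ∀ {e e' : ℕ}, e ≤ e' → y ^ e ≤ y ^ e' := fun he => Nat.pow_le_pow_right hy1 he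
  have hp0 : 0 < p := h.N_pos.trans_le h.N_le_p
  refine Layout.constsLt_hashE _ ?_ ?_ ?_ ?_ ?_ ?_ ?_ ?_ ?_ ?_ ?_ ?_ ?_ ?_
  · exact mono (e := 1) (by rw [pow_one]; exact hy1) (by omega)
  · refine mono (e := 3) ?_ (by omega)
    rw [hwl]
    calc 8 * Λ ≤ 4 * 4 * y := by omega
      _ ≤ y * y * y := by gcongr
      _ = y ^ 3 := by ring
  · refine mono (e := 2 * σ + 13) ?_ (by omega)
    calc 2 ^ Nat.size p ≤ 2 * p := two_pow_size_le hp0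
      _ ≤ y * y ^ (2 * σ + 12) := Nat.mul_le_mul (by omega) hpy
      _ = y ^ (2 * σ + 13) := by ring
  · refine mono (e := σ + 7) ?_ (by omega)
    have e1 : m ≤ y ^ (σ + 5) := hm2.trans (up (by omega))
    have e2 : r ≤ y ^ (σ + 5) := (hry.trans_eq (pow_one y).symm).trans (up (by omega))
    calc 2 ^ Nat.clog 2 (pF + m + r) ≤ 2 * (pF + m + r) := two_pow_clog_le (by omega)
      _ ≤ 4 * 4 * y ^ (σ + 5) := by omega
      _ ≤ y * y * y ^ (σ + 5) := by gcongr
      _ = y ^ (σ + 7) := by ring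
  · refine mono (e := k₀ + 1) ?_ (by omega)
    calc 2 ^ Nat.clog 2 (r ^ k) ≤ 2 * r ^ k := two_pow_clog_le (by positivity)
      _ ≤ y * y ^ k₀ := Nat.mul_le_mul (by omega)
        ((Nat.pow_le_pow_left hry k).trans (up hk))
      _ = y ^ (k₀ + 1) := by ring
  · exact mono (e := 1) (by rw [pow_one]; exact h.k_le.trans hny) (by omega)
  · exact mono (e := 1) (by rw [pow_one]; exact h.l_le.trans hny) (by omega)
  · exact fun d hd => mono ((h.l_pow d hd).le.trans hNy) (by omega)
  · exact mono hm2 (by omega)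
  · exact mono (e := 1) (by rw [pow_one]; exact hry) (by omega)
  · exact mono hNy (by omega)
  · exact mono hpy (by omega)
  · exact mono hpFy (by omega)
  · refine mono (e := 7) (hbits.trans ?_) (by omega)
    calc 9 * n ^ 2 * (8 * Λ) = 72 * (n ^ 2 * Λ) := by ring
      _ ≤ 4 ^ 4 * (y ^ 2 * y) := by gcongr; norm_num
      _ ≤ y ^ 4 * (y ^ 2 * y) := by gcongr
      _ = y ^ 7 := by ring

end Admissible

end UniformHashing

namespace UniformHashing

/-! ### The space bound -/

lemma le_logb_of_two_pow_le {a b : ℕ} (h : 2 ^ a ≤ b) : (a : ℝ) ≤ Real.logb 2 b := by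
  have hb : 0 < b := (Nat.pow_pos two_pos).trans_le h
  rw [Real.le_logb_iff_rpow_le one_lt_two (by exact_mod_cast hb), Real.rpow_natCast]
  exact_mod_cast h

lemma logb_two_mul {a b : ℕ} (ha : 0 < a) (hb : 0 < b) :
    Real.logb 2 ((a * b : ℕ) : ℝ) = Real.logb 2 a + Real.logb 2 b := by
  rw [Nat.cast_mul, Real.logb_mul (by positivity) (by positivity)]

lemma logb_two_two : Real.logb 2 ((2 : ℕ) : ℝ) = 1 := by
  rw [Nat.cast_ofNat]
  exact Real.logb_self_eq_one one_lt_two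

lemma clog_le_logb_add_one {x : ℕ} (hx : 0 < x) : (Nat.clog 2 x : ℝ) ≤ Real.logb 2 x + 1 := by
  have := le_logb_of_two_pow_le (two_pow_clog_le hx)
  rw [logb_two_mul two_pos hx, logb_two_two] at this
  linarith

lemma logb_mono {a b : ℕ} (ha : 0 < a) (h : a ≤ b) : Real.logb 2 a ≤ Real.logb 2 b :=
  Real.logb_le_logb_of_le one_lt_two (by exact_mod_cast ha) (by exact_mod_cast h)

lemma one_le_logb {a : ℕ} (h : 2 ≤ a) : 1 ≤ Real.logb 2 a :=
  logb_two_two.symm.trans_le (logb_mono two_pos h)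

lemma logb_clog_le {u : ℕ} (hu : 2 ≤ u) :
    Real.logb 2 (Nat.clog 2 u) ≤ 1 + Real.logb 2 (Real.logb 2 u) := by
  have h1 := one_le_logb hu
  have h2 := clog_le_logb_add_one (x := u) (by omega)
  have h3 : 0 < Nat.clog 2 u := Nat.clog_pos one_lt_two hu
  have h4 : Real.logb 2 (2 * Real.logb 2 u) = 1 + Real.logb 2 (Real.logb 2 u) := by
    rw [Real.logb_mul two_ne_zero (by linarith), Real.logb_self_eq_one one_lt_two]
  rw [← h4]
  exact Real.logb_le_logb_of_le one_lt_two (by exact_mod_cast h3) (by linarith)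

/-- The computation behind the space bound. -/
lemma space_arith {wp W bt cb dv y Z ρ G c q Q l m k k₀ σ ε : ℝ} (hρ : 1 ≤ ρ) (hG : 1 ≤ G)
    (hZ : 0 ≤ Z) (hl1 : 1 ≤ l) (hk1 : 1 ≤ k) (hkk : k ≤ k₀) (hqQ : q ≤ Q) (hσ : 0 ≤ σ)
    (hc0 : 0 ≤ c) (hq0 : 0 ≤ q) (hm0 : 0 ≤ m) (hW0 : 0 ≤ W) (hbt0 : 0 ≤ bt) (hy0 : 0 ≤ y)
    (hε : 10 ≤ ε * (k * ρ)) (hy : y ≤ 3 + G + ρ + Z) (hwp : wp ≤ 10 + 2 * ((σ + 3) * G) + 2 * Z)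
    (hW : W ≤ 3 + (σ + 3) * G + ρ) (hbt : bt ≤ k * ρ + 1) (hdiv : dv ≤ 2 * m / k)
    (hconst : cb ≤ 20000 * (c + q + 1) * ((2 * σ + k₀ + 20) * y)) :
    2 * wp + (4 * c + 3 * q) * l * W + (k + (dv + 1)) * bt + cb
      ≤ 2 * m * (1 + ε / 10) * ρ
        + ((20000 * (c + Q + 1) + 2) * (2 * σ + k₀ + 20) * 5 + (4 * c + 3 * Q) * (σ + 7)
          + (k₀ + 1) ^ 2) * l * G * ρ
        + (20000 * (c + Q + 1) + 2) * (2 * σ + k₀ + 20) * Z := by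
  -- G, ρ, Z stand for log n, log r, log log u. As G, ρ ≥ 1, terms linear in G and ρ are absorbed
  -- into multiples of G ρ.
  have hGρ : G + ρ ≤ G * ρ + 1 := by nlinarith
  have hGρ1 : 1 ≤ G * ρ := by nlinarith
  have hGρ2 : G ≤ G * ρ := by nlinarith
  have hρG : ρ ≤ G * ρ := by nlinarith
  have hk₀ : 0 ≤ k₀ := by linarith
  have hQ0 : 0 ≤ Q := by linarith
  have hk0 : 0 < k := by linarith
  have hE0 : 20 ≤ 2 * σ + k₀ + 20 := by linarith
  have b1 : y ≤ 5 * (G * ρ) + Z := by linarith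
  have hσG : (σ + 3) * G ≤ (σ + 3) * (G * ρ) := by gcongr
  have b2 : wp ≤ (2 * σ + k₀ + 20) * (5 * (G * ρ) + Z) := by
    have e1 : 0 ≤ σ * (G * ρ) := by positivity
    have e2 : 0 ≤ k₀ * (G * ρ) := by positivity
    have e3 : 0 ≤ σ * Z := by positivity
    have e4 : 0 ≤ k₀ * Z := by positivity
    linarith
  have b3 : W ≤ (σ + 7) * (G * ρ) := by linarith
  have b4 : cb ≤ 20000 * (c + Q + 1) * ((2 * σ + k₀ + 20) * (5 * (G * ρ) + Z)) :=
    hconst.trans (by gcongr)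
  have b5 : (4 * c + 3 * q) * l * W ≤ (4 * c + 3 * Q) * l * ((σ + 7) * (G * ρ)) := by gcongr
  -- The main term: 2m/k blocks of k ρ + 1 bits take 2mρ + 2m/k bits, and the choice of k makes 1/k
  -- at most ερ/10. The stored powers and the extra block are of lower order.
  have b6 : (k + (dv + 1)) * bt ≤ (k₀ + 1) ^ 2 * (G * ρ) + 2 * m * (1 + ε / 10) * ρ := by
    have e1 : (k + (dv + 1)) * bt ≤ (k + (2 * m / k + 1)) * (k * ρ + 1) := by
      have : 0 ≤ (2 : ℝ) * m / k := by positivity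
      gcongr
    have e2 : (k + (2 * m / k + 1)) * (k * ρ + 1)
        = (k + 1) * (k * ρ + 1) + (2 * m * ρ + 2 * m * (1 / k)) := by
      field_simp
      ring
    have e3 : 1 / (k : ℝ) ≤ ε * ρ / 10 := by
      rw [div_le_iff₀ (by linarith)]
      linarith
    have e4 : (k + 1 : ℝ) * (k * ρ + 1) ≤ (k₀ + 1) * ((k₀ + 1) * (G * ρ)) := by
      have : k * ρ ≤ k₀ * (G * ρ) := by gcongr
      have : k * ρ + 1 ≤ (k₀ + 1) * (G * ρ) := by linarith
      gcongr
    have e5 : 2 * m * (1 / (k : ℝ)) ≤ 2 * m * (ε * ρ / 10) := by gcongr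
    linarith
  have hT : (0 : ℝ) ≤ 20000 * (c + Q + 1) := by positivity
  have b7 : (20000 * (c + Q + 1) + 2) * (2 * σ + k₀ + 20) * 5 * (G * ρ)
      ≤ (20000 * (c + Q + 1) + 2) * (2 * σ + k₀ + 20) * 5 * (G * ρ) * l :=
    le_mul_of_one_le_right (by positivity) hl1
  have b8 : ((k₀ : ℝ) + 1) ^ 2 * (G * ρ) ≤ (k₀ + 1) ^ 2 * (G * ρ) * l :=
    le_mul_of_one_le_right (by positivity) hl1
  linarith

variable {n u k c q l m r N p pF : ℕ}

/-- The first term pays for the packed t₁, t₂, the second mainly for the tables of l entries. The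
third is the share of log log u in the collapsing parameters and in the constants, caused by p being
quadratic in ⌈log u⌉. -/
lemma Admissible.space_le (h : Admissible n u k c q l m r N p pF) {σ k₀ Q : ℕ} {ε : ℝ}
    (hNσ : N ≤ 2 * n ^ (σ + 3)) (hpσ : p ≤ 128 * (n ^ (σ + 3) * Nat.clog 2 u) ^ 2)
    (hk : k ≤ k₀) (hq : q ≤ Q) (hε : 10 ≤ ε * (k * Real.logb 2 r)) :
    (((mkLayout u k c q l m r N p pF).bits
        + (((mkLayout u k c q l m r N p pF).hashE.code 1).map Instr.constBits).sum : ℕ) : ℝ)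
      ≤ 2 * m * (1 + ε / 10) * Real.logb 2 r
        + ((20000 * (c + Q + 1) + 2) * (2 * σ + k₀ + 20) * 5 + (4 * c + 3 * Q) * (σ + 7)
          + (k₀ + 1) ^ 2) * l * Real.logb 2 n * Real.logb 2 r
        + (20000 * (c + Q + 1) + 2) * (2 * σ + k₀ + 20) * Real.logb 2 (Real.logb 2 u) := by
  have hr2 := h.two_le_r
  have hn2 : 2 ≤ n := by have := h.small; omega
  have hu2 : 2 ≤ u := by have := h.u_large; omega
  have hl1 : (1 : ℝ) ≤ l := by exact_mod_cast h.l_pos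
  have hp0 : 0 < p := h.N_pos.trans_le h.N_le_p
  have hΛ : 0 < Nat.clog 2 u := Nat.clog_pos one_lt_two hu2
  have hk1 : (1 : ℝ) ≤ k := by exact_mod_cast h.k_pos
  have hkk : (k : ℝ) ≤ k₀ := by exact_mod_cast hk
  have hqQ : (q : ℝ) ≤ Q := by exact_mod_cast hq
  have hρ := one_le_logb hr2
  have hG := one_le_logb hn2
  have hcu := logb_clog_le hu2
  have hZ : 0 ≤ Real.logb 2 (Real.logb 2 u) :=
    Real.logb_nonneg one_lt_two (one_le_logb hu2)
  have hpow : 0 < n ^ (σ + 3) := Nat.pow_pos (by omega)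
  have hlpow : Real.logb 2 ((n ^ (σ + 3) : ℕ) : ℝ) = (σ + 3) * Real.logb 2 n := by
    rw [Nat.cast_pow, Real.logb_pow]
    push_cast
    ring
  have hy : (Nat.clog 2 (2 * n * r * Nat.clog 2 u) : ℝ)
      ≤ 3 + Real.logb 2 n + Real.logb 2 r + Real.logb 2 (Real.logb 2 u) := by
    have h1 := clog_le_logb_add_one (x := 2 * n * r * Nat.clog 2 u) (by positivity)
    rw [logb_two_mul (by positivity) hΛ, logb_two_mul (by positivity) (by omega),
      logb_two_mul two_pos (by omega), logb_two_two] at h1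
    linarith
  have hwp : ((mkLayout u k c q l m r N p pF).wp : ℝ)
      ≤ 10 + 2 * ((σ + 3) * Real.logb 2 n) + 2 * Real.logb 2 (Real.logb 2 u) := by
    have h1 : ((Nat.size p : ℕ) : ℝ) ≤ _ := le_logb_of_two_pow_le (two_pow_size_le hp0)
    have h2 : 2 * p ≤ 2 ^ 8 * ((n ^ (σ + 3) * Nat.clog 2 u) * (n ^ (σ + 3) * Nat.clog 2 u)) := by
      rw [← pow_two]
      omega
    have h3 := h1.trans (logb_mono (by omega) h2)
    have h4 : Real.logb 2 ((2 ^ 8 : ℕ) : ℝ) = 8 := by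
      rw [Nat.cast_pow, Real.logb_pow, logb_two_two]
      norm_num
    rw [logb_two_mul (by positivity) (by positivity), logb_two_mul (by positivity) (by positivity),
      logb_two_mul hpow hΛ, h4, hlpow] at h3
    have h5 : ((mkLayout u k c q l m r N p pF).wp : ℝ) = (Nat.size p : ℕ) := rfl
    linarith
  have hW : ((mkLayout u k c q l m r N p pF).W : ℝ)
      ≤ 3 + (σ + 3) * Real.logb 2 n + Real.logb 2 r := by
    have h1 := clog_le_logb_add_one (x := pF + m + r) (by omega)
    have h2 : pF + m + r ≤ 2 * 2 * n ^ (σ + 3) * r := by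
      have e1 := h.pF_le
      have e2 := h.m_le
      have e3 : n ≤ n ^ (σ + 3) := Nat.le_self_pow (by omega) n
      have e4 : n ^ (σ + 3) * 2 ≤ n ^ (σ + 3) * r := Nat.mul_le_mul_left _ hr2
      have e5 : 1 * r ≤ n ^ (σ + 3) * r := Nat.mul_le_mul_right _ hpow
      nlinarith
    have h3 := logb_mono (by omega) h2
    rw [logb_two_mul (by positivity) (by omega), logb_two_mul (by norm_num) hpow,
      logb_two_mul two_pos two_pos, logb_two_two, hlpow] at h3
    have h5 : ((mkLayout u k c q l m r N p pF).W : ℝ) = (Nat.clog 2 (pF + m + r) : ℕ) := rfl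
    linarith
  have hbt : ((mkLayout u k c q l m r N p pF).bt : ℝ) ≤ k * Real.logb 2 r + 1 := by
    have h1 := clog_le_logb_add_one (x := r ^ k) (by positivity)
    rw [Nat.cast_pow, Real.logb_pow] at h1
    exact h1
  have hconst := (Expr.constBits_code_le _ (h.constsLt hNσ hpσ hk) 1).trans
    (Nat.mul_le_mul_right _ (Layout.size_hashE _))
  have hdiv : ((2 * m / k : ℕ) : ℝ) ≤ 2 * m / k := by
    refine Nat.cast_div_le.trans_eq ?_
    push_cast
    rfl
  have hbits : (((mkLayout u k c q l m r N p pF).bits : ℕ) : ℝ)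
      = 2 * ((mkLayout u k c q l m r N p pF).wp : ℝ)
        + (4 * c + 3 * q) * l * ((mkLayout u k c q l m r N p pF).W : ℝ)
        + (k + ((2 * m / k : ℕ) + 1)) * ((mkLayout u k c q l m r N p pF).bt : ℝ) := by
    have : (mkLayout u k c q l m r N p pF).bits = 2 * (mkLayout u k c q l m r N p pF).wp
        + (4 * c + 3 * q) * l * (mkLayout u k c q l m r N p pF).W
        + (k + (2 * m / k + 1)) * (mkLayout u k c q l m r N p pF).bt := rfl
    rw [this]
    push_cast
    rfl
  have hconst' : (((((mkLayout u k c q l m r N p pF).hashE.code 1).map Instr.constBits).sum : ℕ) : ℝ)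
      ≤ 20000 * (c + q + 1)
        * ((2 * σ + k₀ + 20) * (Nat.clog 2 (2 * n * r * Nat.clog 2 u) : ℕ)) := by
    exact_mod_cast hconst
  rw [Nat.cast_add, hbits]
  exact space_arith hρ hG hZ hl1 hk1 hkk hqQ (Nat.cast_nonneg _) (Nat.cast_nonneg _)
    (Nat.cast_nonneg _) (Nat.cast_nonneg _) (Nat.cast_nonneg _) (Nat.cast_nonneg _)
    (Nat.cast_nonneg _) hε hy hwp hW hbt hdiv hconst'

end UniformHashing

namespace UniformHashing

/-! ### The main result -/

lemma natCeil_rpow_le {δ : ℝ} (hδ : 0 < δ) {n : ℕ} (hn : 1 ≤ n) :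
    (⌈(n : ℝ) ^ δ⌉₊ : ℝ) ≤ 2 * (n : ℝ) ^ δ := by
  have h1 : (1 : ℝ) ≤ (n : ℝ) ^ δ := Real.one_le_rpow (by exact_mod_cast hn) hδ.le
  have h2 := Nat.ceil_lt_add_one (zero_le_one.trans h1)
  linarith

/-- Since log n = o(n^{1-δ}), the lower-order tables fit into any fixed fraction of n; this is why g
can be taken to be 0. -/
lemma eventually_mul_natCeil_rpow_mul_logb_le {δ a b : ℝ} (hδ : 0 < δ) (hδ1 : δ < 1) (ha : 0 ≤ a)
    (hb : 0 < b) :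
    ∀ᶠ n : ℕ in Filter.atTop, a * ⌈(n : ℝ) ^ δ⌉₊ * Real.logb 2 n ≤ b * n := by
  have hlog2 : 0 < Real.log 2 := Real.log_pos one_lt_two
  have h1 := (isLittleO_log_rpow_atTop (r := 1 - δ) (by linarith)).bound
    (show 0 < b * Real.log 2 / (2 * (a + 1)) by positivity)
  filter_upwards [tendsto_natCast_atTop_atTop.eventually h1, Filter.eventually_ge_atTop 1]
    with n hn hn1
  have hn1' : (1 : ℝ) ≤ n := by exact_mod_cast hn1
  have hn0 : (0 : ℝ) < n := by linarith
  have hl := Real.log_nonneg hn1'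
  rw [Real.norm_of_nonneg hl, Real.norm_of_nonneg (by positivity)] at hn
  have hprod : (n : ℝ) ^ δ * (n : ℝ) ^ (1 - δ) = n := by
    rw [← Real.rpow_add hn0, add_sub_cancel, Real.rpow_one]
  calc a * ⌈(n : ℝ) ^ δ⌉₊ * Real.logb 2 n
      ≤ (a + 1) * (2 * (n : ℝ) ^ δ) * (b * Real.log 2 / (2 * (a + 1)) * (n : ℝ) ^ (1 - δ)
          / Real.log 2) := by
        rw [Real.logb]
        gcongr
        · linarith
        · exact natCeil_rpow_le hδ hn1
    _ = b * ((n : ℝ) ^ δ * (n : ℝ) ^ (1 - δ)) := by field_simp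
    _ = b * n := by rw [hprod]

/-- The data structure representing the constant function `0`. -/
def constDS (u r w : ℕ) (hr : 0 < r) : HashDS u r w where
  Ω := Unit
  memBits := 0
  mem _ := Fin.elim0
  prog := [Instr.const 0]
  h _ _ := ⟨0, hr⟩
  run_eq _ _ := by simp [run, runRegs, Instr.eval]

/-- Both sides vanish when the bad event is everything; this settles the cases in which the error
bound is at least 1. -/
lemma uniformOnOutside_univ {Ω : Type} [Fintype Ω] [DecidableEq Ω] {u r : ℕ}
    (h : Ω → Fin u → Fin r) (S : Finset (Fin u)) : UniformOnOutside h S Finset.univ := by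
  intro v
  simp [prob]

/-- The number of table entries packed into one block. -/
lemma exists_block_size {ε : ℝ} (hε : 0 < ε) {u r k₀ : ℕ} (hk₀ : 10 / ε ≤ k₀) (hr : 2 ≤ r)
    (hru : r ≤ u) (hu : 2 ^ (k₀ * k₀) ≤ u) :
    ∃ k, 0 < k ∧ k ≤ k₀ ∧ r ^ k ≤ u ∧ 10 ≤ ε * (k * Real.logb 2 r) := by
  have hk₀0 : 0 < k₀ := by
    have : 0 < 10 / ε := by positivity
    exact_mod_cast this.trans_le hk₀
  rw [div_le_iff₀ hε] at hk₀
  -- An entry with at least k₀ ≥ 10/ε bits can bear a rounding loss of one bit alone. Otherwise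
  -- r^{k₀} < 2^{k₀²} ≤ u, and k₀ entries fit into one block.
  rcases le_or_gt (2 ^ k₀) r with h | h
  · refine ⟨1, one_pos, hk₀0, by simpa using hru, ?_⟩
    have := le_logb_of_two_pow_le h
    rw [Nat.cast_one, one_mul]
    nlinarith
  · refine ⟨k₀, hk₀0, le_rfl, ?_, ?_⟩
    · rw [pow_mul] at hu
      exact (Nat.pow_le_pow_left h.le k₀).trans hu
    · have := one_le_logb hr
      have h2 : (k₀ : ℝ) ≤ k₀ * Real.logb 2 r :=
        le_mul_of_one_le_right (Nat.cast_nonneg _) this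
      nlinarith

lemma prob_filter_id_eq {Ω : Type} [Fintype Ω] [DecidableEq Ω] (σ : Ω) :
    prob (Finset.univ.filter fun ω => id ω = σ) = 1 / (Fintype.card Ω : ℝ) := by
  rw [prob, show (Finset.univ.filter fun ω => id ω = σ) = {σ} by ext; simp]
  simp

/-- The error probability in terms of `n`. -/
lemma error_le {δ s A : ℝ} (hδ : 0 < δ) (hA : 0 ≤ A) {n c l m : ℕ} (hn : 1 ≤ n)
    (hc : (s + 3) / δ ≤ c) (hl : (n : ℝ) ^ δ ≤ l) (hm : m ≤ 2 * n) :
    (n : ℝ) ^ 2 * (3 / (n : ℝ) ^ (s + 3)) + (2 / (l : ℝ)) ^ c * (m : ℝ) ^ 2 * A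
      ≤ (3 + 2 ^ (c + 2) * A) / (n : ℝ) ^ (s + 1) := by
  have hn1 : (1 : ℝ) ≤ n := by exact_mod_cast hn
  have hn0 : (0 : ℝ) < n := by linarith
  have hm' : (m : ℝ) ≤ 2 * n := by exact_mod_cast hm
  have hsplit : (n : ℝ) ^ (s + 3) = (n : ℝ) ^ (s + 1) * (n : ℝ) ^ 2 := by
    rw [← Real.rpow_natCast (n : ℝ) 2, ← Real.rpow_add hn0]
    congr 1
    push_cast
    ring
  -- The power n^{s+3} gained from ℓ^c pays for the factor m² = O(n²) and leaves n^{s+1}.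
  have hlc : (n : ℝ) ^ (s + 3) ≤ (l : ℝ) ^ c := by
    calc (n : ℝ) ^ (s + 3) ≤ (n : ℝ) ^ (δ * c) := by
          refine Real.rpow_le_rpow_of_exponent_le hn1 ?_
          rwa [div_le_iff₀' hδ] at hc
      _ = ((n : ℝ) ^ δ) ^ c := by rw [Real.rpow_mul hn0.le, Real.rpow_natCast]
      _ ≤ (l : ℝ) ^ c := by gcongr
  have e1 : (2 / (l : ℝ)) ^ c ≤ 2 ^ c / ((n : ℝ) ^ (s + 1) * (n : ℝ) ^ 2) := by
    rw [div_pow, ← hsplit]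
    gcongr
  calc _ ≤ (n : ℝ) ^ 2 * (3 / ((n : ℝ) ^ (s + 1) * (n : ℝ) ^ 2))
        + 2 ^ c / ((n : ℝ) ^ (s + 1) * (n : ℝ) ^ 2) * (2 * n) ^ 2 * A := by
        rw [hsplit]
        gcongr
    _ = _ := by
        field_simp
        ring

/-- With M = max(s, 1) the two ceilings and the 1 add up to at most (2M + 7 + 3δ)/δ, and δ < 1 ≤ M
bounds this by 12M/δ; hence 240000 = 12 · 20000. -/
lemma time_le {δ s : ℝ} (hδ : 0 < δ) (hδ1 : δ < 1) :
    20000 * (((⌈(s + 3) / δ⌉₊ : ℕ) : ℝ) + (⌈(s + 4) / δ⌉₊ : ℕ) + 1)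
      ≤ 240000 * (max s 1 / δ) := by
  have hM1 : 1 ≤ max s 1 := le_max_right _ _
  have hMs : s ≤ max s 1 := le_max_left _ _
  have hbound : ∀ a : ℝ, 0 ≤ a → (⌈(s + a) / δ⌉₊ : ℝ) ≤ (max s 1 + a) / δ + 1 := by
    intro a ha
    have h1 : (⌈(s + a) / δ⌉₊ : ℝ) ≤ (⌈(max s 1 + a) / δ⌉₊ : ℝ) := by
      gcongr
    exact h1.trans (Nat.ceil_lt_add_one (by positivity)).le
  have h3 := hbound 3 (by norm_num)
  have h4 := hbound 4 (by norm_num)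
  have h1 : 1 ≤ max s 1 / δ := by
    rw [le_div_iff₀ hδ]
    linarith
  have h5 : (max s 1 + 3) / δ + (max s 1 + 4) / δ + 3 ≤ 12 * (max s 1 / δ) := by
    have : (max s 1 + 3) / δ + (max s 1 + 4) / δ + 3 = (2 * max s 1 + 7 + 3 * δ) / δ := by
      field_simp
      ring
    rw [this, ← mul_div_assoc]
    gcongr
    linarith
  linarith

/-- The data structure for admissible parameters. -/
lemma Admissible.exists_ds {n u k c q l m r N p pF kC : ℕ}
    (h : Admissible n u k c q l m r N p pF) (hc : 0 < c) (hkC : 0 < kC) (hpF : pF.Prime)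
    (hNpF : N ≤ pF) (hNq : N ≤ l ^ q) {col : Fin kC → Fin u → Fin N} {P M : Fin kC → ℕ}
    (hcol : ∀ i x, (col i x : ℕ) = x % P i * M i % p % N) (hP : ∀ i, P i ≤ p)
    (hM : ∀ i, M i ≤ p) :
    ∃ (kH kF kK : ℕ) (H : Fin kH → Fin N → Fin m) (F : Fin kF → Fin N → Fin l)
      (K : Fin kK → Fin N → Fin r) (ds : HashDS u r (8 * Nat.clog 2 u)),
      IsTwoIndependent H ∧ IsUniversal 2 F ∧ IsTwoIndependent K ∧
      ds.time ≤ 20000 * (c + q + 1) ∧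
      ds.space = (mkLayout u k c q l m r N p pF).bits
        + (((mkLayout u k c q l m r N p pF).hashE.code 1).map Instr.constBits).sum ∧
      (∃ π : ds.Ω → DSSeed kC kH kF kK c l m r,
        (∀ σ, prob (Finset.univ.filter fun ω => π ω = σ)
          = 1 / (Fintype.card (DSSeed kC kH kF kK c l m r) : ℝ)) ∧
        ∀ ω x, (ds.h ω x : ℕ) = dsHash col H F K (π ω) x) ∧
      ∀ {η ρ A : ℝ} {S : Finset (Fin u)}, 0 ≤ η →
        (∀ x y, x ≠ y → prob (Finset.univ.filter fun i => col i x = col i y) ≤ η) →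
        (S.card : ℝ) ≤ ρ * m →
        (∀ k, ∑ t ∈ Finset.range k, (t : ℝ) ^ (6 * c) * ρ ^ t ≤ A) →
        ∃ B : Finset ds.Ω, prob B ≤ (S.card : ℝ) ^ 2 * η + (2 / (l : ℝ)) ^ c * (m : ℝ) ^ 2 * A ∧
          UniformOnOutside ds.h S B := by
  have hr2 := h.two_le_r
  have : NeZero l := ⟨h.l_pos.ne'⟩
  have : NeZero m := ⟨h.m_pos.ne'⟩
  have : NeZero r := ⟨by omega⟩
  have : NeZero (mkLayout u k c q l m r N p pF).l := ‹NeZero l›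
  have : NeZero (mkLayout u k c q l m r N p pF).m := ‹NeZero m›
  have : NeZero (mkLayout u k c q l m r N p pF).r := ‹NeZero r›
  have hne : Nonempty ((mkLayout u k c q l m r N p pF).Seed kC) := by
    have : NeZero (pF - 1) := ⟨by have := hpF.two_le; omega⟩
    exact ⟨⟨0, hkC⟩, (fun _ => (tabEquiv q l m).symm fun _ _ => (0 : Fin m),
      fun _ => (0 : Fin (pF - 1)), fun _ _ _ => (0 : Fin m)), fun _ _ => (0 : Fin r),
      fun _ _ => (0 : Fin r), (tabEquiv q l r).symm fun _ _ => (0 : Fin r)⟩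
  have hF : IsUniversal 2 (mulClass pF l N (NeZero.pos l)) := isUniversal_mulClass hpF _ hNpF
  refine ⟨_, _, _, tabClass q l m N, mulClass pF l N (NeZero.pos l), tabClass q l r N,
    Layout.ds (L := mkLayout u k c q l m r N p pF) h.fits hne hP hM (Nat.lt_size_self p) col hcol,
    isTwoIndependent_tabClass hNq, hF, isTwoIndependent_tabClass hNq, ?_, rfl,
    ⟨id, prob_filter_id_eq, fun ω x => rfl⟩, ?_⟩
  · exact (Expr.length_code _ 1).trans_le (Layout.size_hashE _)
  · intro η ρ A S hη hcoll hS hA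
    exact exists_uniformOnOutside hc col (tabClass q l m N) (tabClass q l r N) hη hcoll hF hS hA

set_option maxHeartbeats 800000 in
/-- The data structure for sets that are not too small. -/
theorem exists_ds_of_large {δ ε s : ℝ} (hδ : 0 < δ) (hδ1 : δ < 1) (hε : 0 < ε) (hε1 : ε ≤ 1)
    (hs : 0 ≤ s) :
    ∃ (D : ℝ) (n₀ : ℕ), 0 ≤ D ∧ ∀ n u r : ℕ, n₀ ≤ n → n ≤ u → 1 < r → r ≤ u →
      ∃ ds : HashDS u r (8 * Nat.clog 2 u),
        (∀ S : Finset (Fin u), S.card = n →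
          ∃ B : Finset ds.Ω, prob B ≤ D / (n : ℝ) ^ (s + 1) ∧ UniformOnOutside ds.h S B) ∧
        (ds.time : ℝ) ≤ 240000 * (max s 1 / δ) ∧
        (ds.space : ℝ) ≤ 2 * (1 + ε) * n * Real.logb 2 r + D * Real.logb 2 (Real.logb 2 u) ∧
        BuiltFromZ ds n δ ε s D := by
  obtain ⟨c, hc⟩ : ∃ c, c = ⌈(s + 3) / δ⌉₊ := ⟨_, rfl⟩
  -- Q bounds the number of base-ℓ digits of a collapsed key, since N ≤ 2n^{s+3} ≤ n^{s+4} ≤ ℓ^Q for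
  -- n ≥ 2.
  obtain ⟨Q, hQ⟩ : ∃ Q, Q = ⌈(s + 4) / δ⌉₊ := ⟨_, rfl⟩
  obtain ⟨σ, hσ⟩ : ∃ σ, σ = ⌈s⌉₊ := ⟨_, rfl⟩
  obtain ⟨k₀, hk₀⟩ : ∃ k₀, k₀ = ⌈10 / ε⌉₊ := ⟨_, rfl⟩
  obtain ⟨b, hb⟩ : ∃ b, b = 2 ^ (k₀ * k₀) := ⟨_, rfl⟩
  -- The ratio 1/(1 + ε/4) bounds n/m below, so A depends on δ, ε, s only.
  obtain ⟨A, hA0, hA⟩ : ∃ A : ℝ, 0 ≤ A ∧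
      ∀ k, ∑ t ∈ Finset.range k, (t : ℝ) ^ (6 * c) * (1 / (1 + ε / 4)) ^ t ≤ A := by
    have hρ : (0 : ℝ) ≤ 1 / (1 + ε / 4) := by positivity
    have hρ1 : 1 / (1 + ε / 4) < 1 := by
      rw [div_lt_one (by positivity)]
      linarith
    have hsum := summable_pow_mul_geometric_of_norm_lt_one (6 * c)
      (r := 1 / (1 + ε / 4)) (by rwa [Real.norm_of_nonneg hρ])
    exact ⟨_, tsum_nonneg fun t => by positivity,
      fun k => hsum.sum_le_tsum _ fun t _ => by positivity⟩
  obtain ⟨a, ha⟩ : ∃ a : ℝ, a = (20000 * (c + Q + 1) + 2) * (2 * σ + k₀ + 20) * 5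
      + (4 * c + 3 * Q) * (σ + 7) + (k₀ + 1) ^ 2 := ⟨_, rfl⟩
  obtain ⟨T, hT⟩ : ∃ T : ℝ, T = (20000 * (c + Q + 1) + 2) * (2 * σ + k₀ + 20) := ⟨_, rfl⟩
  have ha0 : 0 ≤ a := by rw [ha]; positivity
  have hT0 : 0 ≤ T := by rw [hT]; positivity
  -- The packed tables use 2(1 + ε/2)(1 + ε/10) n ≤ (2 + 1.3 ε) n units of log r, since ε ≤ 1; of
  -- the allowed 2(1 + ε) n this leaves 0.7 ε n.
  obtain ⟨n₀, hn₀⟩ := Filter.eventually_atTop.1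
    (eventually_mul_natCeil_rpow_mul_logb_le hδ hδ1 ha0 (show 0 < 0.7 * ε by positivity))
  have hAc : 0 ≤ 2 ^ (c + 2) * A := by positivity
  refine ⟨3 + 2 ^ (c + 2) * A + T,
    max n₀ (16 + (4 * c + 3 * Q + 5) + ⌈4 / ε⌉₊ + b + k₀), by positivity,
    fun n u r hn hnu hr hru => ?_⟩
  have hlog := hn₀ n ((le_max_left _ _).trans hn)
  have hbig := (le_max_right _ _).trans hn
  have hn16 : 16 ≤ n := by omega
  have hn1 : (1 : ℝ) ≤ n := by exact_mod_cast (show 1 ≤ n by omega)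
  have hn0 : (0 : ℝ) < n := by linarith
  have hεn : 4 / ε ≤ n := (Nat.le_ceil _).trans (by exact_mod_cast (by omega : ⌈4 / ε⌉₊ ≤ n))
  obtain ⟨k, hk, hkk₀, hrk, hkε⟩ := exists_block_size hε (hk₀ ▸ Nat.le_ceil _) hr hru
    (show 2 ^ (k₀ * k₀) ≤ u by rw [← hb]; omega)
  have he : 1 ≤ (n : ℝ) ^ (s + 3) := Real.one_le_rpow hn1 (by linarith)
  obtain ⟨N, kC, p, col, P, M, hkC, hN, hNu, hNe, hcol, hP, hM, hNp, hpu, hpe, hcoll⟩ :=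
    exists_collapse he (show 2 ≤ u by omega)
  have heσ : (n : ℝ) ^ (s + 3) ≤ ((n ^ (σ + 3) : ℕ) : ℝ) := by
    rw [Nat.cast_pow, ← Real.rpow_natCast]
    refine Real.rpow_le_rpow_of_exponent_le hn1 ?_
    push_cast
    have := Nat.le_ceil s
    rw [← hσ] at this
    linarith
  have hNσ : N ≤ 2 * n ^ (σ + 3) := by
    have : (N : ℝ) ≤ ((2 * n ^ (σ + 3) : ℕ) : ℝ) := by
      rw [Nat.cast_mul, Nat.cast_ofNat]
      linarith
    exact_mod_cast this
  have hpσ : p ≤ 128 * (n ^ (σ + 3) * Nat.clog 2 u) ^ 2 := by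
    refine hpe.trans ?_
    have := Nat.ceil_le.2 heσ
    gcongr
  obtain ⟨l, hl⟩ : ∃ l, l = ⌈(n : ℝ) ^ δ⌉₊ := ⟨_, rfl⟩
  have hnl : (n : ℝ) ^ δ ≤ l := hl ▸ Nat.le_ceil _
  have hl2 : 2 ≤ l := by
    have h1 : (1 : ℝ) < (n : ℝ) ^ δ :=
      Real.one_lt_rpow (by exact_mod_cast (show 1 < n by omega)) hδ
    have : (1 : ℝ) < l := h1.trans_le hnl
    exact_mod_cast this
  have hln : l ≤ n := by
    rw [hl, Nat.ceil_le]
    calc (n : ℝ) ^ δ ≤ (n : ℝ) ^ (1 : ℝ) := Real.rpow_le_rpow_of_exponent_le hn1 hδ1.le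
      _ = n := Real.rpow_one _
  -- Half of ε is spent on enlarging the graph. Rounding down costs less than 1 ≤ εn/4, so m ≥ (1 +
  -- ε/4) n remains.
  obtain ⟨m, hm⟩ : ∃ m, m = ⌊(1 + ε / 2) * n⌋₊ := ⟨_, rfl⟩
  have hmle : (m : ℝ) ≤ (1 + ε / 2) * n := hm ▸ Nat.floor_le (by positivity)
  have hmge : (1 + ε / 4) * n ≤ m := by
    have h1 := Nat.lt_floor_add_one ((1 + ε / 2) * (n : ℝ))
    rw [← hm] at h1
    rw [div_le_iff₀ hε] at hεn
    linarith
  have hnm : n ≤ m := by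
    have : (n : ℝ) ≤ m := by nlinarith
    exact_mod_cast this
  have hm2 : m ≤ 2 * n := by
    have : (m : ℝ) ≤ 2 * n := by nlinarith
    exact_mod_cast this
  obtain ⟨q, hq⟩ : ∃ q, q = Nat.clog l N := ⟨_, rfl⟩
  have hNq : N ≤ l ^ q := hq ▸ Nat.le_pow_clog (by omega) N
  have hqQ : q ≤ Q := by
    rw [hq]
    refine Nat.clog_le_of_le_pow ?_
    have : (N : ℝ) ≤ (l : ℝ) ^ Q := by
      calc (N : ℝ) ≤ 2 * (n : ℝ) ^ (s + 3) := hNe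
        _ ≤ n * (n : ℝ) ^ (s + 3) := by
          gcongr
          exact_mod_cast (show 2 ≤ n by omega)
        _ = (n : ℝ) ^ (s + 4) := by
          rw [← Real.rpow_one_add' hn0.le (by linarith)]
          congr 1
          ring
        _ ≤ (n : ℝ) ^ (δ * Q) := by
          refine Real.rpow_le_rpow_of_exponent_le hn1 ?_
          rw [← div_le_iff₀' hδ, hQ]
          exact Nat.le_ceil _
        _ = ((n : ℝ) ^ δ) ^ Q := by rw [Real.rpow_mul hn0.le, Real.rpow_natCast]
        _ ≤ (l : ℝ) ^ Q := by gcongr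
    exact_mod_cast this
  -- Bertrand's postulate again: the modulus of the functions g_j exceeds every collapsed key and is
  -- at most 2N.
  obtain ⟨pF, hpF, hNpF, hpFN⟩ := Nat.exists_prime_lt_and_le_two_mul N hN.ne'
  have hadm : Admissible n u k c q l m r N p pF :=
    { u_large := by omega, n_le := hnu, small := by omega, two_le_r := hr, r_le := hru
      N_pos := hN, N_le := hNu, N_le_p := hNp, p_le := hpu, pF_le := hpFN, l_pos := by omega
      l_le := hln, l_pow := fun d hd => Nat.pow_lt_of_lt_clog (hq ▸ hd), m_pos := by omega
      m_le := hm2, k_pos := hk, k_le := by omega, r_pow := hrk }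
  have hspace := hadm.space_le hNσ hpσ hkk₀ hqQ hkε
  obtain ⟨kH, kF, kK, H, F, K, ds, hH, hF, hK, htime, hds, hπ, hunif⟩ :=
    hadm.exists_ds (by rw [hc]; exact Nat.ceil_pos.2 (by positivity)) hkC hpF hNpF.le hNq
      hcol hP hM
  refine ⟨ds, ?_, ?_, ?_, ?_⟩
  · intro S hS
    obtain ⟨B, hB, hBS⟩ := hunif (S := S) (ρ := 1 / (1 + ε / 4)) (by positivity) hcoll
      (by rw [hS, one_div_mul_eq_div, le_div_iff₀' (by positivity)]; exact hmge) hA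
    refine ⟨B, hB.trans ?_, hBS⟩
    rw [hS]
    refine (error_le hδ hA0 (by omega) (hc ▸ Nat.le_ceil _) hnl hm2).trans ?_
    exact div_le_div_of_nonneg_right (by linarith) (by positivity)
  · have h2 := time_le (s := s) hδ hδ1
    rw [← hc, ← hQ] at h2
    refine le_trans ?_ h2
    exact_mod_cast htime.trans (by omega : _ ≤ 20000 * (c + Q + 1))
  · rw [← ha, ← hT, ← hds] at hspace
    refine hspace.trans ?_
    rw [← hl] at hlog
    have hρ := one_le_logb hr
    have hZ : 0 ≤ Real.logb 2 (Real.logb 2 u) :=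
      Real.logb_nonneg one_lt_two (one_le_logb (by omega))
    have e1 : 2 * m * (1 + ε / 10) + a * l * Real.logb 2 n ≤ 2 * (1 + ε) * n := by
      have : m * (1 + ε / 10) ≤ (1 + ε / 2) * n * (1 + ε / 10) := by gcongr
      have : ε * ε * n ≤ 1 * ε * n := by gcongr
      linarith
    have e2 : (2 * m * (1 + ε / 10) + a * l * Real.logb 2 n) * Real.logb 2 r
        ≤ 2 * (1 + ε) * n * Real.logb 2 r := by gcongr
    have e3 : T * Real.logb 2 (Real.logb 2 u)
        ≤ (3 + 2 ^ (c + 2) * A + T) * Real.logb 2 (Real.logb 2 u) := by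
      gcongr
      linarith
    linarith
  · refine ⟨N, c, l, m, kC, kH, kF, kK, col, H, F, K, ?_, hl, ?_, ?_, ?_, hH, hF, hK, hπ⟩
    · rw [hc]
      refine le_trans ?_ (Nat.le_ceil _)
      gcongr
      norm_num
    · refine hmle.trans ?_
      gcongr
      linarith
    · refine hNe.trans ?_
      gcongr
      linarith
    · intro x y hxy
      refine (hcoll x y hxy).trans ?_
      gcongr
      linarith

end UniformHashing

/-! ### From large n to all n -/

namespace UniformHashing

lemma BuiltFromZ.mono {u r w n : ℕ} {ds : HashDS u r w} {δ ε ε' s D D' : ℝ}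
    (h : BuiltFromZ ds n δ ε s D) (hε : ε ≤ ε') (hD : D ≤ D') : BuiltFromZ ds n δ ε' s D' := by
  obtain ⟨N, c, l, m, kC, kH, kF, kK, col, H, F, K, hc, hl, hm, hN, hcol, h⟩ := h
  refine ⟨N, c, l, m, kC, kH, kF, kK, col, H, F, K, hc, hl, hm.trans ?_, hN.trans ?_,
    fun x y hxy => (hcol x y hxy).trans ?_, h⟩
  all_goals gcongr

end UniformHashing

/-- Simulating uniform hashing for a universe of size `u` and a range of size `r`. The factors
`κ` (word length `κ⌈log₂ u⌉`) and `C` (evaluation time) are absolute; `D`, `g` and `n₀` depend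
only on `δ`, `ε`, `s`. -/
theorem mainTheorem5 :
    ∃ κ C : ℕ, 0 < κ ∧
      ∀ δ ε s : ℝ, 0 < δ → δ < 1 → 0 < ε → 0 ≤ s →
        ∃ (D : ℝ) (g : ℕ → ℝ) (n₀ : ℕ),
          g =o[Filter.atTop] (fun n : ℕ => (n : ℝ)) ∧
          ∀ n u r : ℕ, 1 ≤ n → 1 < r → r ≤ u →
            ∃ ds : UniformHashing.HashDS u r (κ * Nat.clog 2 u),
              (∀ S : Finset (Fin u), S.card = n →
                ∃ B : Finset ds.Ω,
                  UniformHashing.prob B ≤ D / (n : ℝ) ^ (s + 1) ∧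
                  UniformHashing.UniformOnOutside ds.h S B) ∧
              (ds.time : ℝ) ≤ C * (max s 1 / δ) ∧
              (ds.space : ℝ) ≤ 2 * (1 + ε) * n * Real.logb 2 r + g n
                + D * Real.logb 2 (Real.logb 2 u) ∧
              (n₀ ≤ n → n ≤ u → UniformHashing.BuiltFromZ ds n δ ε s D) := by
  refine ⟨8, 240000, by norm_num, fun δ ε s hδ hδ1 hε hs => ?_⟩
  -- The construction assumes ε ≤ 1, which gives m ≤ 2n; a smaller ε only strengthens the claims.
  have hε' : 0 < min ε 1 := lt_min hε one_pos
  obtain ⟨D, n₀, hD, hds⟩ :=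
    UniformHashing.exists_ds_of_large hδ hδ1 hε' (min_le_right ε 1) hs
  have hD' : 0 ≤ D + (n₀ : ℝ) ^ (s + 1) := by positivity
  have hDle : D ≤ D + (n₀ : ℝ) ^ (s + 1) := le_add_of_nonneg_right (by positivity)
  -- The summand n₀^{s+1} makes the error bound at least 1 for n < n₀, where the whole sample space
  -- serves as bad event.
  refine ⟨D + (n₀ : ℝ) ^ (s + 1), fun _ => 0, n₀, Asymptotics.isLittleO_zero _ _,
    fun n u r hn hr hru => ?_⟩
  have hn0 : (0 : ℝ) < n := by exact_mod_cast hn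
  have hρ : 0 ≤ Real.logb 2 r := zero_le_one.trans (UniformHashing.one_le_logb hr)
  have hZ : 0 ≤ Real.logb 2 (Real.logb 2 u) :=
    Real.logb_nonneg one_lt_two (UniformHashing.one_le_logb (hr.trans_le hru))
  by_cases hlarge : n₀ ≤ n ∧ n ≤ u
  · obtain ⟨ds, hB, htime, hspace, hZf⟩ := hds n u r hlarge.1 hlarge.2 hr hru
    refine ⟨ds, fun S hS => ?_, by exact_mod_cast htime, hspace.trans ?_, fun _ _ => ?_⟩
    · obtain ⟨B, hB, hU⟩ := hB S hS
      exact ⟨B, hB.trans (div_le_div_of_nonneg_right hDle (by positivity)), hU⟩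
    · rw [add_zero]
      have := min_le_left ε 1
      gcongr
    · exact hZf.mono (min_le_left ε 1) hDle
  -- If n > u there is no set of size n, and if n < n₀ nothing is required of the function; a
  -- constant satisfies the time and space bounds.
  · refine ⟨UniformHashing.constDS u r _ (by omega), fun S hS => ⟨Finset.univ, ?_,
      UniformHashing.uniformOnOutside_univ _ S⟩, ?_, ?_, fun h1 h2 => (hlarge ⟨h1, h2⟩).elim⟩
    · have hnu : n ≤ u := hS ▸ (Finset.card_le_univ S).trans_eq (Fintype.card_fin u)
      have hlt : n < n₀ := by
        by_contra h
        exact hlarge ⟨by omega, hnu⟩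
      refine (UniformHashing.prob_le_one _).trans ?_
      rw [one_le_div (by positivity)]
      calc (n : ℝ) ^ (s + 1) ≤ (n₀ : ℝ) ^ (s + 1) := by gcongr
        _ ≤ D + (n₀ : ℝ) ^ (s + 1) := le_add_of_nonneg_left hD
    · have h1 : 1 ≤ max s 1 / δ := by
        rw [le_div_iff₀ hδ]
        linarith [le_max_right s 1]
      have h2 : ((UniformHashing.constDS u r (8 * Nat.clog 2 u) (by omega)).time : ℝ) = 1 := by
        simp [UniformHashing.constDS, UniformHashing.HashDS.time]
      rw [h2]
      push_cast
      linarith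
    · have h2 : ((UniformHashing.constDS u r (8 * Nat.clog 2 u) (by omega)).space : ℝ) = 0 := by
        simp [UniformHashing.constDS, UniformHashing.HashDS.space,
          UniformHashing.Instr.constBits]
      rw [h2]
      positivity
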